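/- Let $U\subset\mathbb R^N$ be open, with coordinates $u=(u^1,\dots,u^N)$. For smooth functions $g^{ij}, b^{ij}_k$ on $U$ and a constant $K$, consider the bracket of hydrodynamic type $$\{I,J\}=\int \frac{\delta I}{\delta u^i(x)}\Big(P^{ij}\frac{\delta J}{\delta u^j(x)}\Big)dx,\qquad P^{ij}=g^{ij}(u)\frac{d}{dx}+b^{ij}_k(u)\,u^k_x+K\,u^i_x\Big(\frac{d}{dx}\Big)^{-1}u^j_x ,$$ on smooth functionals of fields $u(x)$, $x\in\mathbb R$. Here fields are smooth, take values in $U$, and equal a constant outside a bounded interval (the same constant at both ends); variational derivatives are smooth and have the same behaviour at infinity; and $(d/dx)^{-1}$ is the skew-symmetric inverse of $d/dx$, with kernel $\tfrac12\operatorname{sgn}(x-y)$. The bracket is a Poisson bracket on $U$ if it is skew-symmetric and satisfies the Jacobi identity. Two Poisson brackets are compatible if all their linear combinations are Poisson brackets. Let $\{\cdot,\cdot\}_1$ be a Poisson bracket of this form on $U$, possibly degenerate, with an arbitrary constant $K_1$. Let $\{\cdot,\cdot\}_2$ be a Poisson bracket of this form on $U$ that is local ($K_2=0$) and nondegenerate,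 meaning that $\det(g_2^{ij})$ vanishes identically on no nonempty open subset of $U$. For an open convex $V\subset U$, a system of $N$ annihilators and a momentum of $\{\cdot,\cdot\}_2$ on $V$ consists of smooth functions $n^1,\dots,n^N,m$ on $V$ such that $dn^1,\dots,dn^N$ are linearly independent at every point of $V$, each $\int n^i(u)\,dx$ has zero bracket $\{\cdot,\cdot\}_2$ with every functional, and $\int m(u)\,dx$ generates the $x$-translations, i.e. $P_2^{ij}\,\partial m/\partial u^j=u^i_x$ (all for fields with values in $V$). Theorem. Every point of $U$ at which $\det(g_2^{ij})\neq0$ has an open convex neighbourhood $V\subset U$ on which such a system exists. Moreover, the following are equivalent: (a) $\{\cdot,\cdot\}_1$ and $\{\cdot,\cdot\}_2$ are compatible on $U$; (b) for every open convex $V\subset U$ and every system of $N$ annihilators and a momentum of $\{\cdot,\cdot\}_2$ on $V$, the $N+1$ functionals $\int n^1(u)\,dx,\dots,\int n^N(u)\,dx,\int m(u)\,dx$ are pairwise in involution with respect to $\{\cdot,\cdot\}_1$ on the fields with values in $V$; (c) every point of $U$ at which $\det(g_2^{ij})\ne 0$ has an open convex neighbourhood $V\subset U$ on which some system of $N$ annihilators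 and a momentum of $\{\cdot,\cdot\}_2$ is pairwise in involution with respect to $\{\cdot,\cdot\}_1$. -/

import Mathlib

open scoped ContDiff Topology

noncomputable section

/-- Coefficients of a bracket of hydrodynamic type on a coordinate domain of `ℝ^N`, with operator
`g^{ij}(u) d/dx + b^{ij}_k(u) u^k_x + K u^i_x (d/dx)⁻¹ u^j_x`; `b u i j k` is `b^{ij}_k(u)`.
The bracket is local (of Dubrovin–Novikov form) when `K = 0`. -/
structure HydroBracket (N : ℕ) where
  g : (Fin N → ℝ) → Fin N → Fin N → ℝ
  b : (Fin N → ℝ) → Fin N → Fin N → Fin N → ℝ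
  K : ℝ

/-- A field `u(x)` with values in `U`: smooth, and equal to a constant outside a bounded interval
(the same constant at both ends). -/
structure IsHydroField {N : ℕ} (U : Set (Fin N → ℝ)) (u : ℝ → Fin N → ℝ) : Prop where
  smooth : ContDiff ℝ ∞ u
  mem : ∀ x, u x ∈ U
  const_at_infinity : ∃ c : Fin N → ℝ, ∃ R : ℝ, ∀ x, R ≤ |x| → u x = c

/-- A smooth family of fields `w s`, `s ∈ S`, depending on `k` parameters, all equal to one
constant outside one bounded interval. -/
structure IsHydroFieldFamily {N : ℕ} (U : Set (Fin N → ℝ)) {k : ℕ} (S : Set (Fin k → ℝ))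
    (w : (Fin k → ℝ) → ℝ → Fin N → ℝ) : Prop where
  smooth : ContDiffOn ℝ ∞ (fun q : (Fin k → ℝ) × ℝ => w q.1 q.2) (S ×ˢ Set.univ)
  mem : ∀ s ∈ S, ∀ x, w s x ∈ U
  const_at_infinity : ∃ c : Fin N → ℝ, ∃ R : ℝ, ∀ s ∈ S, ∀ x, R ≤ |x| → w s x = c

/-- A smooth functional `I[u]` on the fields with values in `U`, with its variational derivative
`δI/δu^i(x) = varDeriv u x i`. The variational derivative is defined by
`d/dε I[u + ε v] = ∫ (δI/δu^i(x)) v^i(x) dx` for all compactly supported smooth `v`; along every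
smooth family of fields it is smooth in the parameters and in `x`, and it is constant in `x`
outside a bounded interval that is locally uniform in the parameters. -/
structure SmoothFunctional {N : ℕ} (U : Set (Fin N → ℝ)) where
  toFun : (ℝ → Fin N → ℝ) → ℝ
  varDeriv : (ℝ → Fin N → ℝ) → ℝ → Fin N → ℝ
  hasVarDeriv : ∀ u, IsHydroField U u → ∀ v : ℝ → Fin N → ℝ, ContDiff ℝ ∞ v → HasCompactSupport v →
    HasDerivAt (fun ε : ℝ => toFun (u + ε • v)) (∫ x, ∑ i, varDeriv u x i * v x i) 0
  smooth : ∀ (k : ℕ) (S : Set (Fin k → ℝ)) (w : (Fin k → ℝ) → ℝ → Fin N → ℝ), IsOpen S →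
    IsHydroFieldFamily U S w →
    ContDiffOn ℝ ∞ (fun q : (Fin k → ℝ) × ℝ => varDeriv (w q.1) q.2) (S ×ˢ Set.univ)
  const_at_infinity : ∀ (k : ℕ) (S : Set (Fin k → ℝ)) (w : (Fin k → ℝ) → ℝ → Fin N → ℝ),
    IsOpen S → IsHydroFieldFamily U S w → ∀ s₀ ∈ S, ∃ R : ℝ, ∀ᶠ s in 𝓝 s₀,
      ∃ c : Fin N → ℝ, ∀ x, R ≤ |x| → varDeriv (w s) x = c

/-- The skew-symmetric inverse of `d/dx`, with kernel `(1/2) sgn (x - y)`. -/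
def invD (f : ℝ → ℝ) (x : ℝ) : ℝ :=
  (1 / 2) * ((∫ y in Set.Iic x, f y) - ∫ y in Set.Ioi x, f y)

/-- The variational derivative `∂f/∂u^i (u(x))` of the functional `∫ f(u(x)) dx` of hydrodynamic
type with density `f`. -/
def densityDeriv {N : ℕ} (f : (Fin N → ℝ) → ℝ) (u : ℝ → Fin N → ℝ) : ℝ → Fin N → ℝ :=
  fun x i => fderiv ℝ f (u x) (Pi.single i 1)

namespace HydroBracket

variable {N : ℕ}

/-- The coefficients `g^{ij}` and `b^{ij}_k` are smooth functions on `U`. -/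
def SmoothOn (P : HydroBracket N) (U : Set (Fin N → ℝ)) : Prop :=
  (∀ i j, ContDiffOn ℝ ∞ (fun u => P.g u i j) U) ∧
    ∀ i j k, ContDiffOn ℝ ∞ (fun u => P.b u i j k) U

/-- The operator of the bracket at the field `u`, applied to a covector `ξ_j(x)`. -/
def op (P : HydroBracket N) (u ξ : ℝ → Fin N → ℝ) : ℝ → Fin N → ℝ := fun x i =>
  (∑ j, P.g (u x) i j * deriv ξ x j)
    + (∑ j, ∑ k, P.b (u x) i j k * deriv u x k * ξ x j)
    + P.K * deriv u x i * ∑ j, invD (fun y => deriv u y j * ξ y j) x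

/-- The value at the field `u` of the bracket of two functionals whose variational derivatives
at `u` are `ξ` and `ζ`. -/
def pairing (P : HydroBracket N) (u ξ ζ : ℝ → Fin N → ℝ) : ℝ :=
  ∫ x, ∑ i, ξ x i * P.op u ζ x i

/-- The functional `{I, J}`. -/
def bracket (P : HydroBracket N) {U : Set (Fin N → ℝ)} (I J : SmoothFunctional U) :
    (ℝ → Fin N → ℝ) → ℝ :=
  fun u => P.pairing u (I.varDeriv u) (J.varDeriv u)

/-- The Hamiltonian vector field `u^i_t = P^{ij} δL/δu^j(x)` of the functional `L`. -/
def hamVec (P : HydroBracket N) {U : Set (Fin N → ℝ)} (L : SmoothFunctional U)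
    (u : ℝ → Fin N → ℝ) : ℝ → Fin N → ℝ :=
  P.op u (L.varDeriv u)

/-- The bracket is a Poisson bracket on the functionals of fields with values in `U`: it is
skew-symmetric and satisfies the Jacobi identity
`{{I, J}, L} + {{J, L}, I} + {{L, I}, J} = 0`. Here `{F, L}[u]`, for the functional `F = {I, J}`,
is the derivative `∫ (δF/δu^i(x)) P^{ij} (δL/δu^j(x)) dx` of `F` along the Hamiltonian vector
field of `L`. -/
def IsPoisson (P : HydroBracket N) (U : Set (Fin N → ℝ)) : Prop :=
  (∀ I J : SmoothFunctional U, ∀ u, IsHydroField U u → P.bracket I J u = - P.bracket J I u) ∧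
  ∀ I J L : SmoothFunctional U, ∀ u, IsHydroField U u → ∃ a₁ a₂ a₃ : ℝ,
    HasDerivAt (fun ε : ℝ => P.bracket I J (u + ε • P.hamVec L u)) a₁ 0 ∧
    HasDerivAt (fun ε : ℝ => P.bracket J L (u + ε • P.hamVec I u)) a₂ 0 ∧
    HasDerivAt (fun ε : ℝ => P.bracket L I (u + ε • P.hamVec J u)) a₃ 0 ∧
    a₁ + a₂ + a₃ = 0

/-- The bracket `α {·,·}_P + β {·,·}_Q`. -/
def linComb (α : ℝ) (P : HydroBracket N) (β : ℝ) (Q : HydroBracket N) : HydroBracket N where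
  g := fun u i j => α * P.g u i j + β * Q.g u i j
  b := fun u i j k => α * P.b u i j k + β * Q.b u i j k
  K := α * P.K + β * Q.K

/-- Compatibility: every linear combination of the two brackets is a Poisson bracket. -/
def Compatible (P Q : HydroBracket N) (U : Set (Fin N → ℝ)) : Prop :=
  ∀ α β : ℝ, (linComb α P β Q).IsPoisson U

/-- Nondegeneracy: `det g^{ij}` vanishes identically on no nonempty open subset of `U`. -/
def Nondegenerate (P : HydroBracket N) (U : Set (Fin N → ℝ)) : Prop :=
  U ⊆ closure {a | a ∈ U ∧ Matrix.det (Matrix.of (P.g a)) ≠ 0}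

/-- `∫ f(u(x)) dx` is an annihilator of the bracket on `V`: its bracket with every functional
vanishes. -/
def IsAnnihilator (P : HydroBracket N) (V : Set (Fin N → ℝ)) (f : (Fin N → ℝ) → ℝ) : Prop :=
  ∀ J : SmoothFunctional V, ∀ u, IsHydroField V u →
    P.pairing u (densityDeriv f u) (J.varDeriv u) = 0

/-- `∫ m(u(x)) dx` is a momentum of the bracket on `V`: it generates the translations
`u^i_t = u^i_x`. -/
def IsMomentum (P : HydroBracket N) (V : Set (Fin N → ℝ)) (m : (Fin N → ℝ) → ℝ) : Prop :=
  ∀ u, IsHydroField V u → P.op u (densityDeriv m u) = deriv u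

/-- `n^1, …, n^N` are smooth, functionally independent densities of annihilators, and `m` is a
smooth density of a momentum, of the bracket on `V`. -/
structure IsAnnihilatorsAndMomentum (P : HydroBracket N) (V : Set (Fin N → ℝ))
    (n : Fin N → (Fin N → ℝ) → ℝ) (m : (Fin N → ℝ) → ℝ) : Prop where
  smooth_annihilator : ∀ i, ContDiffOn ℝ ∞ (n i) V
  smooth_momentum : ContDiffOn ℝ ∞ m V
  independent : ∀ a ∈ V, LinearIndependent ℝ (fun i => fderiv ℝ (n i) a)
  annihilator : ∀ i, P.IsAnnihilator V (n i)
  momentum : P.IsMomentum V m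

/-- The functionals `∫ h_α(u(x)) dx` are pairwise in involution on the fields with values
in `V`. -/
def InInvolution (P : HydroBracket N) (V : Set (Fin N → ℝ)) {ι : Type}
    (h : ι → (Fin N → ℝ) → ℝ) : Prop :=
  ∀ α β : ι, ∀ u, IsHydroField V u → P.pairing u (densityDeriv (h α) u) (densityDeriv (h β) u) = 0

/-- The `N` annihilators with densities `n^i` and the momentum with density `m` are in involution
(all `N + 1` functionals, pairwise). -/
def AnnihilatorsAndMomentumInInvolution (P : HydroBracket N) (V : Set (Fin N → ℝ))
    (n : Fin N → (Fin N → ℝ) → ℝ) (m : (Fin N → ℝ) → ℝ) : Prop :=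
  P.InInvolution V (fun α : Option (Fin N) => α.elim m n)

end HydroBracket

end

set_option maxSynthPendingDepth 3

/-! ### Pointwise algebra of the coefficients -/

/-! Every condition in the theorem turns out to be pointwise on `U`. If functionals with prescribed
variational derivatives are inserted in the Jacobi identity, integration by parts reduces it to the
integral of three algebraic expressions in `g`, `b`, `∂b` and `K`: `obsA`, `obsB` and `obsC`, of
degree two, one and zero in the derivatives of the covectors. Test fields `p + e φ v` isolate these
one at a time (`IsPoisson.jet_isPoisson`). Conversely, if they vanish, the second variations of the
functionals cancel by skew-symmetry and by symmetry of the second variation (`isPoisson_of_jet`).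
So, for smooth coefficients on an open set, a bracket is Poisson exactly when `g` is symmetric, `∂g
= b + bᵗ`, and the three obstructions vanish. This needs no nondegeneracy, so the first bracket may
degenerate.

The obstructions are quadratic in the bracket, hence compatibility is the vanishing of their mixed
parts. Where `g₂` is invertible, the mixed parts of types A and B force that of type C
(`HydroJet.obsC_mixed_eq_zero`), so only `HydroJet.Mixed` remains; density of the nondegenerate
points and continuity give the conditions on all of `U` (`compatible_of_mixed`).

Involution is pointwise too. The variation of the first bracket of two functionals of hydrodynamic
type is `∫ ω(δu, u_x) dx` with a 2-form `ω`, namely `HydroJet.closedForm`. The bracket vanishes on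
all fields of a convex `V` exactly when `ω = 0`: test fields give one direction
(`closedForm_eq_zero`), contraction of a field to a constant gives the other
(`pairing_comp_eq_zero`).

The link is the connection `-g₂⁻¹ b₂`. Differentials of annihilators are parallel for it, and the
derivative of the differential of a momentum is the parallel one plus `g₂⁻¹`. Since `ω` is bilinear
and the `dn^i` span, vanishing on pairs of annihilators is vanishing on all pairs of parallel
covectors; after subtraction of this part, the pairs with the momentum see `g₂⁻¹` alone. The `g₂⁻¹`
part is the mixed obstruction A, and the parallel part is the mixed obstruction B once A vanishes
(`obsA_mixed_eq`, `obsB_mixed_eq`, `IsFrame.mixed_iff`).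

Annihilators and momenta exist because their equations form a linear total differential system whose
integrability is the symmetry and flatness of this connection; it is solved along rays
(`exists_forall_hasFDerivAt_of_flat`). -/

/-- The pairing `Σ ξ_i v^i` of covectors and vectors in coordinates. -/
noncomputable def pairL {N : ℕ} : (Fin N → ℝ) →L[ℝ] (Fin N → ℝ) →L[ℝ] ℝ :=
  ∑ i, (ContinuousLinearMap.proj (R := ℝ) (φ := fun _ : Fin N => ℝ) i).smulRight
    (ContinuousLinearMap.proj (R := ℝ) (φ := fun _ : Fin N => ℝ) i)

local notation "⟪" ξ "," v "⟫" => pairL ξ v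

theorem pairL_apply {N : ℕ} (ξ v : Fin N → ℝ) : ⟪ξ, v⟫ = ∑ i, ξ i * v i := by
  simp [pairL]

theorem pairL_single_left {N : ℕ} (i : Fin N) (v : Fin N → ℝ) :
    ⟪Pi.single i (1 : ℝ), v⟫ = v i := by
  simp [pairL_apply, Pi.single_apply]

theorem eq_of_forall_pairL {N : ℕ} {v w : Fin N → ℝ} (h : ∀ ξ : Fin N → ℝ, ⟪ξ, v⟫ = ⟪ξ, w⟫) :
    v = w := by
  funext i
  simpa [pairL_single_left] using h (Pi.single i 1)

/-- The values at a point of the coefficients `g`, `b`, of the derivative of `b`, and the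
constant `K` of a bracket of hydrodynamic type. -/
structure HydroJet (N : ℕ) where
  G : (Fin N → ℝ) →L[ℝ] (Fin N → ℝ)
  B : (Fin N → ℝ) →L[ℝ] (Fin N → ℝ) →L[ℝ] (Fin N → ℝ)
  D : (Fin N → ℝ) →L[ℝ] (Fin N → ℝ) →L[ℝ] (Fin N → ℝ) →L[ℝ] (Fin N → ℝ)
  K : ℝ

namespace HydroJet

variable {N : ℕ}

/-- Linear combination of the data at a point. -/
noncomputable def comb (α : ℝ) (X : HydroJet N) (β : ℝ) (Y : HydroJet N) : HydroJet N where
  G := α • X.G + β • Y.G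
  B := α • X.B + β • Y.B
  D := α • X.D + β • Y.D
  K := α * X.K + β * Y.K

/-- The curl of `b^{ij}_k` in its lower index, corrected by the constant curvature term. -/
noncomputable def curv (X : HydroJet N) (h v ξ η : Fin N → ℝ) : ℝ :=
  ⟪ξ, X.D h v η⟫ - ⟪ξ, X.D v h η⟫ - X.K * (⟪ξ, h⟫ * ⟪η, v⟫ - ⟪η, h⟫ * ⟪ξ, v⟫)

/-- Obstruction of second order in the derivatives of the covectors. -/
noncomputable def obsA (X Y : HydroJet N) (ξ η ζ : Fin N → ℝ) : ℝ :=
  ⟪η, X.B (Y.G ζ) ξ⟫ - ⟪ζ, X.B (Y.G η) ξ⟫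

/-- Obstruction of first order in the derivatives of the covectors. -/
noncomputable def obsB (X Y : HydroJet N) (v ξ η ζ : Fin N → ℝ) : ℝ :=
  X.curv (Y.G ζ) v ξ η + ⟪ζ, X.B (Y.B v ξ) η⟫ - ⟪ζ, X.B (Y.B v η) ξ⟫

/-- Obstruction of order zero in the derivatives of the covectors. -/
noncomputable def obsC (X Y : HydroJet N) (v ξ η ζ : Fin N → ℝ) : ℝ :=
  X.curv (Y.B v ζ) v ξ η + X.curv (Y.B v ξ) v η ζ + X.curv (Y.B v η) v ζ ξ

/-- The pointwise conditions for a bracket to be Poisson, other than `∂_k g^{ij} = b^{ij}_k + b^{ji}_k`. -/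
structure IsPoisson (X : HydroJet N) : Prop where
  symm : ∀ ξ η, ⟪ξ, X.G η⟫ = ⟪η, X.G ξ⟫
  obsA : ∀ ξ η ζ, X.obsA X ξ η ζ = 0
  obsB : ∀ v ξ η ζ, X.obsB X v ξ η ζ = 0
  obsC : ∀ v ξ η ζ, X.obsC X v ξ η ζ = 0

/-- The vanishing of the mixed obstructions of two brackets. -/
structure Mixed (X Y : HydroJet N) : Prop where
  obsA : ∀ ξ η ζ, X.obsA Y ξ η ζ + Y.obsA X ξ η ζ = 0
  obsB : ∀ v ξ η ζ, X.obsB Y v ξ η ζ + Y.obsB X v ξ η ζ = 0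

/-- Each obstruction is linear in the outer and in the inner bracket, so on a pencil it is a
quadratic form in `(α, β)`; the cross term is the mixed obstruction. The same holds for `obsB` and
`obsC`. -/
theorem obsA_comb (α β : ℝ) (X Y : HydroJet N) (ξ η ζ : Fin N → ℝ) :
    (comb α X β Y).obsA (comb α X β Y) ξ η ζ = α ^ 2 * X.obsA X ξ η ζ
      + α * β * (X.obsA Y ξ η ζ + Y.obsA X ξ η ζ) + β ^ 2 * Y.obsA Y ξ η ζ := by
  simp only [obsA, comb, add_apply, smul_apply, map_add,
    map_smul, smul_eq_mul]
  ring

theorem obsB_comb (α β : ℝ) (X Y : HydroJet N) (v ξ η ζ : Fin N → ℝ) :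
    (comb α X β Y).obsB (comb α X β Y) v ξ η ζ = α ^ 2 * X.obsB X v ξ η ζ
      + α * β * (X.obsB Y v ξ η ζ + Y.obsB X v ξ η ζ) + β ^ 2 * Y.obsB Y v ξ η ζ := by
  simp only [obsB, curv, comb, add_apply, smul_apply,
    map_add, map_smul, smul_eq_mul]
  ring

theorem obsC_comb (α β : ℝ) (X Y : HydroJet N) (v ξ η ζ : Fin N → ℝ) :
    (comb α X β Y).obsC (comb α X β Y) v ξ η ζ = α ^ 2 * X.obsC X v ξ η ζ
      + α * β * (X.obsC Y v ξ η ζ + Y.obsC X v ξ η ζ) + β ^ 2 * Y.obsC Y v ξ η ζ := by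
  simp only [obsC, curv, comb, add_apply, smul_apply,
    map_add, map_smul, smul_eq_mul]
  ring

theorem IsPoisson.mixed {X Y : HydroJet N} (hX : X.IsPoisson) (hY : Y.IsPoisson)
    (h : (comb 1 X 1 Y).IsPoisson) : Mixed X Y where
  obsA ξ η ζ := by
    have := h.obsA ξ η ζ
    rw [obsA_comb, hX.obsA, hY.obsA] at this
    linarith
  obsB v ξ η ζ := by
    have := h.obsB v ξ η ζ
    rw [obsB_comb, hX.obsB, hY.obsB] at this
    linarith

/-- The cross term of type C is a separate hypothesis because `Mixed` omits it; it is supplied later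
from nondegeneracy of one of the brackets. -/
theorem IsPoisson.comb {X Y : HydroJet N} (hX : X.IsPoisson) (hY : Y.IsPoisson)
    (h : Mixed X Y) (hC : ∀ v ξ η ζ, X.obsC Y v ξ η ζ + Y.obsC X v ξ η ζ = 0) (α β : ℝ) :
    (HydroJet.comb α X β Y).IsPoisson where
  symm ξ η := by
    simp only [HydroJet.comb, add_apply, smul_apply,
      map_add, map_smul, hX.symm ξ η, hY.symm ξ η]
  obsA ξ η ζ := by rw [obsA_comb, hX.obsA, hY.obsA, h.obsA]; ring
  obsB v ξ η ζ := by rw [obsB_comb, hX.obsB, hY.obsB, h.obsB]; ring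
  obsC v ξ η ζ := by rw [obsC_comb, hX.obsC, hY.obsC, hC]; ring

/-- The density of the variation of the bracket of two functionals with fixed variational
derivatives, with 1-jets `(ξ, ξ')`, `(η, η')`, along the vector `h`; the numbers `x`, `y` stand for
the values of `(d/dx)⁻¹` of `u_x · ξ` and `u_x · η`. -/
noncomputable def variation (X : HydroJet N) (v ξ ξ' : Fin N → ℝ) (x : ℝ) (η η' : Fin N → ℝ)
    (y : ℝ) (h : Fin N → ℝ) : ℝ :=
  ⟪η', X.B h ξ⟫ - ⟪ξ', X.B h η⟫ + X.curv h v ξ η - X.K * (⟪ξ', h⟫ * y - ⟪η', h⟫ * x)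

/-- The value of the operator of the bracket on the 1-jet `(ζ, ζ')`. -/
noncomputable def opVal (X : HydroJet N) (v ζ ζ' : Fin N → ℝ) (z : ℝ) : Fin N → ℝ :=
  X.G ζ' + X.B v ζ + (X.K * z) • v

/-- The pointwise core of the Jacobi identity. The values `x`, `y`, `z` of the nonlocal terms are
arbitrary numbers here: they cancel in the cyclic sum, leaving only local obstructions. -/
theorem sum_variation (X : HydroJet N) (hG : ∀ ξ η, ⟪ξ, X.G η⟫ = ⟪η, X.G ξ⟫)
    (v ξ ξ' : Fin N → ℝ) (x : ℝ) (η η' : Fin N → ℝ) (y : ℝ) (ζ ζ' : Fin N → ℝ) (z : ℝ) :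
    X.variation v ξ ξ' x η η' y (X.opVal v ζ ζ' z)
      + X.variation v η η' y ζ ζ' z (X.opVal v ξ ξ' x)
      + X.variation v ζ ζ' z ξ ξ' x (X.opVal v η η' y)
    = X.obsA X ξ η' ζ' + X.obsA X η ζ' ξ' + X.obsA X ζ ξ' η'
      + X.obsB X v ξ η ζ' + X.obsB X v η ζ ξ' + X.obsB X v ζ ξ η' + X.obsC X v ξ η ζ := by
  simp only [variation, opVal, obsA, obsB, obsC, curv, add_apply,
    smul_apply, map_add, map_smul, smul_eq_mul]
  rw [hG ξ' ζ', hG η' ζ', hG η' ξ']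
  ring

/-- The exterior derivative of the 1-form `⟪ξ, G (T ·) + B · η⟫ + K n ⟪ξ, ·⟫`, where `ξ` and
`η = dn` have the derivatives `S` and `T`. -/
noncomputable def closedForm (X : HydroJet N) (ξ : Fin N → ℝ) (S : (Fin N → ℝ) →L[ℝ] (Fin N → ℝ))
    (η : Fin N → ℝ) (T : (Fin N → ℝ) →L[ℝ] (Fin N → ℝ)) (w v : Fin N → ℝ) : ℝ :=
  (⟪S w, X.G (T v)⟫ + ⟪S w, X.B v η⟫ + ⟪T v, X.B w ξ⟫)
    - (⟪S v, X.G (T w)⟫ + ⟪S v, X.B w η⟫ + ⟪T w, X.B v ξ⟫) + X.curv w v ξ η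

/-! ### Mixed obstructions when one bracket is nondegenerate -/

section Nondegenerate

variable {Y : HydroJet N} {H : (Fin N → ℝ) →L[ℝ] (Fin N → ℝ)}

/-- The derivatives `v ↦ -G⁻¹ (B v ξ)` of covectors that are parallel for the connection of a
nondegenerate bracket; `H` is the inverse of `G`. -/
noncomputable def parallel (Y : HydroJet N) (H : (Fin N → ℝ) →L[ℝ] (Fin N → ℝ)) :
    (Fin N → ℝ) →L[ℝ] (Fin N → ℝ) →L[ℝ] (Fin N → ℝ) :=
  -((ContinuousLinearMap.compL ℝ (Fin N → ℝ) (Fin N → ℝ) (Fin N → ℝ) H).comp Y.B.flip)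

theorem parallel_apply (ξ v : Fin N → ℝ) : Y.parallel H ξ v = -H (Y.B v ξ) := by
  simp [parallel]

theorem B_eq_parallel (hGH : ∀ v, Y.G (H v) = v) (ξ v : Fin N → ℝ) :
    Y.B v ξ = -Y.G (Y.parallel H ξ v) := by
  simp [parallel_apply, hGH]

theorem pairL_inv_comm (hGH : ∀ v, Y.G (H v) = v) (hY : Y.IsPoisson) (v w : Fin N → ℝ) :
    ⟪H v, w⟫ = ⟪H w, v⟫ := by
  have := hY.symm (H v) (H w)
  rwa [hGH, hGH] at this

/-- Obstruction A of a nondegenerate bracket says that its connection is torsion-free, so that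
parallel 1-forms are closed. -/
theorem pairL_parallel_comm (hGH : ∀ v, Y.G (H v) = v) (hY : Y.IsPoisson) (ξ v w : Fin N → ℝ) :
    ⟪Y.parallel H ξ v, w⟫ = ⟪Y.parallel H ξ w, v⟫ := by
  have h := hY.obsA ξ (H v) (H w)
  simp only [HydroJet.obsA, hGH] at h
  simp only [parallel_apply, map_neg, neg_apply]
  rw [pairL_inv_comm hGH hY, pairL_inv_comm hGH hY (Y.B w ξ)]
  linarith

/-- Moving `G` and a parallel derivative across the pairing. -/
theorem pairL_G_parallel (hGH : ∀ v, Y.G (H v) = v) (hY : Y.IsPoisson) (ξ p w : Fin N → ℝ) :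
    ⟪p, Y.G (Y.parallel H ξ w)⟫ = ⟪Y.parallel H ξ (Y.G p), w⟫ := by
  rw [hY.symm, pairL_parallel_comm hGH hY]

theorem pairL_B_parallel (hGH : ∀ v, Y.G (H v) = v) (hY : Y.IsPoisson) (a b θ : Fin N → ℝ) :
    ⟪a, Y.B b θ⟫ = -⟪Y.parallel H θ (Y.G a), b⟫ := by
  rw [B_eq_parallel hGH, map_neg, pairL_G_parallel hGH hY]

/-- Obstruction B at `ζ = H h` can be solved for the curl of `b`. This is the constant curvature
equation of the connection, the term with `K` being part of `curv`. -/
theorem curv_nondegenerate (hGH : ∀ v, Y.G (H v) = v) (hY : Y.IsPoisson)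
    (h v ξ η : Fin N → ℝ) :
    Y.curv h v ξ η = ⟪Y.parallel H ξ h, Y.G (Y.parallel H η v)⟫
      - ⟪Y.parallel H η h, Y.G (Y.parallel H ξ v)⟫ := by
  have h1 := hY.obsB v ξ η (H h)
  simp only [HydroJet.obsB, hGH, pairL_B_parallel hGH hY] at h1
  simp only [pairL_G_parallel hGH hY]
  linarith

variable {X : HydroJet N}

/-- The pair `(0, H)` is the difference between the 1-jet of the differential of a momentum and its
parallel part. With value `0` in this slot the curvature term of `closedForm` disappears, and what
is left is of type A. -/
theorem obsA_mixed_eq (hGH : ∀ v, Y.G (H v) = v) (hHG : ∀ v, H (Y.G v) = v) (hY : Y.IsPoisson)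
    (ξ p q : Fin N → ℝ) :
    X.obsA Y ξ p q + Y.obsA X ξ p q
      = -X.closedForm ξ (Y.parallel H ξ) 0 H (Y.G p) (Y.G q) := by
  have e := fun a b => pairL_B_parallel hGH hY a (X.G b) ξ
  simp only [HydroJet.obsA, closedForm, curv, e, hHG, map_zero, zero_apply]
  ring

/-- Once `B` of the nondegenerate bracket is written through parallel derivatives, the two sides
differ by mixed obstructions of type A, with the parallel derivative of one covector along `v` as an
argument. Hence the hypothesis that these vanish. -/
theorem obsB_mixed_eq (hGH : ∀ v, Y.G (H v) = v) (hY : Y.IsPoisson)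
    (hX : ∀ ξ η, ⟪ξ, X.G η⟫ = ⟪η, X.G ξ⟫)
    (hA : ∀ ξ η ζ, X.obsA Y ξ η ζ + Y.obsA X ξ η ζ = 0) (v ξ η ζ : Fin N → ℝ) :
    X.obsB Y v ξ η ζ + Y.obsB X v ξ η ζ
      = X.closedForm ξ (Y.parallel H ξ) η (Y.parallel H η) (Y.G ζ) v := by
  have e := pairL_B_parallel hGH hY
  have h1 := hA ξ ζ (Y.parallel H η v)
  have h2 := hA η ζ (Y.parallel H ξ v)
  have h3 := curv_nondegenerate hGH hY (X.G ζ) v ξ η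
  simp only [HydroJet.obsA, e] at h1 h2
  simp only [HydroJet.obsB, closedForm, h3, e]
  simp only [B_eq_parallel hGH, map_neg, neg_apply]
  have k1 := pairL_parallel_comm hGH hY ξ (X.G ζ) (Y.G (Y.parallel H η v))
  have k2 := pairL_parallel_comm hGH hY η (X.G ζ) (Y.G (Y.parallel H ξ v))
  have k3 := hX (Y.parallel H ξ v) (Y.parallel H η (Y.G ζ))
  linarith

/-- The vector `Y.B v ζ` is `-Y.G` of the parallel derivative of `ζ` along `v`, so mixed obstruction
B with that derivative as last covector produces the curvature terms of `obsC`. The cyclic sum of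
three such identities leaves remainders that cancel by three instances of A and the symmetries of
`G` and of the connection. -/
theorem obsC_mixed_eq_zero (hGH : ∀ v, Y.G (H v) = v) (hY : Y.IsPoisson)
    (hX : ∀ ξ η, ⟪ξ, X.G η⟫ = ⟪η, X.G ξ⟫) (h : Mixed X Y) (v ξ η ζ : Fin N → ℝ) :
    X.obsC Y v ξ η ζ + Y.obsC X v ξ η ζ = 0 := by
  have hB := fun ξ η ζ => h.obsB v ξ η (Y.parallel H ζ v)
  simp only [obsB_mixed_eq hGH hY hX h.obsA, closedForm] at hB
  have b1 := hB ξ η ζ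
  have b2 := hB η ζ ξ
  have b3 := hB ζ ξ η
  have hN : ∀ a ξ η, X.curv (-a) v ξ η = -X.curv a v ξ η := fun a ξ η => by
    simp only [curv, map_neg, neg_apply]; ring
  have e := pairL_B_parallel hGH hY
  have a1 := h.obsA ξ (Y.parallel H ζ v) (Y.parallel H η v)
  have a2 := h.obsA η (Y.parallel H ξ v) (Y.parallel H ζ v)
  have a3 := h.obsA ζ (Y.parallel H η v) (Y.parallel H ξ v)
  simp only [HydroJet.obsA, e] at a1 a2 a3
  simp only [HydroJet.obsC, curv_nondegenerate hGH hY]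
  simp only [B_eq_parallel hGH, hN]
  have s := fun θ a b => pairL_parallel_comm hGH hY θ (X.B v a) (Y.G (Y.parallel H b v))
  have s1 := s ξ η ζ
  have s2 := s ξ ζ η
  have s3 := s η ξ ζ
  have s4 := s η ζ ξ
  have s5 := s ζ ξ η
  have s6 := s ζ η ξ
  have t := fun a b θ => hX (Y.parallel H θ (Y.G (Y.parallel H a v))) (Y.parallel H b v)
  have t1 := t ξ η ζ
  have t2 := t ξ ζ η
  have t3 := t η ξ ζ
  have t4 := t η ζ ξ
  have t5 := t ζ ξ η
  have t6 := t ζ η ξ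
  linarith

end Nondegenerate

end HydroJet

/-! ### The skew-symmetric inverse of `d/dx` -/

section InvD

variable {f k : ℝ → ℝ} {R : ℝ}

theorem hasCompactSupport_of_vanish {E : Type*} [Zero E] {f : ℝ → E}
    (hR : ∀ x, R ≤ |x| → f x = 0) : HasCompactSupport f := by
  refine HasCompactSupport.intro (isCompact_Icc (a := -R) (b := R)) fun x hx => hR x ?_
  by_contra h
  exact hx (abs_le.1 (not_le.1 h).le)

theorem integrable_of_vanish {E : Type*} [NormedAddCommGroup E] {f : ℝ → E} (hf : Continuous f)
    (hR : ∀ x, R ≤ |x| → f x = 0) : MeasureTheory.Integrable f :=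
  hf.integrable_of_hasCompactSupport (hasCompactSupport_of_vanish hR)

theorem integral_eq_intervalIntegral_of_vanish (hR : ∀ x, R ≤ |x| → f x = 0) :
    ∫ x, f x = ∫ x in (-R)..R, f x := by
  refine (intervalIntegral.integral_eq_integral_of_support_subset fun x hx => ?_).symm
  have : ¬ R ≤ |x| := fun h => hx (hR x h)
  have := abs_lt.1 (not_le.1 this)
  exact ⟨this.1, this.2.le⟩

/-- On a function supported in `[-R, R]` the skew inverse is the primitive based at `-R`, shifted by
half of the total integral; calculus then applies to integrals over intervals. -/
theorem invD_eq (hf : Continuous f) (hR : ∀ x, R ≤ |x| → f x = 0) (x : ℝ) :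
    invD f x = (∫ y in (-R)..x, f y) - (1 / 2) * ∫ y in (-R)..R, f y := by
  have hi := integrable_of_vanish hf hR
  have h1 : ∫ y in Set.Iic x, f y = ∫ y in (-R)..x, f y := by
    rw [← intervalIntegral.integral_Iic_sub_Iic hi.integrableOn hi.integrableOn,
      MeasureTheory.setIntegral_eq_zero_of_forall_eq_zero (t := Set.Iic (-R)), sub_zero]
    intro y hy
    exact hR y (by have := neg_abs_le y; have : y ≤ -R := hy; linarith)
  have h2 : (∫ y in Set.Iic x, f y) + ∫ y in Set.Ioi x, f y = ∫ y, f y :=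
    intervalIntegral.integral_Iic_add_Ioi hi.integrableOn hi.integrableOn
  rw [← integral_eq_intervalIntegral_of_vanish hR, ← h1, invD]
  linarith

theorem hasDerivAt_invD (hf : Continuous f) (hR : ∀ x, R ≤ |x| → f x = 0) (x : ℝ) :
    HasDerivAt (invD f) (f x) x := by
  have : invD f = fun x => (∫ y in (-R)..x, f y) - (1 / 2) * ∫ y in (-R)..R, f y :=
    funext (invD_eq hf hR)
  rw [this]
  exact (intervalIntegral.integral_hasDerivAt_right (hf.intervalIntegrable _ _)
    (hf.stronglyMeasurableAtFilter _ _) hf.continuousAt).sub_const _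

theorem continuous_invD (hf : Continuous f) (hR : ∀ x, R ≤ |x| → f x = 0) :
    Continuous (invD f) :=
  continuous_iff_continuousAt.2 fun x => (hasDerivAt_invD hf hR x).continuousAt

theorem contDiff_invD (hf : ContDiff ℝ ∞ f) (hR : ∀ x, R ≤ |x| → f x = 0) :
    ContDiff ℝ ∞ (invD f) := by
  rw [contDiff_infty_iff_deriv]
  refine ⟨fun x => (hasDerivAt_invD hf.continuous hR x).differentiableAt, ?_⟩
  rwa [funext fun x => (hasDerivAt_invD hf.continuous hR x).deriv]

theorem invD_add (hf : Continuous f) (hfR : ∀ x, R ≤ |x| → f x = 0) (hk : Continuous k)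
    (hkR : ∀ x, R ≤ |x| → k x = 0) (x : ℝ) :
    invD (fun y => f y + k y) x = invD f x + invD k x := by
  rw [invD_eq hf hfR, invD_eq hk hkR, invD_eq (R := R) (by fun_prop)
    (fun x hx => by rw [hfR x hx, hkR x hx, add_zero]),
    intervalIntegral.integral_add (hf.intervalIntegrable _ _) (hk.intervalIntegrable _ _),
    intervalIntegral.integral_add (hf.intervalIntegrable _ _) (hk.intervalIntegrable _ _)]
  ring

theorem integral_eq_zero_of_hasDerivAt_of_eq {F F' : ℝ → ℝ} (hF : ∀ x, HasDerivAt F (F' x) x)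
    (hF' : Continuous F') (hR : ∀ x, R ≤ |x| → F' x = 0) (h : F R = F (-R)) :
    ∫ x, F' x = 0 := by
  rw [integral_eq_intervalIntegral_of_vanish hR,
    intervalIntegral.integral_eq_sub_of_hasDerivAt (fun x _ => hF x) (hF'.intervalIntegrable _ _),
    h, sub_self]

/-- The operator `(d/dx)⁻¹` is skew-symmetric. -/
theorem integral_mul_invD (hf : Continuous f) (hfR : ∀ x, R ≤ |x| → f x = 0) (hk : Continuous k)
    (hkR : ∀ x, R ≤ |x| → k x = 0) :
    ∫ x, (f x * invD k x + k x * invD f x) = 0 := by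
  refine integral_eq_zero_of_hasDerivAt_of_eq (R := R) (F := fun x => invD f x * invD k x)
    (fun x => ?_) ?_ (fun x hx => by simp [hfR x hx, hkR x hx]) ?_
  · exact ((hasDerivAt_invD hf hfR x).mul (hasDerivAt_invD hk hkR x)).congr_deriv (by ring)
  · exact (hf.mul (continuous_invD hk hkR)).add (hk.mul (continuous_invD hf hfR))
  -- At `R` the two factors are half of the total integrals and at `-R` they are minus half, so
  -- their product agrees at both ends.
  · simp only [invD_eq hf hfR, invD_eq hk hkR, intervalIntegral.integral_same]
    ring

theorem invD_sum {ι : Type*} (s : Finset ι) {f : ι → ℝ → ℝ} (hf : ∀ i, Continuous (f i))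
    (hR : ∀ i x, R ≤ |x| → f i x = 0) (x : ℝ) :
    ∑ i ∈ s, invD (f i) x = invD (fun y => ∑ i ∈ s, f i y) x := by
  rw [invD_eq (R := R) (continuous_finsetSum _ fun i _ => hf i)
    (fun x hx => Finset.sum_eq_zero fun i _ => hR i x hx),
    Finset.sum_congr rfl fun i _ => invD_eq (hf i) (hR i) x,
    intervalIntegral.integral_finsetSum fun i _ => (hf i).intervalIntegrable _ _,
    intervalIntegral.integral_finsetSum fun i _ => (hf i).intervalIntegrable _ _,
    Finset.sum_sub_distrib, Finset.mul_sum]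

end InvD

/-! ### Integrals depending on a parameter -/

theorem hasDerivAt_intervalIntegral_of_continuous {F F' : ℝ → ℝ → ℝ} (hF : ∀ s, Continuous (F s))
    (hF' : Continuous fun q : ℝ × ℝ => F' q.1 q.2)
    (h : ∀ s x, HasDerivAt (fun s => F s x) (F' s x) s) (a b s₀ : ℝ) :
    HasDerivAt (fun s => ∫ x in a..b, F s x) (∫ x in a..b, F' s₀ x) s₀ := by
  obtain ⟨C, hC⟩ := ((isCompact_closedBall s₀ 1).prod (isCompact_uIcc (a := a) (b := b))).bddAbove_image
    (f := fun q : ℝ × ℝ => ‖F' q.1 q.2‖) hF'.norm.continuousOn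
  refine (intervalIntegral.hasDerivAt_integral_of_dominated_loc_of_deriv_le (bound := fun _ => C)
    (Metric.closedBall_mem_nhds s₀ one_pos)
    (Filter.Eventually.of_forall fun s => (hF s).aestronglyMeasurable)
    ((hF s₀).intervalIntegrable _ _) ?_ ?_ (by simp) ?_).2
  · exact (hF'.comp (by fun_prop : Continuous fun x : ℝ => (s₀, x))).aestronglyMeasurable
  · refine Filter.Eventually.of_forall fun x hx s hs => hC ⟨(s, x), ⟨hs, ?_⟩, rfl⟩
    exact Set.uIoc_subset_uIcc hx
  · exact Filter.Eventually.of_forall fun x _ s _ => h s x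

theorem continuous_intervalIntegral_prod {k : ℝ → ℝ → ℝ}
    (hk : Continuous fun q : ℝ × ℝ => k q.1 q.2) (a : ℝ) :
    Continuous fun q : ℝ × ℝ => ∫ y in a..q.2, k q.1 y :=
  intervalIntegral.continuous_parametric_intervalIntegral_of_continuous (f := fun (q : ℝ × ℝ) y => k q.1 y)
    (hk.comp (by fun_prop : Continuous fun p : (ℝ × ℝ) × ℝ => (p.1.1, p.2))) continuous_snd

section Families

variable {E : Type*} [NormedAddCommGroup E] [NormedSpace ℝ E] {w : ℝ → ℝ → E}

theorem HasFDerivAt.hasDerivAt_fst {F : ℝ × ℝ → E} {F' : ℝ × ℝ →L[ℝ] E} {s x : ℝ}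
    (hF : HasFDerivAt F F' (s, x)) : HasDerivAt (fun s => F (s, x)) (F' (1, 0)) s :=
  HasFDerivAt.comp_hasDerivAt (f := fun s => (s, x)) s hF
    ((hasDerivAt_id s).prodMk (hasDerivAt_const s x))

theorem HasFDerivAt.hasDerivAt_snd {F : ℝ × ℝ → E} {F' : ℝ × ℝ →L[ℝ] E} {s x : ℝ}
    (hF : HasFDerivAt F F' (s, x)) : HasDerivAt (fun x => F (s, x)) (F' (0, 1)) x :=
  HasFDerivAt.comp_hasDerivAt (f := fun x => (s, x)) x hF
    ((hasDerivAt_const x s).prodMk (hasDerivAt_id x))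

theorem hasDerivAt_family_left (hw : ContDiff ℝ ∞ fun q : ℝ × ℝ => w q.1 q.2) (s x : ℝ) :
    HasDerivAt (fun s => w s x) (fderiv ℝ (fun q : ℝ × ℝ => w q.1 q.2) (s, x) (1, 0)) s :=
  ((hw.differentiable (by simp)) (s, x)).hasFDerivAt.hasDerivAt_fst

theorem hasDerivAt_family_right (hw : ContDiff ℝ ∞ fun q : ℝ × ℝ => w q.1 q.2) (s x : ℝ) :
    HasDerivAt (w s) (fderiv ℝ (fun q : ℝ × ℝ => w q.1 q.2) (s, x) (0, 1)) x :=
  ((hw.differentiable (by simp)) (s, x)).hasFDerivAt.hasDerivAt_snd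

theorem contDiff_deriv_family_left (hw : ContDiff ℝ ∞ fun q : ℝ × ℝ => w q.1 q.2) :
    ContDiff ℝ ∞ fun q : ℝ × ℝ => deriv (fun s => w s q.2) q.1 := by
  have : (fun q : ℝ × ℝ => deriv (fun s => w s q.2) q.1)
      = fun q => fderiv ℝ (fun q : ℝ × ℝ => w q.1 q.2) q (1, 0) :=
    funext fun q => (hasDerivAt_family_left hw q.1 q.2).deriv
  rw [this]
  exact (hw.fderiv_right (m := ∞) (by simp)).clm_apply contDiff_const

theorem contDiff_deriv_family_right (hw : ContDiff ℝ ∞ fun q : ℝ × ℝ => w q.1 q.2) :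
    ContDiff ℝ ∞ fun q : ℝ × ℝ => deriv (w q.1) q.2 := by
  have : (fun q : ℝ × ℝ => deriv (w q.1) q.2)
      = fun q => fderiv ℝ (fun q : ℝ × ℝ => w q.1 q.2) q (0, 1) :=
    funext fun q => (hasDerivAt_family_right hw q.1 q.2).deriv
  rw [this]
  exact (hw.fderiv_right (m := ∞) (by simp)).clm_apply contDiff_const

theorem contDiff_section_left (hw : ContDiff ℝ ∞ fun q : ℝ × ℝ => w q.1 q.2) (x : ℝ) :
    ContDiff ℝ ∞ fun s => w s x :=
  hw.comp (contDiff_id.prodMk contDiff_const)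

theorem contDiff_section_right (hw : ContDiff ℝ ∞ fun q : ℝ × ℝ => w q.1 q.2) (s : ℝ) :
    ContDiff ℝ ∞ (w s) :=
  hw.comp (contDiff_const.prodMk contDiff_id)

/-- Both sides are mixed second derivatives of the family, so this is Schwarz's theorem in the form
needed to differentiate `u_x` in a parameter. -/
theorem hasDerivAt_deriv_family (hw : ContDiff ℝ ∞ fun q : ℝ × ℝ => w q.1 q.2) (s x : ℝ) :
    HasDerivAt (fun s => deriv (w s) x) (deriv (fun x => deriv (fun s => w s x) s) x) s := by
  have h2 : ContDiff ℝ ∞ (fderiv ℝ (fun q : ℝ × ℝ => w q.1 q.2)) := hw.fderiv_right (by simp)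
  have hd := (h2.differentiable (by simp) (s, x)).hasFDerivAt
  have e1 : (fun s => deriv (w s) x)
      = fun s => fderiv ℝ (fun q : ℝ × ℝ => w q.1 q.2) (s, x) (0, 1) :=
    funext fun s => (hasDerivAt_family_right hw s x).deriv
  have e2 : (fun x => deriv (fun s => w s x) s)
      = fun x => fderiv ℝ (fun q : ℝ × ℝ => w q.1 q.2) (s, x) (1, 0) :=
    funext fun x => (hasDerivAt_family_left hw s x).deriv
  have k1 := (ContinuousLinearMap.apply ℝ E ((0 : ℝ), (1 : ℝ))).hasFDerivAt.comp_hasDerivAt s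
    hd.hasDerivAt_fst
  have k2 := (ContinuousLinearMap.apply ℝ E ((1 : ℝ), (0 : ℝ))).hasFDerivAt.comp_hasDerivAt x
    hd.hasDerivAt_snd
  rw [e1, e2]
  refine k1.congr_deriv ?_
  refine Eq.trans ?_ (HasDerivAt.deriv k2).symm
  exact second_derivative_symmetric (fun q => (hw.differentiable (by simp) q).hasFDerivAt) hd _ _

end Families

/-! ### The coefficients of a bracket as linear maps -/

namespace HydroBracket

variable {N : ℕ} (P : HydroBracket N) {U : Set (Fin N → ℝ)}

/-- The linear map `ξ ↦ g^{ij} ξ_j`. -/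
noncomputable def gL (p : Fin N → ℝ) : (Fin N → ℝ) →L[ℝ] (Fin N → ℝ) :=
  ∑ i, ∑ j, P.g p i j • (ContinuousLinearMap.proj (R := ℝ) (φ := fun _ : Fin N => ℝ) j).smulRight
    (Pi.single i (1 : ℝ))

/-- The bilinear map `(v, ξ) ↦ b^{ij}_k v^k ξ_j`. -/
noncomputable def bL (p : Fin N → ℝ) : (Fin N → ℝ) →L[ℝ] (Fin N → ℝ) →L[ℝ] (Fin N → ℝ) :=
  ∑ i, ∑ j, ∑ k, P.b p i j k •
    (ContinuousLinearMap.proj (R := ℝ) (φ := fun _ : Fin N => ℝ) k).smulRight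
      ((ContinuousLinearMap.proj (R := ℝ) (φ := fun _ : Fin N => ℝ) j).smulRight
        (Pi.single i (1 : ℝ)))

/-- The data of the bracket at a point. -/
noncomputable def jet (p : Fin N → ℝ) : HydroJet N := ⟨P.gL p, P.bL p, fderiv ℝ P.bL p, P.K⟩

theorem gL_apply (p ξ : Fin N → ℝ) (i : Fin N) : P.gL p ξ i = ∑ j, P.g p i j * ξ j := by
  simp only [gL, sum_apply, smul_apply, ContinuousLinearMap.smulRight_apply,
    ContinuousLinearMap.proj_apply, Finset.sum_apply, Pi.smul_apply, smul_eq_mul, Pi.single_apply]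
  rw [Finset.sum_eq_single i] <;> simp +contextual [eq_comm]

theorem bL_apply (p v ξ : Fin N → ℝ) (i : Fin N) :
    P.bL p v ξ i = ∑ j, ∑ k, P.b p i j k * v k * ξ j := by
  simp only [bL, sum_apply, smul_apply, ContinuousLinearMap.smulRight_apply,
    ContinuousLinearMap.proj_apply, Finset.sum_apply, Pi.smul_apply, smul_eq_mul, Pi.single_apply]
  rw [Finset.sum_eq_single i]
  · simp [mul_assoc]
  · simp +contextual [eq_comm]
  · simp

theorem gL_eq_mulVec (p ξ : Fin N → ℝ) : P.gL p ξ = (Matrix.of (P.g p)).mulVec ξ := by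
  funext i
  rw [gL_apply]
  rfl

variable {P}

theorem SmoothOn.contDiffOn_gL (hP : P.SmoothOn U) : ContDiffOn ℝ ∞ P.gL U :=
  ContDiffOn.sum fun i _ => ContDiffOn.sum fun j _ => (hP.1 i j).smul contDiffOn_const

theorem SmoothOn.contDiffOn_bL (hP : P.SmoothOn U) : ContDiffOn ℝ ∞ P.bL U :=
  ContDiffOn.sum fun i _ => ContDiffOn.sum fun j _ => ContDiffOn.sum fun k _ =>
    (hP.2 i j k).smul contDiffOn_const

theorem SmoothOn.mono {V : Set (Fin N → ℝ)} (hP : P.SmoothOn U) (h : V ⊆ U) : P.SmoothOn V :=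
  ⟨fun i j => (hP.1 i j).mono h, fun i j k => (hP.2 i j k).mono h⟩

end HydroBracket

/-! ### Fields -/

section Fields

variable {N : ℕ} {U : Set (Fin N → ℝ)} {u ξ : ℝ → Fin N → ℝ}

/-- The margin `1` in the radius gives a neighbourhood on which the function is constant; nothing is
known about the derivative on the boundary `|x| = R`. -/
theorem deriv_eq_zero_of_const {E : Type*} [NormedAddCommGroup E] [NormedSpace ℝ E] {f : ℝ → E}
    {c : E} {R : ℝ} (h : ∀ x, R ≤ |x| → f x = c) (x : ℝ) (hx : R + 1 ≤ |x|) : deriv f x = 0 := by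
  have : f =ᶠ[𝓝 x] fun _ => c := by
    filter_upwards [(isOpen_lt continuous_const continuous_abs).mem_nhds
      (show R < |x| by linarith)] with y hy using h y hy.le
  rw [this.deriv_eq, deriv_const]

namespace IsHydroField

theorem exists_radius (h : IsHydroField U u) :
    ∃ c R, 0 ≤ R ∧ ∀ x, R ≤ |x| → u x = c ∧ deriv u x = 0 := by
  obtain ⟨c, R, hR⟩ := h.const_at_infinity
  refine ⟨c, |R| + 1, by positivity, fun x hx => ⟨hR x ?_, deriv_eq_zero_of_const hR x ?_⟩⟩ <;>
  linarith [le_abs_self R]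

theorem of_vanish (hξ : ContDiff ℝ ∞ ξ) {R : ℝ} (hR : ∀ x, R ≤ |x| → ξ x = 0) :
    IsHydroField Set.univ ξ :=
  ⟨hξ, fun _ => Set.mem_univ _, 0, R, hR⟩

theorem const {c : Fin N → ℝ} (hc : c ∈ U) : IsHydroField U fun _ => c :=
  ⟨contDiff_const, fun _ => hc, c, 0, fun _ _ => rfl⟩

theorem contDiff_deriv (h : IsHydroField U u) : ContDiff ℝ ∞ (deriv u) :=
  (contDiff_infty_iff_deriv.1 h.smooth).2

end IsHydroField

namespace HydroBracket

variable {P : HydroBracket N}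

theorem contDiff_pairL {E : Type*} [NormedAddCommGroup E] [NormedSpace ℝ E] {f k : E → Fin N → ℝ}
    (hf : ContDiff ℝ ∞ f) (hk : ContDiff ℝ ∞ k) : ContDiff ℝ ∞ fun x => ⟪f x, k x⟫ :=
  (pairL.contDiff.comp hf).clm_apply hk

theorem op_eq (hu : IsHydroField U u) (hξ : ContDiff ℝ ∞ ξ) (x : ℝ) :
    P.op u ξ x = (P.jet (u x)).opVal (deriv u x) (ξ x) (deriv ξ x)
      (invD (fun y => ⟪ξ y, deriv u y⟫) x) := by
  obtain ⟨c, R, -, hR⟩ := hu.exists_radius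
  have hc := hu.contDiff_deriv.continuous
  have hξc := hξ.continuous
  have e : ∑ j, invD (fun y => deriv u y j * ξ y j) x = invD (fun y => ⟪ξ y, deriv u y⟫) x := by
    rw [invD_sum (R := R) _ (fun j => by fun_prop) (fun j y hy => by simp [(hR y hy).2])]
    simp only [pairL_apply, mul_comm]
  funext i
  simp only [op, HydroJet.opVal, jet, Pi.add_apply, Pi.smul_apply, smul_eq_mul, gL_apply, bL_apply,
    e]
  ring

theorem pairing_eq (hu : IsHydroField U u) {η : ℝ → Fin N → ℝ} (hη : ContDiff ℝ ∞ η) :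
    P.pairing u ξ η = ∫ x, ⟪ξ x, (P.jet (u x)).opVal (deriv u x) (η x) (deriv η x)
      (invD (fun y => ⟪η y, deriv u y⟫) x)⟫ := by
  refine MeasureTheory.integral_congr_ae (Filter.Eventually.of_forall fun x => ?_)
  simp only [← op_eq hu hη, pairL_apply (ξ x)]

theorem SmoothOn.contDiff_gL_comp (hP : P.SmoothOn U) {E : Type*} [NormedAddCommGroup E]
    [NormedSpace ℝ E] {w : E → Fin N → ℝ} (hw : ContDiff ℝ ∞ w) (hwU : ∀ x, w x ∈ U) :
    ContDiff ℝ ∞ fun x => P.gL (w x) :=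
  hP.contDiffOn_gL.comp_contDiff hw hwU

theorem SmoothOn.contDiff_bL_comp (hP : P.SmoothOn U) {E : Type*} [NormedAddCommGroup E]
    [NormedSpace ℝ E] {w : E → Fin N → ℝ} (hw : ContDiff ℝ ∞ w) (hwU : ∀ x, w x ∈ U) :
    ContDiff ℝ ∞ fun x => P.bL (w x) :=
  hP.contDiffOn_bL.comp_contDiff hw hwU

theorem SmoothOn.contDiffOn_fderiv_bL (hP : P.SmoothOn U) (hU : IsOpen U) :
    ContDiffOn ℝ ∞ (fderiv ℝ P.bL) U :=
  hP.contDiffOn_bL.fderiv_of_isOpen hU (by simp)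

theorem SmoothOn.continuous_fderiv_bL_comp (hP : P.SmoothOn U) (hU : IsOpen U)
    {w : ℝ → Fin N → ℝ} (hw : Continuous w) (hwU : ∀ x, w x ∈ U) :
    Continuous fun x => fderiv ℝ P.bL (w x) :=
  (hP.contDiffOn_fderiv_bL hU).continuousOn.comp_continuous hw hwU

theorem SmoothOn.hasFDerivAt_gL (hP : P.SmoothOn U) (hU : IsOpen U) {p : Fin N → ℝ} (hp : p ∈ U) :
    HasFDerivAt P.gL (fderiv ℝ P.gL p) p :=
  ((hP.contDiffOn_gL.contDiffAt (hU.mem_nhds hp)).differentiableAt (by simp)).hasFDerivAt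

theorem SmoothOn.hasFDerivAt_bL (hP : P.SmoothOn U) (hU : IsOpen U) {p : Fin N → ℝ} (hp : p ∈ U) :
    HasFDerivAt P.bL (fderiv ℝ P.bL p) p :=
  ((hP.contDiffOn_bL.contDiffAt (hU.mem_nhds hp)).differentiableAt (by simp)).hasFDerivAt

theorem contDiff_invD_pairL (hu : IsHydroField U u) (hξ : ContDiff ℝ ∞ ξ) :
    ContDiff ℝ ∞ (invD fun y => ⟪ξ y, deriv u y⟫) := by
  obtain ⟨c, R, -, hR⟩ := hu.exists_radius
  exact contDiff_invD (R := R) (contDiff_pairL hξ hu.contDiff_deriv)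
    fun x hx => by rw [(hR x hx).2, map_zero]

theorem contDiff_op (hP : P.SmoothOn U) (hu : IsHydroField U u) (hξ : ContDiff ℝ ∞ ξ) :
    ContDiff ℝ ∞ (P.op u ξ) := by
  rw [funext (op_eq hu hξ)]
  have h1 := hP.contDiff_gL_comp hu.smooth hu.mem
  have h2 := hP.contDiff_bL_comp hu.smooth hu.mem
  have h3 := hu.contDiff_deriv
  have h4 := (contDiff_infty_iff_deriv.1 hξ).2
  have h5 := contDiff_invD_pairL hu hξ
  simp only [HydroJet.opVal, jet]
  exact ((h1.clm_apply h4).add ((h2.clm_apply h3).clm_apply hξ)).add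
    ((contDiff_const.mul h5).smul h3)

theorem op_vanish (hu : IsHydroField U u) (hξ : IsHydroField Set.univ ξ) :
    ∃ R, ∀ x, R ≤ |x| → P.op u ξ x = 0 := by
  obtain ⟨c, R, -, hR⟩ := hu.exists_radius
  obtain ⟨c', R', -, hR'⟩ := hξ.exists_radius
  refine ⟨max R R', fun x hx => ?_⟩
  rw [op_eq hu hξ.smooth, HydroJet.opVal, (hR x (le_trans (le_max_left _ _) hx)).2,
    (hR' x (le_trans (le_max_right _ _) hx)).2]
  simp

theorem integrable_pairing (hP : P.SmoothOn U) (hu : IsHydroField U u) (hξ : Continuous ξ)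
    {η : ℝ → Fin N → ℝ} (hη : IsHydroField Set.univ η) :
    MeasureTheory.Integrable fun x => ⟪ξ x, P.op u η x⟫ := by
  obtain ⟨R, hR⟩ := op_vanish (P := P) hu hη
  have := (contDiff_op hP hu hη.smooth).continuous
  exact integrable_of_vanish (R := R) (by fun_prop) fun x hx => by rw [hR x hx, map_zero]

/-- The condition `∂_k g^{ij} = b^{ij}_k + b^{ji}_k`. -/
def IsMetric (P : HydroBracket N) (U : Set (Fin N → ℝ)) : Prop :=
  ∀ p ∈ U, ∀ h ξ η, ⟪ξ, fderiv ℝ P.gL p h η⟫ = ⟪ξ, P.bL p h η⟫ + ⟪η, P.bL p h ξ⟫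

/-- The variation of the bracket of two functionals, with variational derivatives fixed to be
`ξ` and `η`, under the variation `h` of the field. -/
noncomputable def fieldVariation (P : HydroBracket N) (u ξ η h : ℝ → Fin N → ℝ) : ℝ :=
  ∫ x, (P.jet (u x)).variation (deriv u x) (ξ x) (deriv ξ x) (invD (fun y => ⟪ξ y, deriv u y⟫) x)
    (η x) (deriv η x) (invD (fun y => ⟪η y, deriv u y⟫) x) (h x)

/-- Integration by parts bringing the variation of the bracket to the form that is local
in the variation of the field. -/
theorem integral_variation (hU : IsOpen U) (hP : P.SmoothOn U) (hPm : P.IsMetric U)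
    (hu : IsHydroField U u) (hξ : IsHydroField Set.univ ξ) {η h : ℝ → Fin N → ℝ}
    (hη : IsHydroField Set.univ η) (hh : ContDiff ℝ ∞ h) {R₀ : ℝ}
    (hhR₀ : ∀ x, R₀ ≤ |x| → h x = 0) :
    ∫ x, (⟪ξ x, fderiv ℝ P.gL (u x) (h x) (deriv η x)⟫
        + ⟪ξ x, fderiv ℝ P.bL (u x) (h x) (deriv u x) (η x)⟫ + ⟪ξ x, P.bL (u x) (deriv h x) (η x)⟫
        + P.K * (⟪ξ x, deriv h x⟫ * invD (fun y => ⟪η y, deriv u y⟫) x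
          + ⟪ξ x, deriv u x⟫ * invD (fun y => ⟪η y, deriv h y⟫) x))
      = P.fieldVariation u ξ η h := by
  obtain ⟨c, R, -, hR⟩ := hu.exists_radius
  set ρ := max R (R₀ + 1)
  have hhR : ∀ x, ρ ≤ |x| → h x = 0 := fun x hx =>
    hhR₀ x (by linarith [le_max_right R (R₀ + 1)])
  have hh'R : ∀ x, ρ ≤ |x| → deriv h x = 0 := fun x hx =>
    deriv_eq_zero_of_const hhR₀ x (le_trans (le_max_right _ _) hx)
  have huR : ∀ x, ρ ≤ |x| → deriv u x = 0 := fun x hx => (hR x (le_trans (le_max_left _ _) hx)).2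
  have du := fun x => (hu.smooth.differentiable (by simp) x).hasDerivAt
  have dh := fun x => (hh.differentiable (by simp) x).hasDerivAt
  have dξ := fun x => (hξ.smooth.differentiable (by simp) x).hasDerivAt
  have dη := fun x => (hη.smooth.differentiable (by simp) x).hasDerivAt
  have cu := hu.contDiff_deriv.continuous
  have cu0 := hu.smooth.continuous
  have ch := hh.continuous
  have ch' := (contDiff_infty_iff_deriv.1 hh).2.continuous
  have cξ := hξ.smooth.continuous
  have cη := hη.smooth.continuous
  have cξ' := hξ.contDiff_deriv.continuous
  have cη' := hη.contDiff_deriv.continuous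
  have cB := (hP.contDiff_bL_comp hu.smooth hu.mem).continuous
  have cD := hP.continuous_fderiv_bL_comp hU cu0 hu.mem
  set X := invD fun y => ⟪ξ y, deriv u y⟫ with hX
  set Y := invD fun y => ⟪η y, deriv u y⟫ with hY
  have dX : ∀ x, HasDerivAt X ⟪ξ x, deriv u x⟫ x :=
    hasDerivAt_invD (R := ρ) (by fun_prop) fun x hx => by rw [huR x hx, map_zero]
  have dY : ∀ x, HasDerivAt Y ⟪η x, deriv u x⟫ x :=
    hasDerivAt_invD (R := ρ) (by fun_prop) fun x hx => by rw [huR x hx, map_zero]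
  have cX := (contDiff_invD_pairL hu hξ.smooth).continuous
  have cY := (contDiff_invD_pairL hu hη.smooth).continuous
  -- Total derivative of `⟪ξ, B h η⟫`: it removes `h_x` from the local term and turns `∂b` into its
  -- curl.
  have I₁ : ∫ x, (⟪deriv ξ x, P.bL (u x) (h x) (η x)⟫
      + ⟪ξ x, fderiv ℝ P.bL (u x) (deriv u x) (h x) (η x)⟫
      + ⟪ξ x, P.bL (u x) (deriv h x) (η x)⟫ + ⟪ξ x, P.bL (u x) (h x) (deriv η x)⟫) = 0 := by
    refine integral_eq_zero_of_hasDerivAt_of_eq (R := ρ)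
      (F := fun x => ⟪ξ x, P.bL (u x) (h x) (η x)⟫) (fun x => ?_) (by fun_prop)
      (fun x hx => by simp [hhR x hx, hh'R x hx, huR x hx])
      (by simp [hhR ρ (le_abs_self ρ), hhR (-ρ) (by rw [abs_neg]; exact le_abs_self ρ)])
    have dB := (hP.hasFDerivAt_bL hU (hu.mem x)).comp_hasDerivAt x (du x)
    have := (pairL.hasFDerivAt.comp_hasDerivAt x (dξ x)).clm_apply
      ((dB.clm_apply (dh x)).clm_apply (dη x))
    refine this.congr_deriv ?_
    simp only [Function.comp, add_apply, map_add]
    ring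
  -- Total derivative of `⟪ξ, h⟫ Y - ⟪η, h⟫ X`: it removes `h_x` from the nonlocal terms; the
  -- derivatives of `X` and `Y` give the constant curvature correction in `curv`.
  have I₂ : ∫ x, (⟪ξ x, deriv h x⟫ * Y x + ⟪deriv ξ x, h x⟫ * Y x + ⟪ξ x, h x⟫ * ⟪η x, deriv u x⟫
      - (⟪η x, deriv h x⟫ * X x + ⟪deriv η x, h x⟫ * X x + ⟪η x, h x⟫ * ⟪ξ x, deriv u x⟫)) = 0 := by
    refine integral_eq_zero_of_hasDerivAt_of_eq (R := ρ)
      (F := fun x => ⟪ξ x, h x⟫ * Y x - ⟪η x, h x⟫ * X x) (fun x => ?_) (by fun_prop)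
      (fun x hx => by simp [hhR x hx, hh'R x hx])
      (by simp [hhR ρ (le_abs_self ρ), hhR (-ρ) (by rw [abs_neg]; exact le_abs_self ρ)])
    have := ((((pairL.hasFDerivAt.comp_hasDerivAt x (dξ x)).clm_apply (dh x)).mul (dY x)).sub
      (((pairL.hasFDerivAt.comp_hasDerivAt x (dη x)).clm_apply (dh x)).mul (dX x)))
    refine this.congr_deriv ?_
    simp only [Function.comp]
    ring
  -- Skew-symmetry of `(d/dx)⁻¹` moves it off the factor that contains `h_x`.
  have I₃ : ∫ x, (⟪ξ x, deriv u x⟫ * invD (fun y => ⟪η y, deriv h y⟫) x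
      + ⟪η x, deriv h x⟫ * X x) = 0 :=
    integral_mul_invD (R := ρ) (by fun_prop) (fun x hx => by rw [huR x hx, map_zero])
      (by fun_prop) (fun x hx => by rw [hh'R x hx, map_zero])
  have cZ : Continuous (invD fun y => ⟪η y, deriv h y⟫) :=
    continuous_invD (R := ρ) (by fun_prop) fun x hx => by rw [hh'R x hx, map_zero]
  have J₁ := integrable_of_vanish (R := ρ) (f := fun x => ⟪deriv ξ x, P.bL (u x) (h x) (η x)⟫
      + ⟪ξ x, fderiv ℝ P.bL (u x) (deriv u x) (h x) (η x)⟫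
      + ⟪ξ x, P.bL (u x) (deriv h x) (η x)⟫ + ⟪ξ x, P.bL (u x) (h x) (deriv η x)⟫)
    (by fun_prop) (fun x hx => by simp [hhR x hx, hh'R x hx, huR x hx])
  have J₂ := integrable_of_vanish (R := ρ) (f := fun x => P.K * (⟪ξ x, deriv h x⟫ * Y x
      + ⟪deriv ξ x, h x⟫ * Y x + ⟪ξ x, h x⟫ * ⟪η x, deriv u x⟫
      - (⟪η x, deriv h x⟫ * X x + ⟪deriv η x, h x⟫ * X x + ⟪η x, h x⟫ * ⟪ξ x, deriv u x⟫)))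
    (by fun_prop) (fun x hx => by simp [hhR x hx, hh'R x hx])
  have J₃ := integrable_of_vanish (R := ρ) (f := fun x => P.K * (⟪ξ x, deriv u x⟫
      * invD (fun y => ⟪η y, deriv h y⟫) x + ⟪η x, deriv h x⟫ * X x))
    (by fun_prop) (fun x hx => by simp [huR x hx, hh'R x hx])
  have J₀ := integrable_of_vanish (R := ρ) (f := fun x => (P.jet (u x)).variation (deriv u x) (ξ x)
      (deriv ξ x) (X x) (η x) (deriv η x) (Y x) (h x))
    (by simp only [HydroJet.variation, HydroJet.curv, jet]; fun_prop)
    (fun x hx => by simp [HydroJet.variation, HydroJet.curv, jet, hhR x hx])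
  have key : ∀ x, ⟪ξ x, fderiv ℝ P.gL (u x) (h x) (deriv η x)⟫
        + ⟪ξ x, fderiv ℝ P.bL (u x) (h x) (deriv u x) (η x)⟫ + ⟪ξ x, P.bL (u x) (deriv h x) (η x)⟫
        + P.K * (⟪ξ x, deriv h x⟫ * Y x
          + ⟪ξ x, deriv u x⟫ * invD (fun y => ⟪η y, deriv h y⟫) x)
      = (((P.jet (u x)).variation (deriv u x) (ξ x)
        (deriv ξ x) (X x) (η x) (deriv η x) (Y x) (h x)
      + (⟪deriv ξ x, P.bL (u x) (h x) (η x)⟫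
      + ⟪ξ x, fderiv ℝ P.bL (u x) (deriv u x) (h x) (η x)⟫
      + ⟪ξ x, P.bL (u x) (deriv h x) (η x)⟫ + ⟪ξ x, P.bL (u x) (h x) (deriv η x)⟫))
      + P.K * (⟪ξ x, deriv h x⟫ * Y x
      + ⟪deriv ξ x, h x⟫ * Y x + ⟪ξ x, h x⟫ * ⟪η x, deriv u x⟫
      - (⟪η x, deriv h x⟫ * X x + ⟪deriv η x, h x⟫ * X x + ⟪η x, h x⟫ * ⟪ξ x, deriv u x⟫)))
      + P.K * (⟪ξ x, deriv u x⟫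
      * invD (fun y => ⟪η y, deriv h y⟫) x + ⟪η x, deriv h x⟫ * X x) := fun x => by
    rw [hPm (u x) (hu.mem x)]
    simp only [HydroJet.variation, HydroJet.curv, jet]
    ring
  rw [MeasureTheory.integral_congr_ae (Filter.Eventually.of_forall key),
    MeasureTheory.integral_add ((J₀.fun_add J₁).fun_add J₂) J₃, MeasureTheory.integral_add (J₀.fun_add J₁) J₂,
    MeasureTheory.integral_add J₀ J₁, MeasureTheory.integral_const_mul,
    MeasureTheory.integral_const_mul, I₁, I₂, I₃, fieldVariation]
  ring

end HydroBracket

end Fields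

/-! ### The derivative of a bracket along a family of fields -/

namespace HydroBracket

variable {N : ℕ} {P : HydroBracket N} {U : Set (Fin N → ℝ)}

theorem isHydroField_deriv_family {ξ : ℝ → ℝ → Fin N → ℝ} {R : ℝ}
    (hξ : ContDiff ℝ ∞ fun q : ℝ × ℝ => ξ q.1 q.2)
    (hξR : ∀ s x, R ≤ |x| → ξ s x = ξ s R) (s₀ : ℝ) :
    IsHydroField Set.univ fun x => deriv (fun s => ξ s x) s₀ :=
  ⟨contDiff_section_right (w := fun s x => deriv (fun s => ξ s x) s)
    (contDiff_deriv_family_left hξ) s₀, fun _ => Set.mem_univ _,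
    deriv (fun s => ξ s R) s₀, R, fun x hx => by
      rw [show (fun s => ξ s x) = fun s => ξ s R from funext fun s => hξR s x hx]⟩

/-- The product rule for the bracket: two terms differentiate the covectors, and the third the field
that enters the operator. -/
theorem hasDerivAt_pairing (hU : IsOpen U) (hP : P.SmoothOn U) (hPm : P.IsMetric U)
    {w ξ η : ℝ → ℝ → Fin N → ℝ} {c : Fin N → ℝ} {R : ℝ}
    (hw : ContDiff ℝ ∞ fun q : ℝ × ℝ => w q.1 q.2) (hwU : ∀ s x, w s x ∈ U)
    (hwR : ∀ s x, R ≤ |x| → w s x = c)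
    (hξ : ContDiff ℝ ∞ fun q : ℝ × ℝ => ξ q.1 q.2) (hξR : ∀ s x, R ≤ |x| → ξ s x = ξ s R)
    (hη : ContDiff ℝ ∞ fun q : ℝ × ℝ => η q.1 q.2) (hηR : ∀ s x, R ≤ |x| → η s x = η s R)
    (s₀ : ℝ) :
    HasDerivAt (fun s => P.pairing (w s) (ξ s) (η s))
      (P.pairing (w s₀) (fun x => deriv (fun s => ξ s x) s₀) (η s₀)
        + P.pairing (w s₀) (ξ s₀) (fun x => deriv (fun s => η s x) s₀)
        + P.fieldVariation (w s₀) (ξ s₀) (η s₀) (fun x => deriv (fun s => w s x) s₀)) s₀ := by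
  set ρ := R + 1 with hρ
  have hwf : ∀ s, IsHydroField U (w s) := fun s =>
    ⟨contDiff_section_right hw s, hwU s, c, R, hwR s⟩
  have hξf : ∀ s, IsHydroField Set.univ (ξ s) := fun s =>
    ⟨contDiff_section_right hξ s, fun _ => Set.mem_univ _, _, R, hξR s⟩
  have hηf : ∀ s, IsHydroField Set.univ (η s) := fun s =>
    ⟨contDiff_section_right hη s, fun _ => Set.mem_univ _, _, R, hηR s⟩
  set h : ℝ → Fin N → ℝ := fun x => deriv (fun s => w s x) s₀ with hh
  set ξd : ℝ → Fin N → ℝ := fun x => deriv (fun s => ξ s x) s₀ with hξd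
  set ηd : ℝ → Fin N → ℝ := fun x => deriv (fun s => η s x) s₀ with hηd
  have hξdf : IsHydroField Set.univ ξd := isHydroField_deriv_family hξ hξR s₀
  have hηdf : IsHydroField Set.univ ηd := isHydroField_deriv_family hη hηR s₀
  have hhs : ContDiff ℝ ∞ h := contDiff_section_right
    (w := fun s x => deriv (fun s => w s x) s) (contDiff_deriv_family_left hw) s₀
  have hhR : ∀ x, R ≤ |x| → h x = 0 := fun x hx => by
    simp only [hh]
    rw [show (fun s => w s x) = fun _ => c from funext fun s => hwR s x hx, deriv_const]
  have vw : ∀ s x, ρ ≤ |x| → deriv (w s) x = 0 := fun s => deriv_eq_zero_of_const (hwR s)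
  have vη : ∀ s x, ρ ≤ |x| → deriv (η s) x = 0 := fun s => deriv_eq_zero_of_const (hηR s)
  have vh' : ∀ x, ρ ≤ |x| → deriv h x = 0 := deriv_eq_zero_of_const hhR
  have vh : ∀ x, ρ ≤ |x| → h x = 0 := fun x hx => hhR x (by linarith)
  have vηd : ∀ x, ρ ≤ |x| → deriv ηd x = 0 := deriv_eq_zero_of_const (c := ηd R) fun x hx => by
    simp only [hηd]
    rw [show (fun s => η s x) = fun s => η s R from funext fun s => hηR s x hx]
  have hw' := contDiff_deriv_family_right hw
  have hη' := contDiff_deriv_family_right hη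
  have hg := hP.contDiff_gL_comp hw fun q => hwU q.1 q.2
  have hb := hP.contDiff_bL_comp hw fun q => hwU q.1 q.2
  set F : ℝ → ℝ → ℝ := fun s x =>
    ⟪ξ s x, P.gL (w s x) (deriv (η s) x) + P.bL (w s x) (deriv (w s) x) (η s x)⟫ with hF
  set f : ℝ → ℝ → ℝ := fun s x => ⟪ξ s x, deriv (w s) x⟫ with hf
  set k : ℝ → ℝ → ℝ := fun s x => ⟪η s x, deriv (w s) x⟫ with hk
  have cF : ContDiff ℝ ∞ fun q : ℝ × ℝ => F q.1 q.2 :=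
    contDiff_pairL hξ ((hg.clm_apply hη').add ((hb.clm_apply hw').clm_apply hη))
  have cf : ContDiff ℝ ∞ fun q : ℝ × ℝ => f q.1 q.2 := contDiff_pairL hξ hw'
  have ck : ContDiff ℝ ∞ fun q : ℝ × ℝ => k q.1 q.2 := contDiff_pairL hη hw'
  have cF' := (contDiff_deriv_family_left cF).continuous
  have cf' := (contDiff_deriv_family_left cf).continuous
  have ck' := (contDiff_deriv_family_left ck).continuous
  have dF : ∀ s x, HasDerivAt (fun s => F s x) (deriv (fun s => F s x) s) s := fun s x =>
    ((contDiff_section_left cF x).differentiable (by simp) s).hasDerivAt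
  have df : ∀ s x, HasDerivAt (fun s => f s x) (deriv (fun s => f s x) s) s := fun s x =>
    ((contDiff_section_left cf x).differentiable (by simp) s).hasDerivAt
  have dk : ∀ s x, HasDerivAt (fun s => k s x) (deriv (fun s => k s x) s) s := fun s x =>
    ((contDiff_section_left ck x).differentiable (by simp) s).hasDerivAt
  have vk : ∀ s x, ρ ≤ |x| → k s x = 0 := fun s x hx => by simp [hk, vw s x hx]
  set k' : ℝ → ℝ → ℝ := fun s x => deriv (fun s => k s x) s with hk'
  have vk' : ∀ s x, ρ ≤ |x| → k' s x = 0 := fun s x hx => by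
    simp only [hk']
    rw [show (fun s => k s x) = fun _ => 0 from funext fun s => vk s x hx, deriv_const]
  -- `J` is `(d/dx)⁻¹` of `k` over an interval that does not depend on the parameter, so that it can
  -- be differentiated under the integral sign.
  set J : ℝ → ℝ → ℝ := fun s x =>
    (∫ y in (-ρ)..x, k s y) - (1 / 2) * ∫ y in (-ρ)..ρ, k s y with hJ
  set J' : ℝ → ℝ → ℝ := fun s x =>
    (∫ y in (-ρ)..x, k' s y) - (1 / 2) * ∫ y in (-ρ)..ρ, k' s y with hJ'
  have cJgen : ∀ k : ℝ → ℝ → ℝ, Continuous (fun q : ℝ × ℝ => k q.1 q.2) →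
      Continuous fun q : ℝ × ℝ =>
        (∫ y in (-ρ)..q.2, k q.1 y) - (1 / 2) * ∫ y in (-ρ)..ρ, k q.1 y := fun k hk => by
    have h1 := continuous_intervalIntegral_prod hk (-ρ)
    exact h1.sub (continuous_const.mul
      (h1.comp (by fun_prop : Continuous fun q : ℝ × ℝ => (q.1, ρ))))
  have cJ : Continuous fun q : ℝ × ℝ => J q.1 q.2 := cJgen k ck.continuous
  have cJ' : Continuous fun q : ℝ × ℝ => J' q.1 q.2 := cJgen k' ck'
  have ck0 : ∀ s, Continuous (k s) := fun s => (contDiff_section_right ck s).continuous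
  have ck0' : ∀ s, Continuous (k' s) := fun s =>
    ck'.comp (by fun_prop : Continuous fun x : ℝ => (s, x))
  have dJ : ∀ s x, HasDerivAt (fun s => J s x) (J' s x) s := fun s x =>
    (hasDerivAt_intervalIntegral_of_continuous ck0 ck' dk _ _ s).sub
      ((hasDerivAt_intervalIntegral_of_continuous ck0 ck' dk _ _ s).const_mul _)
  have val : ∀ s, P.pairing (w s) (ξ s) (η s)
      = ∫ x in (-ρ)..ρ, (F s x + P.K * (f s x * J s x)) := fun s => by
    rw [pairing_eq (hwf s) (hηf s).smooth, ← integral_eq_intervalIntegral_of_vanish]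
    · congr 1
      funext x
      simp only [HydroJet.opVal, jet, hF, hf, hJ]
      rw [invD_eq (R := ρ) (ck0 s) (vk s)]
      simp only [map_add, map_smul, smul_eq_mul]
      ring
    · intro x hx
      simp [hF, hf, vw s x hx, vη s x hx]
  have main := hasDerivAt_intervalIntegral_of_continuous
    (F := fun s x => F s x + P.K * (f s x * J s x))
    (F' := fun s x => deriv (fun s => F s x) s
      + P.K * (deriv (fun s => f s x) s * J s x + f s x * J' s x))
    (fun s => by
      have h1 := (contDiff_section_right cF s).continuous
      have h2 := (contDiff_section_right cf s).continuous
      have h3 : Continuous (J s) := cJ.comp (by fun_prop : Continuous fun x : ℝ => (s, x))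
      fun_prop)
    (by
      have := cf.continuous
      fun_prop)
    (fun s x => (dF s x).add (((df s x).mul (dJ s x)).const_mul P.K)) (-ρ) ρ s₀
  rw [funext val]
  refine main.congr_deriv ?_
  -- the value of the derivative
  have dw : ∀ x, HasDerivAt (fun s => w s x) (h x) s₀ := fun x =>
    ((contDiff_section_left hw x).differentiable (by simp) s₀).hasDerivAt
  have dξ : ∀ x, HasDerivAt (fun s => ξ s x) (ξd x) s₀ := fun x =>
    ((contDiff_section_left hξ x).differentiable (by simp) s₀).hasDerivAt
  have dη : ∀ x, HasDerivAt (fun s => η s x) (ηd x) s₀ := fun x =>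
    ((contDiff_section_left hη x).differentiable (by simp) s₀).hasDerivAt
  have dw' : ∀ x, HasDerivAt (fun s => deriv (w s) x) (deriv h x) s₀ :=
    hasDerivAt_deriv_family hw s₀
  have dη' : ∀ x, HasDerivAt (fun s => deriv (η s) x) (deriv ηd x) s₀ :=
    hasDerivAt_deriv_family hη s₀
  have eF : ∀ x, deriv (fun s => F s x) s₀ = ⟪ξd x, P.gL (w s₀ x) (deriv (η s₀) x)
      + P.bL (w s₀ x) (deriv (w s₀) x) (η s₀ x)⟫
      + (⟪ξ s₀ x, fderiv ℝ P.gL (w s₀ x) (h x) (deriv (η s₀) x)⟫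
      + ⟪ξ s₀ x, P.gL (w s₀ x) (deriv ηd x)⟫
      + ⟪ξ s₀ x, fderiv ℝ P.bL (w s₀ x) (h x) (deriv (w s₀) x) (η s₀ x)⟫
      + ⟪ξ s₀ x, P.bL (w s₀ x) (deriv h x) (η s₀ x)⟫
      + ⟪ξ s₀ x, P.bL (w s₀ x) (deriv (w s₀) x) (ηd x)⟫) := fun x => by
    have dB := (hP.hasFDerivAt_bL hU (hwU s₀ x)).comp_hasDerivAt s₀ (dw x)
    have dG := (hP.hasFDerivAt_gL hU (hwU s₀ x)).comp_hasDerivAt s₀ (dw x)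
    have := (pairL.hasFDerivAt.comp_hasDerivAt s₀ (dξ x)).clm_apply
      ((dG.clm_apply (dη' x)).add ((dB.clm_apply (dw' x)).clm_apply (dη x)))
    refine (HasDerivAt.deriv this).trans ?_
    simp only [Function.comp, add_apply, map_add, Pi.add_apply]
    ring
  have ef : ∀ x, deriv (fun s => f s x) s₀ = ⟪ξd x, deriv (w s₀) x⟫ + ⟪ξ s₀ x, deriv h x⟫ :=
    fun x => HasDerivAt.deriv ((pairL.hasFDerivAt.comp_hasDerivAt s₀ (dξ x)).clm_apply (dw' x))
  have ek : ∀ x, k' s₀ x = ⟪ηd x, deriv (w s₀) x⟫ + ⟪η s₀ x, deriv h x⟫ :=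
    fun x => HasDerivAt.deriv ((pairL.hasFDerivAt.comp_hasDerivAt s₀ (dη x)).clm_apply (dw' x))
  have eJ : ∀ x, J s₀ x = invD (fun y => ⟪η s₀ y, deriv (w s₀) y⟫) x := fun x =>
    (invD_eq (ck0 s₀) (vk s₀) x).symm
  have eJ' : ∀ x, J' s₀ x = invD (fun y => ⟪ηd y, deriv (w s₀) y⟫) x
      + invD (fun y => ⟪η s₀ y, deriv h y⟫) x := fun x => by
    have c1 := hηdf.smooth.continuous
    have c2 := (hwf s₀).contDiff_deriv.continuous
    have c3 := (hηf s₀).smooth.continuous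
    have c4 := (contDiff_infty_iff_deriv.1 hhs).2.continuous
    rw [← invD_add (R := ρ) (by fun_prop) (fun x hx => by rw [vw s₀ x hx, map_zero])
      (by fun_prop) (fun x hx => by rw [vh' x hx, map_zero]), ← funext ek]
    exact (invD_eq (ck0' s₀) (vk' s₀) x).symm
  have key : ∀ x, deriv (fun s => F s x) s₀
      + P.K * (deriv (fun s => f s x) s₀ * J s₀ x + f s₀ x * J' s₀ x)
      = ⟪ξd x, P.op (w s₀) (η s₀) x⟫ + ⟪ξ s₀ x, P.op (w s₀) ηd x⟫
        + (⟪ξ s₀ x, fderiv ℝ P.gL (w s₀ x) (h x) (deriv (η s₀) x)⟫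
        + ⟪ξ s₀ x, fderiv ℝ P.bL (w s₀ x) (h x) (deriv (w s₀) x) (η s₀ x)⟫
        + ⟪ξ s₀ x, P.bL (w s₀ x) (deriv h x) (η s₀ x)⟫
        + P.K * (⟪ξ s₀ x, deriv h x⟫ * invD (fun y => ⟪η s₀ y, deriv (w s₀) y⟫) x
          + ⟪ξ s₀ x, deriv (w s₀) x⟫ * invD (fun y => ⟪η s₀ y, deriv h y⟫) x)) := fun x => by
    rw [eF, ef, eJ, eJ', op_eq (hwf s₀) (hηf s₀).smooth, op_eq (hwf s₀) hηdf.smooth]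
    simp only [HydroJet.opVal, jet, map_add, map_smul, smul_eq_mul, hf]
    ring
  have hi := integral_variation hU hP hPm (hwf s₀) (hξf s₀) (hηf s₀) hhs hhR
  have i1 := integrable_pairing hP (hwf s₀) hξdf.smooth.continuous (hηf s₀)
  have i2 := integrable_pairing hP (hwf s₀) (hξf s₀).smooth.continuous hηdf
  rw [← integral_eq_intervalIntegral_of_vanish,
    MeasureTheory.integral_congr_ae (Filter.Eventually.of_forall key),
    MeasureTheory.integral_add (i1.fun_add i2), MeasureTheory.integral_add i1 i2, hi]
  · simp only [pairing, pairL_apply]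
  · have c1 := (hwf s₀).contDiff_deriv.continuous
    have c2 := (hwf s₀).smooth.continuous
    have c3 := (hηf s₀).smooth.continuous
    have c4 := (hηf s₀).contDiff_deriv.continuous
    have c5 := (hξf s₀).smooth.continuous
    have c6 := hhs.continuous
    have c7 := (contDiff_infty_iff_deriv.1 hhs).2.continuous
    have cB := (hP.contDiff_bL_comp (hwf s₀).smooth (hwf s₀).mem).continuous
    have cD := hP.continuous_fderiv_bL_comp hU c2 (hwf s₀).mem
    have cG : Continuous fun x => fderiv ℝ P.gL (w s₀ x) :=
      (hP.contDiffOn_gL.fderiv_of_isOpen hU (m := ∞) (by simp)).continuousOn.comp_continuous c2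
        (hwf s₀).mem
    have cY := (contDiff_invD_pairL (hwf s₀) (hηf s₀).smooth).continuous
    have cZ : Continuous (invD fun y => ⟪η s₀ y, deriv h y⟫) :=
      continuous_invD (R := ρ) (by fun_prop) fun x hx => by rw [vh' x hx, map_zero]
    refine integrable_of_vanish (R := ρ) (by fun_prop) fun x hx => ?_
    simp [vh x hx, vh' x hx, vw s₀ x hx]
  · intro x hx
    rw [eF, ef]
    simp [hf, vh x hx, vh' x hx, vw s₀ x hx, vη s₀ x hx, vηd x hx]

end HydroBracket

/-! ### Smooth functionals -/

section Reparametrization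

/-- A smooth function with values in `[-δ, δ]`, tangent to the identity at `0`. -/
noncomputable def sinScale (δ s : ℝ) : ℝ := δ * Real.sin (s / δ)

theorem contDiff_sinScale (δ : ℝ) : ContDiff ℝ ∞ (sinScale δ) :=
  contDiff_const.mul (Real.contDiff_sin.comp (contDiff_id.div_const δ))

@[simp] theorem sinScale_zero (δ : ℝ) : sinScale δ 0 = 0 := by simp [sinScale]

theorem abs_sinScale_le {δ : ℝ} (hδ : 0 < δ) (s : ℝ) : |sinScale δ s| ≤ δ := by
  rw [sinScale, abs_mul, abs_of_pos hδ]
  exact mul_le_of_le_one_right hδ.le (Real.abs_sin_le_one _)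

theorem hasDerivAt_sinScale {δ : ℝ} (hδ : 0 < δ) : HasDerivAt (sinScale δ) 1 0 := by
  have := ((Real.hasDerivAt_sin (0 / δ)).comp 0 ((hasDerivAt_id (0 : ℝ)).div_const δ)).const_mul δ
  refine this.congr_deriv ?_
  simp [hδ.ne']

/-- A local inverse of `τ` undoes the reparametrization. Lines of fields can thus be replaced by
families that stay in `U` for every real parameter, without changing derivatives at `0`. -/
theorem hasDerivAt_of_comp_of_deriv_one {E : Type*} [NormedAddCommGroup E] [NormedSpace ℝ E]
    {F : ℝ → E} {τ : ℝ → ℝ} {a : E} (hτ : ContDiff ℝ ∞ τ) (hτ0 : τ 0 = 0)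
    (hτ1 : HasDerivAt τ 1 0) (h : HasDerivAt (fun s => F (τ s)) a 0) : HasDerivAt F a 0 := by
  have hs : HasStrictDerivAt τ 1 0 := hτ.contDiffAt.hasStrictDerivAt' hτ1 (by simp)
  set k := hs.localInverse τ 1 0 one_ne_zero
  have hk0 : k 0 = 0 := by
    have := (hs.eventually_left_inverse one_ne_zero).self_of_nhds
    rwa [hτ0] at this
  have hk : HasDerivAt k 1 0 := by
    have := (hs.to_localInverse one_ne_zero).hasDerivAt
    rwa [hτ0, inv_one] at this
  have hr : ∀ᶠ ε in 𝓝 (0 : ℝ), τ (k ε) = ε := by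
    have := hs.eventually_right_inverse one_ne_zero
    rwa [hτ0] at this
  have h' : HasDerivAt (fun s => F (τ s)) a (k 0) := by rwa [hk0]
  have := h'.scomp (0 : ℝ) hk
  rw [one_smul] at this
  refine this.congr_of_eventuallyEq ?_
  filter_upwards [hr] with ε hε
  simp [Function.comp, hε]

end Reparametrization

section Functionals

variable {N : ℕ} {U : Set (Fin N → ℝ)} {u : ℝ → Fin N → ℝ}

theorem limUnder_eq_of_const {c : Fin N → ℝ} {R : ℝ} (h : ∀ x, R ≤ |x| → u x = c) :
    Filter.limUnder Filter.atTop u = c := by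
  refine Filter.Tendsto.limUnder_eq (tendsto_const_nhds.congr' ?_)
  filter_upwards [Filter.eventually_ge_atTop R] with x hx
  exact (h x (hx.trans (le_abs_self x))).symm

/-- The linear functional `u ↦ ∫ ξ_i(x) (u^i(x) - u^i(∞)) dx`, with variational derivative `ξ`. -/
noncomputable def linFunctional (U : Set (Fin N → ℝ)) (ξ : ℝ → Fin N → ℝ)
    (hξ : IsHydroField Set.univ ξ) : SmoothFunctional U where
  -- As `ξ` may be nonzero at infinity, the integral needs subtraction of the limit of `u`;
  -- compactly supported variations leave this limit unchanged.
  toFun u := ∫ x, ⟪ξ x, u x - Filter.limUnder Filter.atTop u⟫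
  varDeriv _ := ξ
  hasVarDeriv u hu v hv hvc := by
    obtain ⟨c, R, hR⟩ := hu.const_at_infinity
    obtain ⟨r, hr⟩ := hvc.isCompact.isBounded.subset_ball 0
    have hvR : ∀ x, r ≤ |x| → v x = 0 := fun x hx => by
      refine image_eq_zero_of_notMem_tsupport fun h => ?_
      have := hr h
      rw [mem_ball_zero_iff, Real.norm_eq_abs] at this
      linarith
    have c1 := hξ.smooth.continuous
    have c2 := hu.smooth.continuous
    have c3 := hv.continuous
    have i1 : MeasureTheory.Integrable fun x => ⟪ξ x, u x - c⟫ :=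
      integrable_of_vanish (R := R) (by fun_prop) fun x hx => by rw [hR x hx, sub_self, map_zero]
    have i2 : MeasureTheory.Integrable fun x => ⟪ξ x, v x⟫ :=
      integrable_of_vanish (R := r) (by fun_prop) fun x hx => by rw [hvR x hx, map_zero]
    have e : (fun ε : ℝ => ∫ x, ⟪ξ x, (u + ε • v) x - Filter.limUnder Filter.atTop (u + ε • v)⟫)
        = fun ε => (∫ x, ⟪ξ x, u x - c⟫) + ε * ∫ x, ⟪ξ x, v x⟫ := by
      funext ε
      rw [limUnder_eq_of_const (c := c) (R := max R r) fun x hx => by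
        simp [hR x ((le_max_left _ _).trans hx), hvR x ((le_max_right _ _).trans hx)],
        ← MeasureTheory.integral_const_mul, ← MeasureTheory.integral_add i1 (i2.const_mul ε)]
      congr 1
      funext x
      simp only [Pi.add_apply, Pi.smul_apply, map_add, map_sub, map_smul, smul_eq_mul]
      ring
    rw [e]
    have := ((hasDerivAt_id (0 : ℝ)).mul_const (∫ x, ⟪ξ x, v x⟫)).const_add
      (∫ x, ⟪ξ x, u x - c⟫)
    refine this.congr_deriv ?_
    simp [pairL_apply]
  smooth k S w _ _ := (hξ.smooth.comp contDiff_snd).contDiffOn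
  const_at_infinity k S w _ _ s₀ _ := by
    obtain ⟨c, R, hR⟩ := hξ.const_at_infinity
    exact ⟨R, Filter.Eventually.of_forall fun _ => ⟨c, hR⟩⟩

/-- A field that is constant near infinity has compact range, so some uniform thickening of the
range stays in `U`, and the variations are bounded. -/
theorem exists_pos_forall_add_smul_mem (hU : IsOpen U) (hu : IsHydroField U u)
    {h₁ h₂ : ℝ → Fin N → ℝ} (c₁ : Continuous h₁) (c₂ : Continuous h₂) {R : ℝ}
    (hR₁ : ∀ x, R ≤ |x| → h₁ x = 0) (hR₂ : ∀ x, R ≤ |x| → h₂ x = 0) :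
    ∃ δ > 0, ∀ s t : ℝ, |s| ≤ δ → |t| ≤ δ → ∀ x, u x + s • h₁ x + t • h₂ x ∈ U := by
  obtain ⟨c, r, hr0, hr⟩ := hu.exists_radius
  have hK : IsCompact (Set.range u) := by
    have : Set.range u = u '' Set.Icc (-r) r := by
      refine Set.Subset.antisymm ?_ (Set.image_subset_range _ _)
      rintro _ ⟨x, rfl⟩
      rcases le_total r |x| with hx | hx
      · exact ⟨r, ⟨by linarith, le_rfl⟩, by
          rw [(hr x hx).1, (hr r (by rw [abs_of_nonneg hr0])).1]⟩
      · exact ⟨x, abs_le.1 hx, rfl⟩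
    rw [this]
    exact isCompact_Icc.image hu.smooth.continuous
  obtain ⟨ρ, hρ, hsub⟩ := hK.exists_thickening_subset_open hU
    (by rintro _ ⟨x, rfl⟩; exact hu.mem x)
  obtain ⟨C₁, hC₁⟩ := c₁.bounded_above_of_compact_support (hasCompactSupport_of_vanish hR₁)
  obtain ⟨C₂, hC₂⟩ := c₂.bounded_above_of_compact_support (hasCompactSupport_of_vanish hR₂)
  have p₁ : 0 ≤ C₁ := (norm_nonneg _).trans (hC₁ 0)
  have p₂ : 0 ≤ C₂ := (norm_nonneg _).trans (hC₂ 0)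
  refine ⟨ρ / (2 * (C₁ + C₂ + 1)), by positivity, fun s t hs ht x => hsub ?_⟩
  refine Metric.mem_thickening_iff.2 ⟨u x, ⟨x, rfl⟩, ?_⟩
  rw [dist_eq_norm, add_assoc, add_sub_cancel_left]
  calc ‖s • h₁ x + t • h₂ x‖ ≤ ‖s • h₁ x‖ + ‖t • h₂ x‖ := norm_add_le _ _
    _ = |s| * ‖h₁ x‖ + |t| * ‖h₂ x‖ := by rw [norm_smul, norm_smul]; rfl
    _ ≤ ρ / (2 * (C₁ + C₂ + 1)) * C₁ + ρ / (2 * (C₁ + C₂ + 1)) * C₂ := by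
        gcongr
        · exact hC₁ x
        · exact hC₂ x
    _ = ρ * ((C₁ + C₂) / (2 * (C₁ + C₂ + 1))) := by ring
    _ < ρ * 1 := by
        gcongr
        rw [div_lt_one (by positivity)]
        linarith
    _ = ρ := mul_one ρ

namespace SmoothFunctional

variable (I : SmoothFunctional U)

theorem isHydroField_varDeriv (hu : IsHydroField U u) : IsHydroField Set.univ (I.varDeriv u) := by
  -- A single field is a family with no parameters.
  have hf : IsHydroFieldFamily U (Set.univ : Set (Fin 0 → ℝ)) fun _ => u :=
    ⟨(hu.smooth.comp contDiff_snd).contDiffOn, fun _ _ => hu.mem, by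
      obtain ⟨c, R, hR⟩ := hu.const_at_infinity
      exact ⟨c, R, fun _ _ => hR⟩⟩
  have h1 := I.smooth 0 Set.univ _ isOpen_univ hf
  rw [Set.univ_prod_univ, contDiffOn_univ] at h1
  obtain ⟨R, hR⟩ := I.const_at_infinity 0 Set.univ _ isOpen_univ hf 0 (Set.mem_univ _)
  obtain ⟨c, hc⟩ := hR.self_of_nhds
  exact ⟨h1.comp (contDiff_const.prodMk contDiff_id : ContDiff ℝ ∞ fun x : ℝ => ((0 : Fin 0 → ℝ), x)),
    fun _ => Set.mem_univ _, c, R, hc⟩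

/-- The derivative of the variational derivative along `h`. -/
noncomputable def secondVar (u h : ℝ → Fin N → ℝ) (x : ℝ) : Fin N → ℝ :=
  deriv (fun ε : ℝ => I.varDeriv (u + ε • h) x) 0

theorem isHydroFieldFamily_add (hu : IsHydroField U u) {k : ℕ} {h : Fin k → ℝ → Fin N → ℝ}
    {τ : Fin k → ℝ → ℝ} (hτ : ∀ i, ContDiff ℝ ∞ (τ i)) (hh : ∀ i, ContDiff ℝ ∞ (h i)) {R : ℝ}
    (hR : ∀ i x, R ≤ |x| → h i x = 0) (hmem : ∀ (s : Fin k → ℝ) x, (u + ∑ i, τ i (s i) • h i) x ∈ U) :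
    IsHydroFieldFamily U Set.univ fun s : Fin k → ℝ => u + ∑ i, τ i (s i) • h i := by
  refine ⟨?_, fun s _ => hmem s, ?_⟩
  · refine ContDiff.contDiffOn ?_
    simp only [Pi.add_apply, Finset.sum_apply, Pi.smul_apply]
    refine (hu.smooth.comp contDiff_snd).add (ContDiff.sum fun i _ => ?_)
    exact ((hτ i).comp ((contDiff_apply ℝ ℝ i).comp contDiff_fst)).smul ((hh i).comp contDiff_snd)
  · obtain ⟨c, r, hr⟩ := hu.const_at_infinity
    refine ⟨c, max r R, fun s _ x hx => ?_⟩
    simp [hr x ((le_max_left _ _).trans hx), fun i => hR i x ((le_max_right _ _).trans hx)]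

theorem contDiff_varDeriv_line {τ : ℝ → ℝ} {h : ℝ → Fin N → ℝ}
    (hfam : IsHydroFieldFamily U Set.univ fun s : Fin 1 → ℝ => u + τ (s 0) • h) :
    ContDiff ℝ ∞ fun q : ℝ × ℝ => I.varDeriv (u + τ q.1 • h) q.2 := by
  have h1 := I.smooth 1 Set.univ _ isOpen_univ hfam
  rw [Set.univ_prod_univ, contDiffOn_univ] at h1
  have h2 : ContDiff ℝ ∞ fun q : ℝ × ℝ => ((fun _ : Fin 1 => q.1), q.2) :=
    (contDiff_pi.2 fun _ => contDiff_fst).prodMk contDiff_snd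
  exact ContDiff.comp (g := fun q : (Fin 1 → ℝ) × ℝ => I.varDeriv (u + τ (q.1 0) • h) q.2) h1 h2

theorem eventually_varDeriv_line_const {τ : ℝ → ℝ} {h : ℝ → Fin N → ℝ}
    (hfam : IsHydroFieldFamily U Set.univ fun s : Fin 1 → ℝ => u + τ (s 0) • h) :
    ∃ R, ∀ᶠ s in 𝓝 (0 : ℝ), ∃ c : Fin N → ℝ, ∀ x, R ≤ |x| → I.varDeriv (u + τ s • h) x = c := by
  obtain ⟨R, hR⟩ := I.const_at_infinity 1 Set.univ _ isOpen_univ hfam (fun _ => 0)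
    (Set.mem_univ _)
  have hcont : Continuous fun (s : ℝ) (_ : Fin 1) => s := by fun_prop
  have ht : Filter.Tendsto (fun (s : ℝ) (_ : Fin 1) => s) (𝓝 0) (𝓝 fun _ => 0) := hcont.tendsto 0
  exact ⟨R, ht.eventually hR⟩

/-- A reparametrized line of fields along which two functionals have variational derivatives that
are constant outside one bounded interval. -/
theorem exists_line (hU : IsOpen U) (I J : SmoothFunctional U) (hu : IsHydroField U u)
    {h : ℝ → Fin N → ℝ} (hh : ContDiff ℝ ∞ h) {R₀ : ℝ} (hR₀ : ∀ x, R₀ ≤ |x| → h x = 0) :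
    ∃ τ : ℝ → ℝ, ContDiff ℝ ∞ τ ∧ τ 0 = 0 ∧ HasDerivAt τ 1 0 ∧ ∃ c R,
      (∀ s x, (u + τ s • h) x ∈ U) ∧ (∀ s x, R ≤ |x| → (u + τ s • h) x = c) ∧
      (ContDiff ℝ ∞ fun q : ℝ × ℝ => I.varDeriv (u + τ q.1 • h) q.2) ∧
      (∀ s x, R ≤ |x| → I.varDeriv (u + τ s • h) x = I.varDeriv (u + τ s • h) R) ∧
      (ContDiff ℝ ∞ fun q : ℝ × ℝ => J.varDeriv (u + τ q.1 • h) q.2) ∧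
      (∀ s x, R ≤ |x| → J.varDeriv (u + τ s • h) x = J.varDeriv (u + τ s • h) R) := by
  obtain ⟨δ, hδ, hmem⟩ := exists_pos_forall_add_smul_mem hU hu hh.continuous hh.continuous hR₀ hR₀
  have hmem' : ∀ s x, (u + sinScale δ s • h) x ∈ U := fun s x => by
    simpa using hmem (sinScale δ s) 0 (abs_sinScale_le hδ s) (by simpa using hδ.le) x
  obtain ⟨c, r, -, hr⟩ := hu.exists_radius
  have hfam := isHydroFieldFamily_add (k := 1) (τ := fun _ => sinScale δ) (h := fun _ => h) hu
    (fun _ => contDiff_sinScale δ) (fun _ => hh) (fun _ => hR₀) (fun s x => by simpa using hmem' _ x)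
  simp only [Finset.univ_unique, Fin.default_eq_zero, Fin.isValue, Finset.sum_singleton] at hfam
  have hsm := fun I : SmoothFunctional U => I.contDiff_varDeriv_line hfam
  obtain ⟨R₁, h₁⟩ := I.eventually_varDeriv_line_const hfam
  obtain ⟨R₂, h₂⟩ := J.eventually_varDeriv_line_const hfam
  obtain ⟨e, he, hball⟩ := Metric.eventually_nhds_iff.1 (h₁.and h₂)
  have he2 : 0 < e / 2 := by positivity
  set R := max (max R₀ r) (max |R₁| |R₂|)
  have hR0 : 0 ≤ R := (abs_nonneg R₁).trans ((le_max_left _ _).trans (le_max_right _ _))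
  have hRR : R ≤ |R| := le_abs_self R
  have hin : ∀ s, dist (sinScale (e / 2) s) 0 < e := fun s => by
    rw [Real.dist_0_eq_abs]
    linarith [abs_sinScale_le he2 s]
  have l1 : R₁ ≤ R := (le_abs_self R₁).trans ((le_max_left _ _).trans (le_max_right _ _))
  have l2 : R₂ ≤ R := (le_abs_self R₂).trans ((le_max_right _ _).trans (le_max_right _ _))
  have h₃ : ContDiff ℝ ∞ fun q : ℝ × ℝ => (sinScale (e / 2) q.1, q.2) :=
    ((contDiff_sinScale _).comp contDiff_fst).prodMk contDiff_snd
  -- The outer `sinScale δ` keeps the fields in `U`. The inner one keeps its argument within `e / 2`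
  -- of `0`, where one radius serves both variational derivatives, since constancy at infinity is
  -- uniform only locally in the parameter.
  refine ⟨fun s => sinScale δ (sinScale (e / 2) s),
    (contDiff_sinScale δ).comp (contDiff_sinScale _), by simp, ?_, c, R,
    fun s => hmem' _, fun s x hx => ?_, ?_, fun s x hx => ?_, ?_, fun s x hx => ?_⟩
  · have h1 : HasDerivAt (sinScale δ) 1 (sinScale (e / 2) 0) := by
      rw [sinScale_zero]; exact hasDerivAt_sinScale hδ
    exact (h1.comp (0 : ℝ) (hasDerivAt_sinScale he2)).congr_deriv (one_mul 1)
  · simp [hR₀ x (((le_max_left _ _).trans (le_max_left _ _)).trans hx),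
      (hr x (((le_max_right _ _).trans (le_max_left _ _)).trans hx)).1]
  · have h₄ := ContDiff.comp (g := fun q : ℝ × ℝ => I.varDeriv (u + sinScale δ q.1 • h) q.2)
      (hsm I) h₃
    exact h₄
  · obtain ⟨c, hc⟩ := (hball (hin s)).1
    rw [hc x (l1.trans hx), hc R (l1.trans hRR)]
  · have h₄ := ContDiff.comp (g := fun q : ℝ × ℝ => J.varDeriv (u + sinScale δ q.1 • h) q.2)
      (hsm J) h₃
    exact h₄
  · obtain ⟨c, hc⟩ := (hball (hin s)).2
    rw [hc x (l2.trans hx), hc R (l2.trans hRR)]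

theorem hasDerivAt_varDeriv_of_line {I : SmoothFunctional U} {h : ℝ → Fin N → ℝ} {τ : ℝ → ℝ}
    (hτ : ContDiff ℝ ∞ τ) (hτ0 : τ 0 = 0) (hτ1 : HasDerivAt τ 1 0)
    (hs : ContDiff ℝ ∞ fun q : ℝ × ℝ => I.varDeriv (u + τ q.1 • h) q.2) (x : ℝ) :
    HasDerivAt (fun s => I.varDeriv (u + τ s • h) x) (I.secondVar u h x) 0 := by
  have h1 : HasDerivAt (fun s => I.varDeriv (u + τ s • h) x) _ 0 :=
    ((contDiff_section_left (w := fun s x => I.varDeriv (u + τ s • h) x) hs x).differentiable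
      (by simp) 0).hasDerivAt
  have h2 := hasDerivAt_of_comp_of_deriv_one (F := fun ε => I.varDeriv (u + ε • h) x) hτ hτ0 hτ1 h1
  rw [secondVar, h2.deriv]
  exact h1

theorem isHydroField_secondVar (hU : IsOpen U) (hu : IsHydroField U u)
    {h : ℝ → Fin N → ℝ} (hh : ContDiff ℝ ∞ h) {R₀ : ℝ} (hR₀ : ∀ x, R₀ ≤ |x| → h x = 0) :
    IsHydroField Set.univ (I.secondVar u h) := by
  obtain ⟨τ, hτ, hτ0, hτ1, c, R, -, -, hs, hc, -, -⟩ := exists_line hU I I hu hh hR₀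
  have := HydroBracket.isHydroField_deriv_family (ξ := fun s x => I.varDeriv (u + τ s • h) x)
    hs hc 0
  rwa [funext fun x => (hasDerivAt_varDeriv_of_line hτ hτ0 hτ1 hs x).deriv] at this

end SmoothFunctional

namespace HydroBracket

variable {P : HydroBracket N}

/-- The product rule along the reparametrized line; besides `fieldVariation` there are the
contributions of the second variations of the two functionals. -/
theorem hasDerivAt_bracket (hU : IsOpen U) (hP : P.SmoothOn U) (hPm : P.IsMetric U)
    (I J : SmoothFunctional U) (hu : IsHydroField U u)
    {h : ℝ → Fin N → ℝ} (hh : ContDiff ℝ ∞ h) {R₀ : ℝ} (hR₀ : ∀ x, R₀ ≤ |x| → h x = 0) :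
    HasDerivAt (fun ε : ℝ => P.bracket I J (u + ε • h))
      (P.pairing u (I.secondVar u h) (J.varDeriv u) + P.pairing u (I.varDeriv u) (J.secondVar u h)
        + P.fieldVariation u (I.varDeriv u) (J.varDeriv u) h) 0 := by
  obtain ⟨τ, hτ, hτ0, hτ1, c, R, hmem, hc, hsI, hcI, hsJ, hcJ⟩ :=
    SmoothFunctional.exists_line hU I J hu hh hR₀
  refine hasDerivAt_of_comp_of_deriv_one hτ hτ0 hτ1 ?_
  have hw : ContDiff ℝ ∞ fun q : ℝ × ℝ => (u + τ q.1 • h) q.2 :=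
    (hu.smooth.comp contDiff_snd).add ((hτ.comp contDiff_fst).smul (hh.comp contDiff_snd))
  have main := hasDerivAt_pairing hU hP hPm (w := fun s => u + τ s • h)
    (ξ := fun s => I.varDeriv (u + τ s • h)) (η := fun s => J.varDeriv (u + τ s • h))
    hw hmem hc hsI hcI hsJ hcJ 0
  refine main.congr_deriv ?_
  have e0 : u + τ 0 • h = u := by simp [hτ0]
  have eh : (fun x => deriv (fun s => (u + τ s • h) x) 0) = h := by
    funext x
    have := ((hτ1.smul_const (h x)).const_add (u x)).deriv
    simpa using this
  simp only [e0, eh, (SmoothFunctional.hasDerivAt_varDeriv_of_line hτ hτ0 hτ1 hsI _).deriv,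
    (SmoothFunctional.hasDerivAt_varDeriv_of_line hτ hτ0 hτ1 hsJ _).deriv]

end HydroBracket

end Functionals

/-! ### Symmetry of the second variation -/

theorem hasFDerivAt_intervalIntegral_of_contDiff {A : (ℝ × ℝ) × ℝ → ℝ} (hA : ContDiff ℝ ∞ A)
    (a b : ℝ) (q₀ : ℝ × ℝ) :
    HasFDerivAt (fun q => ∫ x in a..b, A (q, x))
      (∫ x in a..b, (fderiv ℝ A (q₀, x)).comp (ContinuousLinearMap.inl ℝ (ℝ × ℝ) ℝ)) q₀ := by
  have c' : Continuous fun p : (ℝ × ℝ) × ℝ =>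
      (fderiv ℝ A p).comp (ContinuousLinearMap.inl ℝ (ℝ × ℝ) ℝ) :=
    (hA.continuous_fderiv (by simp)).clm_comp continuous_const
  have hcs : ∀ q : ℝ × ℝ, Continuous fun x : ℝ => (q, x) := fun q => by fun_prop
  obtain ⟨C, hC⟩ := ((isCompact_closedBall q₀ 1).prod
    (isCompact_uIcc (a := a) (b := b))).bddAbove_image
    (f := fun p => ‖(fderiv ℝ A p).comp (ContinuousLinearMap.inl ℝ (ℝ × ℝ) ℝ)‖)
    c'.norm.continuousOn
  refine intervalIntegral.hasFDerivAt_integral_of_dominated_of_fderiv_le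
    (F' := fun q x => (fderiv ℝ A (q, x)).comp (ContinuousLinearMap.inl ℝ (ℝ × ℝ) ℝ))
    (bound := fun _ => C) (Metric.closedBall_mem_nhds q₀ one_pos)
    (Filter.Eventually.of_forall fun q => (hA.continuous.comp (hcs q)).aestronglyMeasurable)
    ((hA.continuous.comp (hcs q₀)).intervalIntegrable _ _)
    (c'.comp (hcs q₀)).aestronglyMeasurable ?_ (by simp) ?_
  · exact Filter.Eventually.of_forall fun x hx q hq =>
      hC ⟨(q, x), ⟨hq, Set.uIoc_subset_uIcc hx⟩, rfl⟩
  · refine Filter.Eventually.of_forall fun x _ q _ => ?_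
    exact HasFDerivAt.comp (f := fun q : ℝ × ℝ => (q, x)) q
      (hA.differentiable (by simp) (q, x)).hasFDerivAt (hasFDerivAt_prodMk_left q x)

/-- Equality of mixed second derivatives for a function with given partial derivatives. -/
theorem mixed_deriv_comm {F : ℝ → ℝ → ℝ} {a b : ℝ × ℝ → ℝ}
    (ha : ∀ s t, HasDerivAt (fun s => F s t) (a (s, t)) s)
    (hb : ∀ s t, HasDerivAt (fun t => F s t) (b (s, t)) t)
    (ca : Continuous a) (cb : Continuous b) {a' b' : ℝ × ℝ →L[ℝ] ℝ} {q : ℝ × ℝ}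
    (da : HasFDerivAt a a' q) (db : HasFDerivAt b b' q) : a' (0, 1) = b' (1, 0) := by
  -- Continuity of both partial derivatives makes `F` differentiable everywhere, with derivative
  -- assembled from `a` and `b`; Schwarz's theorem at `q` then needs only their differentiability
  -- there.
  have h1 : ∀ q : ℝ × ℝ, HasFDerivAt (fun q : ℝ × ℝ => F q.1 q.2)
      (a q • ContinuousLinearMap.fst ℝ ℝ ℝ + b q • ContinuousLinearMap.snd ℝ ℝ ℝ) q := fun q => by
    have := hasStrictFDerivAt_uncurry_coprod (𝕜 := ℝ) (u := q) (f := F)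
      (f₁ := fun s t => a (s, t) • ContinuousLinearMap.id ℝ ℝ)
      (f₂ := fun s t => b (s, t) • ContinuousLinearMap.id ℝ ℝ)
      (Filter.Eventually.of_forall fun v => by
        refine (ha v.1 v.2).hasFDerivAt.congr_fderiv ?_
        ext; simp [Function.HasUncurry.uncurry])
      (Filter.Eventually.of_forall fun v => by
        refine (hb v.1 v.2).hasFDerivAt.congr_fderiv ?_
        ext; simp [Function.HasUncurry.uncurry])
      (ca.smul continuous_const).continuousAt
      (cb.smul continuous_const).continuousAt
    refine this.hasFDerivAt.congr_fderiv ?_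
    ext <;> simp [Function.HasUncurry.uncurry]
  have h2 := (da.smul_const (ContinuousLinearMap.fst ℝ ℝ ℝ)).add
    (db.smul_const (ContinuousLinearMap.snd ℝ ℝ ℝ))
  have := second_derivative_symmetric h1 h2 (0, 1) (1, 0)
  simpa using this

namespace SmoothFunctional

variable {N : ℕ} {U : Set (Fin N → ℝ)} {u : ℝ → Fin N → ℝ} (I : SmoothFunctional U)

theorem hasDerivAt_toFun_line (hu : IsHydroField U u) {τ : ℝ → ℝ} {h : ℝ → Fin N → ℝ}
    (hh : ContDiff ℝ ∞ h) {R s t : ℝ} (hR : ∀ x, R ≤ |x| → h x = 0) (hτ : HasDerivAt τ t s)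
    {v : ℝ → Fin N → ℝ} (hv : v + τ s • h = u) :
    HasDerivAt (fun s => I.toFun (v + τ s • h)) (t * ∫ x in (-R)..R, ⟪I.varDeriv u x, h x⟫) s := by
  have h1 := I.hasVarDeriv u hu h hh (hasCompactSupport_of_vanish hR)
  have h2 := HasDerivAt.comp_of_eq (h := fun s' => τ s' - τ s) s h1 (hτ.sub_const (τ s)) (by simp)
  have e : (fun s => I.toFun (v + τ s • h))
      = (fun ε : ℝ => I.toFun (u + ε • h)) ∘ fun s' => τ s' - τ s := by
    funext s'
    simp only [Function.comp, ← hv, add_assoc, ← add_smul]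
    congr 3
    ring
  rw [e, ← integral_eq_intervalIntegral_of_vanish fun x hx => by rw [hR x hx, map_zero], mul_comm]
  simpa only [pairL_apply] using h2

/-- Both integrals are mixed second derivatives at the origin of `I[u + φ(s) h₁ + φ(t) h₂]`. The
cut-off `φ` keeps the two-parameter family in `U` and has derivative `1` at `0`. -/
theorem integral_secondVar_comm (hU : IsOpen U) (hu : IsHydroField U u)
    {h₁ h₂ : ℝ → Fin N → ℝ} (hh₁ : ContDiff ℝ ∞ h₁) (hh₂ : ContDiff ℝ ∞ h₂) {R : ℝ}
    (hR₁ : ∀ x, R ≤ |x| → h₁ x = 0) (hR₂ : ∀ x, R ≤ |x| → h₂ x = 0) :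
    ∫ x, ⟪I.secondVar u h₁ x, h₂ x⟫ = ∫ x, ⟪I.secondVar u h₂ x, h₁ x⟫ := by
  obtain ⟨δ, hδ, hmem⟩ :=
    exists_pos_forall_add_smul_mem hU hu hh₁.continuous hh₂.continuous hR₁ hR₂
  set φ := sinScale δ with hφ
  have cφ : ContDiff ℝ ∞ φ := contDiff_sinScale δ
  have cφ' : ContDiff ℝ ∞ (deriv φ) := (contDiff_infty_iff_deriv.1 cφ).2
  have dφ : ∀ s, HasDerivAt φ (deriv φ s) s := fun s => (cφ.differentiable (by simp) s).hasDerivAt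
  have φ0 : φ 0 = 0 := sinScale_zero δ
  have φ1 : HasDerivAt φ 1 0 := hasDerivAt_sinScale hδ
  have hmem' : ∀ s t x, (u + φ s • h₁ + φ t • h₂) x ∈ U := fun s t x =>
    hmem _ _ (abs_sinScale_le hδ s) (abs_sinScale_le hδ t) x
  have hfield : ∀ s t, IsHydroField U (u + φ s • h₁ + φ t • h₂) := fun s t => by
    refine ⟨(hu.smooth.add (contDiff_const.smul hh₁)).add (contDiff_const.smul hh₂), hmem' s t, ?_⟩
    obtain ⟨c, r, hr⟩ := hu.const_at_infinity
    refine ⟨c, max r R, fun x hx => ?_⟩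
    simp [hr x ((le_max_left _ _).trans hx), hR₁ x ((le_max_right _ _).trans hx),
      hR₂ x ((le_max_right _ _).trans hx)]
  have hfam := isHydroFieldFamily_add (k := 2) (τ := fun _ => φ) (h := ![h₁, h₂]) (R := R) hu
    (fun _ => cφ) (fun i => by fin_cases i <;> assumption) (fun i => by fin_cases i <;> assumption)
    (fun s x => by simpa [Fin.sum_univ_two, add_assoc] using hmem' (s 0) (s 1) x)
  have h1 := I.smooth 2 Set.univ _ isOpen_univ hfam
  rw [Set.univ_prod_univ, contDiffOn_univ] at h1
  have h2 : ContDiff ℝ ∞ fun p : (ℝ × ℝ) × ℝ => ((![p.1.1, p.1.2] : Fin 2 → ℝ), p.2) := by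
    refine (contDiff_pi.2 fun i => ?_).prodMk contDiff_snd
    fin_cases i
    · exact contDiff_fst.comp contDiff_fst
    · exact contDiff_snd.comp contDiff_fst
  have hΞ : ContDiff ℝ ∞ fun p : (ℝ × ℝ) × ℝ =>
      I.varDeriv (u + φ p.1.1 • h₁ + φ p.1.2 • h₂) p.2 := by
    have h3 := h1.comp h2
    simpa [Function.comp_def, Fin.sum_univ_two, add_assoc] using h3
  have hA : ∀ h : ℝ → Fin N → ℝ, ContDiff ℝ ∞ h → ContDiff ℝ ∞ fun p : (ℝ × ℝ) × ℝ =>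
      ⟪I.varDeriv (u + φ p.1.1 • h₁ + φ p.1.2 • h₂) p.2, h p.2⟫ := fun h hh =>
    HydroBracket.contDiff_pairL hΞ (hh.comp contDiff_snd)
  have d1 := fun q => hasFDerivAt_intervalIntegral_of_contDiff (hA h₁ hh₁) (-R) R q
  have d2 := fun q => hasFDerivAt_intervalIntegral_of_contDiff (hA h₂ hh₂) (-R) R q
  have f1 : Differentiable ℝ fun q : ℝ × ℝ => deriv φ q.1 *
      ∫ x in (-R)..R, ⟪I.varDeriv (u + φ q.1 • h₁ + φ q.2 • h₂) x, h₁ x⟫ := fun q =>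
    ((cφ'.comp contDiff_fst).differentiable (by simp) q).mul (d1 q).differentiableAt
  have f2 : Differentiable ℝ fun q : ℝ × ℝ => deriv φ q.2 *
      ∫ x in (-R)..R, ⟪I.varDeriv (u + φ q.1 • h₁ + φ q.2 • h₂) x, h₂ x⟫ := fun q =>
    ((cφ'.comp contDiff_snd).differentiable (by simp) q).mul (d2 q).differentiableAt
  have key := mixed_deriv_comm (F := fun s t => I.toFun (u + φ s • h₁ + φ t • h₂)) (q := (0, 0))
    (fun s t => by
      have := I.hasDerivAt_toFun_line (hfield s t) hh₁ hR₁ (dφ s) (v := u + φ t • h₂)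
        (add_right_comm _ _ _)
      simpa only [add_right_comm u (φ t • h₂)] using this)
    (fun s t => I.hasDerivAt_toFun_line (hfield s t) hh₂ hR₂ (dφ t) rfl)
    f1.continuous f2.continuous (f1 (0, 0)).hasFDerivAt (f2 (0, 0)).hasFDerivAt
  have e1 := (f1 (0, 0)).hasFDerivAt.hasDerivAt_snd
  have e2 := (f2 (0, 0)).hasFDerivAt.hasDerivAt_fst
  rw [key] at e1
  have g : ∀ h k : ℝ → Fin N → ℝ, ContDiff ℝ ∞ h →
      (ContDiff ℝ ∞ fun q : ℝ × ℝ => I.varDeriv (u + φ q.1 • k) q.2) →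
      HasDerivAt (fun s => ∫ x in (-R)..R, ⟪I.varDeriv (u + φ s • k) x, h x⟫)
        (∫ x in (-R)..R, ⟪I.secondVar u k x, h x⟫) 0 := fun h k hh hs => by
    have c := contDiff_deriv_family_left (w := fun s x => I.varDeriv (u + φ s • k) x) hs
    have c1 := fun s =>
      (contDiff_section_right (w := fun s x => I.varDeriv (u + φ s • k) x) hs s).continuous
    have c2 := hh.continuous
    have c3 := c.continuous
    have := hasDerivAt_intervalIntegral_of_continuous
      (F := fun s x => ⟪I.varDeriv (u + φ s • k) x, h x⟫)
      (F' := fun s x => ⟪deriv (fun s => I.varDeriv (u + φ s • k) x) s, h x⟫)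
      (fun s => by have := c1 s; fun_prop) (by fun_prop)
      (fun s x => ((pairL.flip (h x)).hasFDerivAt.comp_hasDerivAt s
        ((contDiff_section_left (w := fun s x => I.varDeriv (u + φ s • k) x) hs x).differentiable
          (by simp) s).hasDerivAt)) (-R) R 0
    refine this.congr_deriv ?_
    simp only [(hasDerivAt_varDeriv_of_line cφ φ0 φ1 hs _).deriv]
  have s1 : ContDiff ℝ ∞ fun q : ℝ × ℝ => I.varDeriv (u + φ q.1 • h₁) q.2 := by
    have : ContDiff ℝ ∞ fun q : ℝ × ℝ => ((q.1, (0 : ℝ)), q.2) :=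
      (contDiff_fst.prodMk contDiff_const).prodMk contDiff_snd
    have h3 := hΞ.comp this
    simpa [Function.comp_def, φ0] using h3
  have s2 : ContDiff ℝ ∞ fun q : ℝ × ℝ => I.varDeriv (u + φ q.1 • h₂) q.2 := by
    have : ContDiff ℝ ∞ fun q : ℝ × ℝ => (((0 : ℝ), q.1), q.2) :=
      (contDiff_const.prodMk contDiff_fst).prodMk contDiff_snd
    have h3 := hΞ.comp this
    simpa [Function.comp_def, φ0] using h3
  simp only [φ1.deriv, one_mul, φ0, zero_smul, add_zero] at e1 e2
  rw [integral_eq_intervalIntegral_of_vanish (R := R) fun x hx => by rw [hR₂ x hx, map_zero],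
    integral_eq_intervalIntegral_of_vanish (R := R) fun x hx => by rw [hR₁ x hx, map_zero],
    (g h₂ h₁ hh₂ s1).unique e2, (g h₁ h₂ hh₁ s2).unique e1]

end SmoothFunctional

/-! ### Sufficient conditions for the Jacobi identity -/

namespace HydroBracket

variable {N : ℕ} {P : HydroBracket N} {U : Set (Fin N → ℝ)} {u ξ η ζ : ℝ → Fin N → ℝ}

theorem pairing_eq_integral_op : P.pairing u ξ η = ∫ x, ⟪ξ x, P.op u η x⟫ := by
  simp only [pairing, pairL_apply]

/-- The failure of skew-symmetry of the bracket, when `g` is symmetric. -/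
theorem pairing_add_pairing (hU : IsOpen U) (hP : P.SmoothOn U)
    (hG : ∀ p ∈ U, ∀ ξ η, ⟪ξ, P.gL p η⟫ = ⟪η, P.gL p ξ⟫) (hu : IsHydroField U u)
    (hξ : IsHydroField Set.univ ξ) (hη : IsHydroField Set.univ η) :
    P.pairing u ξ η + P.pairing u η ξ = ∫ x, (⟪ξ x, P.bL (u x) (deriv u x) (η x)⟫
      + ⟪η x, P.bL (u x) (deriv u x) (ξ x)⟫ - ⟪ξ x, fderiv ℝ P.gL (u x) (deriv u x) (η x)⟫) := by
  obtain ⟨c, R, -, hR⟩ := hu.exists_radius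
  obtain ⟨c₁, R₁, -, hR₁⟩ := hξ.exists_radius
  obtain ⟨c₂, R₂, -, hR₂⟩ := hη.exists_radius
  set ρ := max R (max R₁ R₂)
  replace hR : ∀ x, ρ ≤ |x| → u x = c ∧ deriv u x = 0 := fun x hx =>
    hR x ((le_max_left _ _).trans hx)
  replace hR₁ : ∀ x, ρ ≤ |x| → ξ x = c₁ ∧ deriv ξ x = 0 := fun x hx =>
    hR₁ x (((le_max_left _ _).trans (le_max_right _ _)).trans hx)
  replace hR₂ : ∀ x, ρ ≤ |x| → η x = c₂ ∧ deriv η x = 0 := fun x hx =>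
    hR₂ x (((le_max_right _ _).trans (le_max_right _ _)).trans hx)
  have r1 : ρ ≤ |ρ| := le_abs_self ρ
  have r2 : ρ ≤ |-ρ| := by rw [abs_neg]; exact r1
  have cu0 := hu.smooth.continuous
  have cu := hu.contDiff_deriv.continuous
  have cξ := hξ.smooth.continuous
  have cη := hη.smooth.continuous
  have cξ' := hξ.contDiff_deriv.continuous
  have cη' := hη.contDiff_deriv.continuous
  have cB := (hP.contDiff_bL_comp hu.smooth hu.mem).continuous
  have cG := (hP.contDiff_gL_comp hu.smooth hu.mem).continuous
  have cG' : Continuous fun x => fderiv ℝ P.gL (u x) :=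
    (hP.contDiffOn_gL.fderiv_of_isOpen hU (m := ∞) (by simp)).continuousOn.comp_continuous cu0 hu.mem
  have cX := (contDiff_invD_pairL hu hξ.smooth).continuous
  have cY := (contDiff_invD_pairL hu hη.smooth).continuous
  have I₁ : ∫ x, (⟪deriv ξ x, P.gL (u x) (η x)⟫ + ⟪ξ x, fderiv ℝ P.gL (u x) (deriv u x) (η x)⟫
      + ⟪ξ x, P.gL (u x) (deriv η x)⟫) = 0 := by
    refine integral_eq_zero_of_hasDerivAt_of_eq (R := ρ) (F := fun x => ⟪ξ x, P.gL (u x) (η x)⟫)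
      (fun x => ?_) (by fun_prop)
      (fun x hx => by simp [(hR x hx).2, (hR₁ x hx).2, (hR₂ x hx).2])
      (by simp only [(hR _ r1).1, (hR _ r2).1, (hR₁ _ r1).1, (hR₁ _ r2).1, (hR₂ _ r1).1,
        (hR₂ _ r2).1])
    have dG := (hP.hasFDerivAt_gL hU (hu.mem x)).comp_hasDerivAt x
      (hu.smooth.differentiable (by simp) x).hasDerivAt
    have := (pairL.hasFDerivAt.comp_hasDerivAt x
      (hξ.smooth.differentiable (by simp) x).hasDerivAt).clm_apply
      (dG.clm_apply (hη.smooth.differentiable (by simp) x).hasDerivAt)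
    refine this.congr_deriv ?_
    simp only [Function.comp, map_add]
    ring
  have I₂ := integral_mul_invD (R := ρ) (f := fun x => ⟪ξ x, deriv u x⟫)
    (k := fun x => ⟪η x, deriv u x⟫) (by fun_prop) (fun x hx => by rw [(hR x hx).2, map_zero])
    (by fun_prop) (fun x hx => by rw [(hR x hx).2, map_zero])
  have J₁ := integrable_of_vanish (R := ρ) (f := fun x => ⟪deriv ξ x, P.gL (u x) (η x)⟫
      + ⟪ξ x, fderiv ℝ P.gL (u x) (deriv u x) (η x)⟫ + ⟪ξ x, P.gL (u x) (deriv η x)⟫)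
    (by fun_prop) (fun x hx => by simp [(hR x hx).2, (hR₁ x hx).2, (hR₂ x hx).2])
  have J₂ := integrable_of_vanish (R := ρ) (f := fun x =>
      P.K * (⟪ξ x, deriv u x⟫ * invD (fun x => ⟪η x, deriv u x⟫) x
        + ⟪η x, deriv u x⟫ * invD (fun x => ⟪ξ x, deriv u x⟫) x))
    (by fun_prop) (fun x hx => by simp [(hR x hx).2])
  have J₀ := integrable_of_vanish (R := ρ) (f := fun x => ⟪ξ x, P.bL (u x) (deriv u x) (η x)⟫
      + ⟪η x, P.bL (u x) (deriv u x) (ξ x)⟫ - ⟪ξ x, fderiv ℝ P.gL (u x) (deriv u x) (η x)⟫)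
    (by fun_prop) (fun x hx => by simp [(hR x hx).2])
  have key : ∀ x, ⟪ξ x, P.op u η x⟫ + ⟪η x, P.op u ξ x⟫
      = (⟪ξ x, P.bL (u x) (deriv u x) (η x)⟫
      + ⟪η x, P.bL (u x) (deriv u x) (ξ x)⟫ - ⟪ξ x, fderiv ℝ P.gL (u x) (deriv u x) (η x)⟫)
      + (⟪deriv ξ x, P.gL (u x) (η x)⟫
      + ⟪ξ x, fderiv ℝ P.gL (u x) (deriv u x) (η x)⟫ + ⟪ξ x, P.gL (u x) (deriv η x)⟫)
      + P.K * (⟪ξ x, deriv u x⟫ * invD (fun x => ⟪η x, deriv u x⟫) x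
        + ⟪η x, deriv u x⟫ * invD (fun x => ⟪ξ x, deriv u x⟫) x) := fun x => by
    rw [op_eq hu hη.smooth, op_eq hu hξ.smooth, hG (u x) (hu.mem x) (deriv ξ x)]
    simp only [HydroJet.opVal, jet, map_add, map_smul, smul_eq_mul]
    ring
  rw [pairing_eq_integral_op, pairing_eq_integral_op, ← MeasureTheory.integral_add
    (integrable_pairing hP hu cξ hη) (integrable_pairing hP hu cη hξ),
    MeasureTheory.integral_congr_ae (Filter.Eventually.of_forall key),
    MeasureTheory.integral_add (J₀.fun_add J₁) J₂, MeasureTheory.integral_add J₀ J₁,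
    MeasureTheory.integral_const_mul, I₁, I₂]
  ring

theorem pairing_skew (hU : IsOpen U) (hP : P.SmoothOn U)
    (hG : ∀ p ∈ U, ∀ ξ η, ⟪ξ, P.gL p η⟫ = ⟪η, P.gL p ξ⟫) (hPm : P.IsMetric U)
    (hu : IsHydroField U u) (hξ : IsHydroField Set.univ ξ) (hη : IsHydroField Set.univ η) :
    P.pairing u ξ η = - P.pairing u η ξ := by
  rw [← add_eq_zero_iff_eq_neg, pairing_add_pairing hU hP hG hu hξ hη]
  simp only [hPm _ (hu.mem _)]
  simp

theorem integrable_variation (hU : IsOpen U) (hP : P.SmoothOn U) (hu : IsHydroField U u)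
    (hξ : IsHydroField Set.univ ξ) (hη : IsHydroField Set.univ η) {h : ℝ → Fin N → ℝ}
    (ch : Continuous h) {R : ℝ} (hR : ∀ x, R ≤ |x| → h x = 0) :
    MeasureTheory.Integrable fun x => (P.jet (u x)).variation (deriv u x) (ξ x)
      (deriv ξ x) (invD (fun y => ⟪ξ y, deriv u y⟫) x) (η x) (deriv η x)
      (invD (fun y => ⟪η y, deriv u y⟫) x) (h x) := by
  have cu0 := hu.smooth.continuous
  have cu := hu.contDiff_deriv.continuous
  have cξ := hξ.smooth.continuous
  have cη := hη.smooth.continuous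
  have cξ' := hξ.contDiff_deriv.continuous
  have cη' := hη.contDiff_deriv.continuous
  have cB := (hP.contDiff_bL_comp hu.smooth hu.mem).continuous
  have cD := hP.continuous_fderiv_bL_comp hU cu0 hu.mem
  have cX := (contDiff_invD_pairL hu hξ.smooth).continuous
  have cY := (contDiff_invD_pairL hu hη.smooth).continuous
  refine integrable_of_vanish (R := R)
    (by simp only [HydroJet.variation, HydroJet.curv, jet]; fun_prop)
    (fun x hx => by simp [HydroJet.variation, HydroJet.curv, jet, hR x hx])

/-- The Jacobi identity reduces to the integral of the pointwise obstructions. -/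
theorem sum_fieldVariation (hU : IsOpen U) (hP : P.SmoothOn U)
    (hG : ∀ p ∈ U, ∀ ξ η, ⟪ξ, P.gL p η⟫ = ⟪η, P.gL p ξ⟫) (hu : IsHydroField U u)
    (hξ : IsHydroField Set.univ ξ) (hη : IsHydroField Set.univ η)
    (hζ : IsHydroField Set.univ ζ) :
    P.fieldVariation u ξ η (P.op u ζ) + P.fieldVariation u η ζ (P.op u ξ)
      + P.fieldVariation u ζ ξ (P.op u η)
    = ∫ x, ((P.jet (u x)).obsA (P.jet (u x)) (ξ x) (deriv η x) (deriv ζ x)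
      + (P.jet (u x)).obsA (P.jet (u x)) (η x) (deriv ζ x) (deriv ξ x)
      + (P.jet (u x)).obsA (P.jet (u x)) (ζ x) (deriv ξ x) (deriv η x)
      + (P.jet (u x)).obsB (P.jet (u x)) (deriv u x) (ξ x) (η x) (deriv ζ x)
      + (P.jet (u x)).obsB (P.jet (u x)) (deriv u x) (η x) (ζ x) (deriv ξ x)
      + (P.jet (u x)).obsB (P.jet (u x)) (deriv u x) (ζ x) (ξ x) (deriv η x)
      + (P.jet (u x)).obsC (P.jet (u x)) (deriv u x) (ξ x) (η x) (ζ x)) := by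
  obtain ⟨R₁, hR₁⟩ := op_vanish (P := P) hu hξ
  obtain ⟨R₂, hR₂⟩ := op_vanish (P := P) hu hη
  obtain ⟨R₃, hR₃⟩ := op_vanish (P := P) hu hζ
  have i1 := integrable_variation hU hP hu hξ hη (contDiff_op hP hu hζ.smooth).continuous hR₃
  have i2 := integrable_variation hU hP hu hη hζ (contDiff_op hP hu hξ.smooth).continuous hR₁
  have i3 := integrable_variation hU hP hu hζ hξ (contDiff_op hP hu hη.smooth).continuous hR₂
  rw [fieldVariation, fieldVariation, fieldVariation, ← MeasureTheory.integral_add i1 i2,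
    ← MeasureTheory.integral_add (i1.fun_add i2) i3]
  congr 1
  funext x
  rw [op_eq hu hξ.smooth, op_eq hu hη.smooth, op_eq hu hζ.smooth]
  exact HydroJet.sum_variation _ (hG (u x) (hu.mem x)) _ _ _ _ _ _ _ _ _ _

/-- The cyclic sum of the field variations vanishes pointwise, and the six terms with second
variations cancel in pairs, one pair for each functional. -/
theorem isPoisson_of_jet (hU : IsOpen U) (hP : P.SmoothOn U) (hPm : P.IsMetric U)
    (hj : ∀ p ∈ U, (P.jet p).IsPoisson) : P.IsPoisson U := by
  have hG : ∀ p ∈ U, ∀ ξ η, ⟪ξ, P.gL p η⟫ = ⟪η, P.gL p ξ⟫ := fun p hp => (hj p hp).symm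
  refine ⟨fun I J u hu => pairing_skew hU hP hG hPm hu (I.isHydroField_varDeriv hu)
    (J.isHydroField_varDeriv hu), fun I J L u hu => ?_⟩
  have hI := I.isHydroField_varDeriv hu
  have hJ := J.isHydroField_varDeriv hu
  have hL := L.isHydroField_varDeriv hu
  obtain ⟨R₁, hR₁⟩ := op_vanish (P := P) hu hI
  obtain ⟨R₂, hR₂⟩ := op_vanish (P := P) hu hJ
  obtain ⟨R₃, hR₃⟩ := op_vanish (P := P) hu hL
  set R := max R₁ (max R₂ R₃)
  replace hR₁ : ∀ x, R ≤ |x| → P.hamVec I u x = 0 := fun x hx =>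
    hR₁ x ((le_max_left _ _).trans hx)
  replace hR₂ : ∀ x, R ≤ |x| → P.hamVec J u x = 0 := fun x hx =>
    hR₂ x (((le_max_left _ _).trans (le_max_right _ _)).trans hx)
  replace hR₃ : ∀ x, R ≤ |x| → P.hamVec L u x = 0 := fun x hx =>
    hR₃ x (((le_max_right _ _).trans (le_max_right _ _)).trans hx)
  have cI : ContDiff ℝ ∞ (P.hamVec I u) := contDiff_op hP hu hI.smooth
  have cJ : ContDiff ℝ ∞ (P.hamVec J u) := contDiff_op hP hu hJ.smooth
  have cL : ContDiff ℝ ∞ (P.hamVec L u) := contDiff_op hP hu hL.smooth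
  refine ⟨_, _, _, hasDerivAt_bracket hU hP hPm I J hu cL hR₃,
    hasDerivAt_bracket hU hP hPm J L hu cI hR₁, hasDerivAt_bracket hU hP hPm L I hu cJ hR₂, ?_⟩
  have s := sum_fieldVariation hU hP hG hu hI hJ hL
  simp only [(hj _ (hu.mem _)).obsA, (hj _ (hu.mem _)).obsB, (hj _ (hu.mem _)).obsC, add_zero,
    MeasureTheory.integral_zero] at s
  -- Skew-symmetry brings each second variation to the left slot. The two terms of one functional
  -- are then its second variation on the Hamiltonian vector fields of the other two, in the two
  -- orders and with opposite signs.
  have k1 := pairing_skew hU hP hG hPm hu hI (J.isHydroField_secondVar hU hu cL hR₃)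
  have k2 := pairing_skew hU hP hG hPm hu hJ (L.isHydroField_secondVar hU hu cI hR₁)
  have k3 := pairing_skew hU hP hG hPm hu hL (I.isHydroField_secondVar hU hu cJ hR₂)
  have m1 := I.integral_secondVar_comm hU hu cJ cL hR₂ hR₃
  have m2 := J.integral_secondVar_comm hU hu cL cI hR₃ hR₁
  have m3 := L.integral_secondVar_comm hU hu cI cJ hR₁ hR₂
  simp only [hamVec] at *
  rw [k1, k2, k3]
  simp only [pairing_eq_integral_op]
  linarith

end HydroBracket

/-! ### Test fields and the necessity of the pointwise conditions -/

/-- A smooth function on the line that vanishes, with its derivatives of first and second order,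
outside `(-4, 4)` and is not constant. -/
structure IsBump (φ : ℝ → ℝ) : Prop where
  smooth : ContDiff ℝ ∞ φ
  vanish : ∀ x, 4 ≤ |x| → φ x = 0
  vanish_deriv : ∀ x, 4 ≤ |x| → deriv φ x = 0
  pos : 0 < ∫ x in (-4)..4, deriv φ x ^ 2

theorem exists_isBump : ∃ φ, IsBump φ := by
  let f : ContDiffBump (0 : ℝ) := ⟨1, 2, one_pos, one_lt_two⟩
  have hs : ContDiff ℝ ∞ f := f.contDiff
  have v0 : ∀ x, 2 ≤ |x| → f x = 0 := fun x hx => f.zero_of_le_dist (by simpa using hx)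
  have v1 : ∀ x, 3 ≤ |x| → deriv f x = 0 := fun x hx =>
    deriv_eq_zero_of_const v0 x (by linarith)
  have hc : Continuous (deriv f) := (contDiff_infty_iff_deriv.1 hs).2.continuous
  refine ⟨f, hs, fun x hx => v0 x (by linarith), fun x hx => v1 x (by linarith), ?_⟩
  obtain ⟨c, -, hc'⟩ := exists_deriv_eq_slope (f : ℝ → ℝ) (show (0 : ℝ) < 2 by norm_num)
    hs.continuous.continuousOn (hs.differentiable (by simp)).differentiableOn
  have hne : deriv f c ≠ 0 := by
    rw [hc', v0 2 (by norm_num), f.one_of_mem_closedBall (by simp [f])]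
    norm_num
  have hv : ∀ x, 4 ≤ |x| → deriv f x ^ 2 = 0 := fun x hx => by
    rw [v1 x (by linarith)]; norm_num
  rw [← integral_eq_intervalIntegral_of_vanish hv]
  exact (hc.pow 2).integral_pos_of_hasCompactSupport_nonneg_nonzero (hasCompactSupport_of_vanish hv)
    (fun x => sq_nonneg _) (pow_ne_zero 2 hne)

namespace IsBump

variable {N : ℕ} {U : Set (Fin N → ℝ)} {φ : ℝ → ℝ}

theorem continuous (hφ : IsBump φ) : Continuous φ := hφ.smooth.continuous

theorem contDiff_deriv (hφ : IsBump φ) : ContDiff ℝ ∞ (deriv φ) :=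
  (contDiff_infty_iff_deriv.1 hφ.smooth).2

theorem hasDerivAt (hφ : IsBump φ) (x : ℝ) : HasDerivAt φ (deriv φ x) x :=
  (hφ.smooth.differentiable (by simp) x).hasDerivAt

theorem isHydroField_smul (hφ : IsBump φ) (a : Fin N → ℝ) :
    IsHydroField Set.univ fun x => φ x • a :=
  IsHydroField.of_vanish (hφ.smooth.smul contDiff_const) (R := 4)
    fun x hx => by rw [hφ.vanish x hx, zero_smul]

theorem isHydroField_deriv_smul (hφ : IsBump φ) (a : Fin N → ℝ) :
    IsHydroField Set.univ fun x => deriv φ x • a :=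
  IsHydroField.of_vanish (hφ.contDiff_deriv.smul contDiff_const) (R := 4)
    fun x hx => by rw [hφ.vanish_deriv x hx, zero_smul]

theorem deriv_smul (hφ : IsBump φ) (a : Fin N → ℝ) (x : ℝ) :
    deriv (fun x => φ x • a) x = deriv φ x • a :=
  ((hφ.hasDerivAt x).smul_const a).deriv

theorem deriv_testField (hφ : IsBump φ) (p v : Fin N → ℝ) (e x : ℝ) :
    deriv (fun x => p + (e * φ x) • v) x = (e * deriv φ x) • v :=
  ((((hφ.hasDerivAt x).const_mul e).smul_const v).const_add p).deriv

/-- Extraction of a pointwise identity from identities for the fields `p + e φ v`. -/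
theorem eq_zero_of_testField (hφ : IsBump φ) (hU : IsOpen U) {p : Fin N → ℝ} (hp : p ∈ U)
    (v : Fin N → ℝ) {Q Q₂ : (Fin N → ℝ) → ℝ} (hQ : ContinuousOn Q U) (hQ₂ : ContinuousOn Q₂ U)
    {χ : ℝ → ℝ} (hχ : Continuous χ)
    (h : ∀ e : ℝ, IsHydroField U (fun x => p + (e * φ x) • v) →
      e * (∫ x in (-4)..4, Q (p + (e * φ x) • v) * deriv φ x ^ 2)
        + e ^ 2 * (∫ x in (-4)..4, Q₂ (p + (e * φ x) • v) * χ x) = 0) : Q p = 0 := by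
  have hv := (hφ.isHydroField_smul v)
  obtain ⟨δ, hδ, hmem⟩ := exists_pos_forall_add_smul_mem hU (IsHydroField.const hp)
    hv.smooth.continuous hv.smooth.continuous (R := 4)
    (fun x hx => by rw [hφ.vanish x hx, zero_smul]) (fun x hx => by rw [hφ.vanish x hx, zero_smul])
  have hmem' : ∀ s x, p + (sinScale δ s * φ x) • v ∈ U := fun s x => by
    simpa [smul_smul] using hmem (sinScale δ s) 0 (abs_sinScale_le hδ s) (by simpa using hδ.le) x
  have hfield : ∀ s, IsHydroField U fun x => p + (sinScale δ s * φ x) • v := fun s =>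
    ⟨contDiff_const.add ((contDiff_const.mul hφ.smooth).smul contDiff_const), hmem' s, p, 4,
      fun x hx => by simp [hφ.vanish x hx]⟩
  have cs := (contDiff_sinScale δ).continuous
  have cφ := hφ.continuous
  have cφ' := hφ.contDiff_deriv.continuous
  have cw : Continuous fun q : ℝ × ℝ => p + (sinScale δ q.1 * φ q.2) • v := by fun_prop
  have cQ := hQ.comp_continuous cw fun q => hmem' q.1 q.2
  have cQ₂ := hQ₂.comp_continuous cw fun q => hmem' q.1 q.2
  have c1 : Continuous fun s => (∫ x in (-4)..4, Q (p + (sinScale δ s * φ x) • v) * deriv φ x ^ 2)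
      + sinScale δ s * ∫ x in (-4)..4, Q₂ (p + (sinScale δ s * φ x) • v) * χ x := by
    refine Continuous.add ?_ (cs.mul ?_)
    · refine intervalIntegral.continuous_parametric_intervalIntegral_of_continuous' ?_ _ _
      exact cQ.mul ((cφ'.comp continuous_snd).pow 2)
    · refine intervalIntegral.continuous_parametric_intervalIntegral_of_continuous' ?_ _ _
      exact cQ₂.mul (hχ.comp continuous_snd)
  -- For `0 < s < δ` the amplitude `sinScale δ s` is positive and can be divided out; continuity at
  -- `s = 0` then leaves `Q p` times the positive number `∫ φ'²`.
  have hz : Set.EqOn (fun s => (∫ x in (-4)..4, Q (p + (sinScale δ s * φ x) • v) * deriv φ x ^ 2)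
      + sinScale δ s * ∫ x in (-4)..4, Q₂ (p + (sinScale δ s * φ x) • v) * χ x) (fun _ => 0)
      (Set.Ioo 0 δ) := fun s hs => by
    have hpos : 0 < sinScale δ s := by
      refine mul_pos hδ (Real.sin_pos_of_pos_of_lt_pi (div_pos hs.1 hδ) ?_)
      have : s / δ < 1 := (div_lt_one hδ).2 hs.2
      linarith [Real.pi_gt_three]
    have := h (sinScale δ s) (hfield s)
    refine (mul_eq_zero.1 ?_).resolve_left hpos.ne'
    linarith
  have h0 := hz.closure c1 continuous_const (x := 0)
    (by rw [closure_Ioo hδ.ne]; exact ⟨le_rfl, hδ.le⟩)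
  simp only [sinScale_zero, zero_mul, zero_smul, add_zero] at h0
  rw [intervalIntegral.integral_const_mul] at h0
  exact (mul_eq_zero.1 h0).resolve_right hφ.pos.ne'

/-- The version of `eq_zero_of_testField` without a term of second order. -/
theorem eq_zero_of_testField' (hφ : IsBump φ) (hU : IsOpen U) {p : Fin N → ℝ} (hp : p ∈ U)
    (v : Fin N → ℝ) {Q : (Fin N → ℝ) → ℝ} (hQ : ContinuousOn Q U)
    (h : ∀ e : ℝ, IsHydroField U (fun x => p + (e * φ x) • v) →
      e * (∫ x in (-4)..4, Q (p + (e * φ x) • v) * deriv φ x ^ 2) = 0) : Q p = 0 :=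
  hφ.eq_zero_of_testField hU hp v hQ (Q₂ := fun _ => 0) continuousOn_const
    (χ := fun _ => 0) continuous_const fun e he => by simpa using h e he

end IsBump

/-! ### Homogeneity of the obstructions -/

namespace HydroJet

variable {N : ℕ} (X Y : HydroJet N)

theorem obsA_smul (a b : ℝ) (ξ η ζ : Fin N → ℝ) :
    X.obsA Y ξ (a • η) (b • ζ) = a * b * X.obsA Y ξ η ζ := by
  simp only [obsA, map_smul, smul_apply, smul_eq_mul]
  ring

theorem obsA_zero_left (ξ ζ : Fin N → ℝ) : X.obsA Y ξ 0 ζ = 0 := by simp [obsA]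

theorem obsA_zero_right (ξ η : Fin N → ℝ) : X.obsA Y ξ η 0 = 0 := by simp [obsA]

theorem obsB_smul (a b : ℝ) (v ξ η ζ : Fin N → ℝ) :
    X.obsB Y (a • v) ξ η (b • ζ) = a * b * X.obsB Y v ξ η ζ := by
  simp only [obsB, curv, map_smul, smul_apply, smul_eq_mul]
  ring

theorem obsB_zero_left (ξ η ζ : Fin N → ℝ) : X.obsB Y 0 ξ η ζ = 0 := by simp [obsB, curv]

theorem obsB_zero_right (v ξ η : Fin N → ℝ) : X.obsB Y v ξ η 0 = 0 := by simp [obsB, curv]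

theorem obsC_smul (a b : ℝ) (v ξ η ζ : Fin N → ℝ) :
    X.obsC Y (a • v) (b • ξ) η ζ = a ^ 2 * b * X.obsC Y v ξ η ζ := by
  simp only [obsC, curv, map_smul, smul_apply, smul_eq_mul]
  ring

theorem obsC_zero_left (ξ η ζ : Fin N → ℝ) : X.obsC Y 0 ξ η ζ = 0 := by simp [obsC, curv]

end HydroJet

/-! ### Pointwise conditions extracted from a Poisson bracket -/

namespace HydroBracket

variable {N : ℕ} {P : HydroBracket N} {U : Set (Fin N → ℝ)} {u ξ η ζ : ℝ → Fin N → ℝ}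

theorem SmoothOn.continuousOn_obsA (hP : P.SmoothOn U) (ξ η ζ : Fin N → ℝ) :
    ContinuousOn (fun p => (P.jet p).obsA (P.jet p) ξ η ζ) U := by
  have hg := hP.contDiffOn_gL.continuousOn
  have hb := hP.contDiffOn_bL.continuousOn
  simp only [HydroJet.obsA, jet]
  fun_prop

theorem SmoothOn.continuousOn_obsB (hP : P.SmoothOn U) (hU : IsOpen U) (v ξ η ζ : Fin N → ℝ) :
    ContinuousOn (fun p => (P.jet p).obsB (P.jet p) v ξ η ζ) U := by
  have hg := hP.contDiffOn_gL.continuousOn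
  have hb := hP.contDiffOn_bL.continuousOn
  have hd := (hP.contDiffOn_fderiv_bL hU).continuousOn
  simp only [HydroJet.obsB, HydroJet.curv, jet]
  fun_prop

theorem SmoothOn.continuousOn_obsC (hP : P.SmoothOn U) (hU : IsOpen U) (v ξ η ζ : Fin N → ℝ) :
    ContinuousOn (fun p => (P.jet p).obsC (P.jet p) v ξ η ζ) U := by
  have hb := hP.contDiffOn_bL.continuousOn
  have hd := (hP.contDiffOn_fderiv_bL hU).continuousOn
  simp only [HydroJet.obsC, HydroJet.curv, jet]
  fun_prop

theorem IsPoisson.pairing_skew (h : P.IsPoisson U) (hu : IsHydroField U u)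
    (hξ : IsHydroField Set.univ ξ) (hη : IsHydroField Set.univ η) :
    P.pairing u ξ η = - P.pairing u η ξ :=
  h.1 (linFunctional U ξ hξ) (linFunctional U η hη) u hu

/-- At a constant field only `g` acts. With covectors `φ' a` and `φ b`, integration by parts makes
both sides of skew-symmetry multiples of `∫ φ'²`. -/
theorem IsPoisson.gL_symm (h : P.IsPoisson U) {p : Fin N → ℝ} (hp : p ∈ U) (a b : Fin N → ℝ) :
    ⟪a, P.gL p b⟫ = ⟪b, P.gL p a⟫ := by
  obtain ⟨φ, hφ⟩ := exists_isBump
  have hs := h.pairing_skew (IsHydroField.const hp) (hφ.isHydroField_deriv_smul a)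
    (hφ.isHydroField_smul b)
  have dd : ∀ x, HasDerivAt (deriv φ) (deriv (deriv φ) x) x := fun x =>
    (hφ.contDiff_deriv.differentiable (by simp) x).hasDerivAt
  have e2 : ∀ x, deriv (fun x => deriv φ x • a) x = deriv (deriv φ) x • a := fun x =>
    ((dd x).smul_const a).deriv
  have c1 := hφ.continuous
  have c2 := hφ.contDiff_deriv.continuous
  have c3 := (contDiff_infty_iff_deriv.1 hφ.contDiff_deriv).2.continuous
  rw [pairing_eq (IsHydroField.const hp) (hφ.isHydroField_smul b).smooth,
    pairing_eq (IsHydroField.const hp) (hφ.isHydroField_deriv_smul a).smooth] at hs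
  simp only [deriv_const, HydroJet.opVal, jet, hφ.deriv_smul, e2, map_zero, zero_apply, smul_zero,
    add_zero, map_smul, smul_apply, smul_eq_mul] at hs
  have hi : ∫ x, (deriv φ x * deriv φ x + deriv (deriv φ) x * φ x) = 0 :=
    integral_eq_zero_of_hasDerivAt_of_eq (R := 4) (F := fun x => deriv φ x * φ x)
      (fun x => ((dd x).mul (hφ.hasDerivAt x)).congr_deriv (add_comm _ _)) (by fun_prop)
      (fun x hx => by simp [hφ.vanish x hx, hφ.vanish_deriv x hx])
      (by simp [hφ.vanish 4 (by norm_num), hφ.vanish (-4) (by norm_num)])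
  have i1 : MeasureTheory.Integrable fun x => deriv φ x * deriv φ x :=
    integrable_of_vanish (R := 4) (by fun_prop) fun x hx => by simp [hφ.vanish_deriv x hx]
  have i2 : MeasureTheory.Integrable fun x => deriv (deriv φ) x * φ x :=
    integrable_of_vanish (R := 4) (by fun_prop) fun x hx => by simp [hφ.vanish x hx]
  rw [MeasureTheory.integral_add i1 i2] at hi
  have hpos := hφ.pos
  rw [← integral_eq_intervalIntegral_of_vanish (R := 4)
    fun x hx => by simp [hφ.vanish_deriv x hx]] at hpos
  have f3 : ∫ x, deriv φ x ^ 2 = ∫ x, deriv φ x * deriv φ x := by simp only [sq]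
  simp only [← mul_assoc, MeasureTheory.integral_mul_const] at hs
  rw [eq_neg_of_add_eq_zero_right hi, ← f3] at hs
  have : (∫ x, deriv φ x ^ 2) * (⟪a, P.gL p b⟫ - ⟪b, P.gL p a⟫) = 0 := by linarith
  linarith [(mul_eq_zero.1 this).resolve_left hpos.ne']

/-- With `g` already symmetric, the defect of skew-symmetry is an integral linear in `u_x`. The
covectors `φ' a` and constant `b`, at the field `p + e φ v`, give it the weight `e φ'²`. -/
theorem IsPoisson.isMetric (h : P.IsPoisson U) (hU : IsOpen U) (hP : P.SmoothOn U) :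
    P.IsMetric U := by
  intro p hp v a b
  obtain ⟨φ, hφ⟩ := exists_isBump
  have hg' : ContinuousOn (fderiv ℝ P.gL) U :=
    (hP.contDiffOn_gL.fderiv_of_isOpen hU (m := ∞) (by simp)).continuousOn
  have hb := hP.contDiffOn_bL.continuousOn
  have := hφ.eq_zero_of_testField' hU hp v
    (Q := fun p => ⟪a, P.bL p v b⟫ + ⟪b, P.bL p v a⟫ - ⟪a, fderiv ℝ P.gL p v b⟫)
    (by fun_prop) fun e he => by
      have hc : IsHydroField Set.univ fun _ : ℝ => b := IsHydroField.const (Set.mem_univ b)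
      have h1 := pairing_add_pairing hU hP (fun p hp => h.gL_symm hp) he
        (hφ.isHydroField_deriv_smul a) hc
      rw [h.pairing_skew he (hφ.isHydroField_deriv_smul a) hc, neg_add_cancel] at h1
      rw [h1, integral_eq_intervalIntegral_of_vanish (R := 4)
        fun x hx => by simp [hφ.vanish_deriv x hx], ← intervalIntegral.integral_const_mul]
      congr 1
      funext x
      simp only [hφ.deriv_testField, map_smul, smul_apply, smul_eq_mul]
      ring
  linarith

/-- Linear functionals have constant variational derivative, hence no second variation, so the
Jacobi identity for them involves the field variations alone. -/
theorem IsPoisson.integral_obs_eq_zero (h : P.IsPoisson U) (hU : IsOpen U) (hP : P.SmoothOn U)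
    (hu : IsHydroField U u) (hξ : IsHydroField Set.univ ξ) (hη : IsHydroField Set.univ η)
    (hζ : IsHydroField Set.univ ζ) :
    ∫ x, ((P.jet (u x)).obsA (P.jet (u x)) (ξ x) (deriv η x) (deriv ζ x)
      + (P.jet (u x)).obsA (P.jet (u x)) (η x) (deriv ζ x) (deriv ξ x)
      + (P.jet (u x)).obsA (P.jet (u x)) (ζ x) (deriv ξ x) (deriv η x)
      + (P.jet (u x)).obsB (P.jet (u x)) (deriv u x) (ξ x) (η x) (deriv ζ x)
      + (P.jet (u x)).obsB (P.jet (u x)) (deriv u x) (η x) (ζ x) (deriv ξ x)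
      + (P.jet (u x)).obsB (P.jet (u x)) (deriv u x) (ζ x) (ξ x) (deriv η x)
      + (P.jet (u x)).obsC (P.jet (u x)) (deriv u x) (ξ x) (η x) (ζ x)) = 0 := by
  have hG : ∀ p ∈ U, ∀ ξ η, ⟪ξ, P.gL p η⟫ = ⟪η, P.gL p ξ⟫ := fun p hp => h.gL_symm hp
  have hPm := h.isMetric hU hP
  rw [← sum_fieldVariation hU hP hG hu hξ hη hζ]
  obtain ⟨a₁, a₂, a₃, h₁, h₂, h₃, hs⟩ :=
    h.2 (linFunctional U ξ hξ) (linFunctional U η hη) (linFunctional U ζ hζ) u hu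
  have key : ∀ {ξ η ζ : ℝ → Fin N → ℝ} (hξ : IsHydroField Set.univ ξ)
      (hη : IsHydroField Set.univ η) (hζ : IsHydroField Set.univ ζ) {a : ℝ},
      HasDerivAt (fun ε : ℝ => P.bracket (linFunctional U ξ hξ) (linFunctional U η hη)
        (u + ε • P.hamVec (linFunctional U ζ hζ) u)) a 0 →
      P.fieldVariation u ξ η (P.op u ζ) = a := fun {ξ η ζ} hξ hη hζ {a} ha => by
    obtain ⟨R, hR⟩ := op_vanish (P := P) hu hζ
    have hd := hasDerivAt_bracket hU hP hPm (linFunctional U ξ hξ) (linFunctional U η hη) hu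
      (contDiff_op hP hu hζ.smooth) hR
    have e : ∀ θ (hθ : IsHydroField Set.univ θ),
        (linFunctional U θ hθ).secondVar u (P.op u ζ) = fun _ => 0 := fun θ hθ =>
      funext fun x => deriv_const _ _
    have hz : IsHydroField Set.univ fun _ : ℝ => (0 : Fin N → ℝ) :=
      IsHydroField.const (Set.mem_univ _)
    have z1 : ∀ θ, P.pairing u (fun _ => 0) θ = 0 := fun θ => by simp [pairing]
    have z2 := HydroBracket.pairing_skew hU hP hG hPm hu hξ hz
    rw [z1, neg_zero] at z2
    rw [e, e, z1] at hd
    change HasDerivAt _ (0 + P.pairing u ξ (fun _ => 0) + P.fieldVariation u ξ η (P.op u ζ)) 0 at hd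
    rw [z2, zero_add, zero_add] at hd
    exact hd.unique ha
  rw [key hξ hη hζ h₁, key hη hζ hξ h₂, key hζ hξ hη h₃, hs]

theorem IsPoisson.jet_isPoisson (h : P.IsPoisson U) (hU : IsOpen U) (hP : P.SmoothOn U)
    {p : Fin N → ℝ} (hp : p ∈ U) : (P.jet p).IsPoisson := by
  obtain ⟨φ, hφ⟩ := exists_isBump
  have hc : ∀ a : Fin N → ℝ, IsHydroField Set.univ fun _ : ℝ => a := fun a =>
    IsHydroField.const (Set.mem_univ a)
  -- A constant field kills the terms of types B and C. With two covectors proportional to `φ` and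
  -- the third constant, a single term of type A survives.
  have hA : ∀ p ∈ U, ∀ ξ η ζ, (P.jet p).obsA (P.jet p) ξ η ζ = 0 := fun p hp ξ η ζ => by
    have h1 := h.integral_obs_eq_zero hU hP (IsHydroField.const hp) (hφ.isHydroField_smul η)
      (hφ.isHydroField_smul ζ) (hc ξ)
    simp only [deriv_const, hφ.deriv_smul, HydroJet.obsA_zero_left, HydroJet.obsA_zero_right,
      HydroJet.obsB_zero_left, HydroJet.obsC_zero_left, HydroJet.obsA_smul, zero_add, add_zero] at h1
    rw [integral_eq_intervalIntegral_of_vanish (R := 4)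
      fun x hx => by simp [hφ.vanish_deriv x hx], intervalIntegral.integral_mul_const] at h1
    refine (mul_eq_zero.1 h1).resolve_left ?_
    simpa only [sq] using hφ.pos.ne'
  -- With only one nonconstant covector, one term of type B survives, of order `e`. The term of type
  -- C is quadratic in `u_x`, hence carries `e²` and goes into the second-order part of
  -- `eq_zero_of_testField`.
  have hB : ∀ p ∈ U, ∀ v ξ η ζ, (P.jet p).obsB (P.jet p) v ξ η ζ = 0 := fun p hp v ξ η ζ => by
    refine hφ.eq_zero_of_testField hU hp v (Q := fun p => (P.jet p).obsB (P.jet p) v ξ η ζ)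
      (hP.continuousOn_obsB hU v ξ η ζ) (hP.continuousOn_obsC hU v ζ ξ η)
      (χ := fun x => deriv φ x ^ 2 * φ x)
      ((hφ.contDiff_deriv.continuous.pow 2).mul hφ.continuous) fun e he => ?_
    have h1 := h.integral_obs_eq_zero hU hP he (hφ.isHydroField_smul ζ) (hc ξ) (hc η)
    simp only [deriv_const, hφ.deriv_smul, hφ.deriv_testField, hA _ (he.mem _),
      HydroJet.obsB_zero_right, HydroJet.obsC_smul, HydroJet.obsB_smul, zero_add, add_zero] at h1
    have cB := (hP.continuousOn_obsB hU v ξ η ζ).comp_continuous he.smooth.continuous he.mem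
    have cC := (hP.continuousOn_obsC hU v ζ ξ η).comp_continuous he.smooth.continuous he.mem
    have c1 := hφ.continuous
    have c2 := hφ.contDiff_deriv.continuous
    rw [integral_eq_intervalIntegral_of_vanish (R := 4)
      fun x hx => by simp [hφ.vanish_deriv x hx]] at h1
    rw [← intervalIntegral.integral_const_mul, ← intervalIntegral.integral_const_mul,
      ← intervalIntegral.integral_add (Continuous.intervalIntegrable (by fun_prop) _ _)
        (Continuous.intervalIntegrable (by fun_prop) _ _), ← h1]
    congr 1
    funext x
    ring
  refine ⟨fun ξ η => h.gL_symm hp ξ η, hA p hp, hB p hp, fun v ξ η ζ => ?_⟩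
  refine hφ.eq_zero_of_testField' hU hp v (Q := fun p => (P.jet p).obsC (P.jet p) v ξ η ζ)
    (hP.continuousOn_obsC hU v ξ η ζ) fun e he => ?_
  have h1 := h.integral_obs_eq_zero hU hP he (hc ξ) (hc η) (hc ζ)
  have e1 := fun q (a : ℝ) => (P.jet q).obsC_smul (P.jet q) a 1 v ξ η ζ
  simp only [one_smul, mul_one] at e1
  simp only [deriv_const, hφ.deriv_testField, hA _ (he.mem _), hB _ (he.mem _), e1,
    zero_add] at h1
  rw [integral_eq_intervalIntegral_of_vanish (R := 4)
    fun x hx => by simp [hφ.vanish_deriv x hx]] at h1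
  -- With constant covectors only type C remains, with factor `e²`. One factor `e` is cancelled; for
  -- `e = 0` the required identity is trivial.
  have h2 : e * (e * ∫ x in (-4)..4, (P.jet (p + (e * φ x) • v)).obsC
      (P.jet (p + (e * φ x) • v)) v ξ η ζ * deriv φ x ^ 2) = 0 := by
    rw [← intervalIntegral.integral_const_mul, ← intervalIntegral.integral_const_mul, ← h1]
    congr 1
    funext x
    ring
  rcases mul_eq_zero.1 h2 with h3 | h3
  · simp [h3]
  · exact h3

end HydroBracket

/-! ### Functionals of hydrodynamic type -/

section Densities

variable {N : ℕ} {V : Set (Fin N → ℝ)}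

/-- The covector with components `∂f/∂u^i`, as a function of the differential of `f`. -/
noncomputable def covectorL {N : ℕ} : ((Fin N → ℝ) →L[ℝ] ℝ) →L[ℝ] (Fin N → ℝ) :=
  ContinuousLinearMap.pi fun i => ContinuousLinearMap.apply ℝ ℝ (Pi.single i 1)

theorem pairL_covectorL (L : (Fin N → ℝ) →L[ℝ] ℝ) (v : Fin N → ℝ) : ⟪covectorL L, v⟫ = L v := by
  conv_rhs => rw [← Finset.univ_sum_single v, map_sum]
  rw [pairL_apply]
  refine Finset.sum_congr rfl fun i _ => ?_
  rw [show (Pi.single i (v i) : Fin N → ℝ) = v i • Pi.single i (1 : ℝ) by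
    rw [← Pi.single_smul', smul_eq_mul, mul_one], map_smul, smul_eq_mul, mul_comm]
  rfl

theorem covectorL_pairL (ξ : Fin N → ℝ) : covectorL (pairL ξ) = ξ := by
  funext i
  change ⟪ξ, Pi.single i 1⟫ = ξ i
  simp [pairL_apply, Pi.single_apply]

/-- The covector field `∂f/∂u^i`. -/
noncomputable def gradCovector (f : (Fin N → ℝ) → ℝ) (p : Fin N → ℝ) : Fin N → ℝ :=
  covectorL (fderiv ℝ f p)

theorem densityDeriv_eq (f : (Fin N → ℝ) → ℝ) (u : ℝ → Fin N → ℝ) :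
    densityDeriv f u = fun x => gradCovector f (u x) := rfl

/-- A closed smooth 1-form on `V`, given by its covector of components. -/
structure IsClosedForm (V : Set (Fin N → ℝ)) (θ : (Fin N → ℝ) → Fin N → ℝ) : Prop where
  smooth : ContDiffOn ℝ ∞ θ V
  symm : ∀ p ∈ V, ∀ v w, ⟪fderiv ℝ θ p v, w⟫ = ⟪fderiv ℝ θ p w, v⟫

theorem isClosedForm_gradCovector (hV : IsOpen V) {f : (Fin N → ℝ) → ℝ} (hf : ContDiffOn ℝ ∞ f V) :
    IsClosedForm V (gradCovector f) := by
  have h1 : ContDiffOn ℝ ∞ (fderiv ℝ f) V := hf.fderiv_of_isOpen hV (by simp)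
  refine ⟨covectorL.contDiff.comp_contDiffOn h1, fun p hp v w => ?_⟩
  have h2 := ((h1.contDiffAt (hV.mem_nhds hp)).differentiableAt (by simp)).hasFDerivAt
  have h3 : HasFDerivAt (gradCovector f) (covectorL.comp (fderiv ℝ (fderiv ℝ f) p)) p :=
    covectorL.hasFDerivAt.comp p h2
  rw [h3.fderiv]
  simp only [ContinuousLinearMap.comp_apply, pairL_covectorL]
  exact ((hf.contDiffAt (hV.mem_nhds hp)).isSymmSndFDerivAt
    (by simpa using WithTop.coe_le_coe.2 (le_top (a := (2 : ℕ∞))))).eq v w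

namespace IsClosedForm

variable {θ κ : (Fin N → ℝ) → Fin N → ℝ}

theorem hasFDerivAt (hθ : IsClosedForm V θ) (hV : IsOpen V) {p : Fin N → ℝ} (hp : p ∈ V) :
    HasFDerivAt θ (fderiv ℝ θ p) p :=
  ((hθ.smooth.contDiffAt (hV.mem_nhds hp)).differentiableAt (by simp)).hasFDerivAt

theorem continuousOn_fderiv (hθ : IsClosedForm V θ) (hV : IsOpen V) :
    ContinuousOn (fderiv ℝ θ) V :=
  (hθ.smooth.fderiv_of_isOpen hV (m := ∞) (by simp)).continuousOn

theorem deriv_comp (hθ : IsClosedForm V θ) (hV : IsOpen V) {c : ℝ → Fin N → ℝ}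
    (hc : ContDiff ℝ ∞ c) {x : ℝ} (hx : c x ∈ V) :
    deriv (fun x => θ (c x)) x = fderiv ℝ θ (c x) (deriv c x) :=
  ((hθ.hasFDerivAt hV hx).comp_hasDerivAt x
    (hc.differentiable (by simp) x).hasDerivAt).deriv

theorem isHydroField_comp (hθ : IsClosedForm V θ) {u : ℝ → Fin N → ℝ} (hu : IsHydroField V u) :
    IsHydroField Set.univ fun x => θ (u x) := by
  obtain ⟨c, R, hR⟩ := hu.const_at_infinity
  exact ⟨hθ.smooth.comp_contDiff hu.smooth hu.mem, fun _ => Set.mem_univ _, θ c, R,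
    fun x hx => by rw [hR x hx]⟩

end IsClosedForm

namespace HydroBracket

variable {P : HydroBracket N} {θ κ : (Fin N → ℝ) → Fin N → ℝ}

/-- The derivative of the bracket of two functionals of hydrodynamic type along a family of
fields. -/
theorem hasDerivAt_pairing_comp (hV : IsOpen V) (hP : P.SmoothOn V)
    (hG : ∀ p ∈ V, ∀ ξ η, ⟪ξ, P.gL p η⟫ = ⟪η, P.gL p ξ⟫) (hPm : P.IsMetric V)
    (hθ : IsClosedForm V θ) (hκ : IsClosedForm V κ)
    {w : ℝ → ℝ → Fin N → ℝ} {c : Fin N → ℝ} {R : ℝ}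
    (hw : ContDiff ℝ ∞ fun q : ℝ × ℝ => w q.1 q.2) (hwV : ∀ s x, w s x ∈ V)
    (hwR : ∀ s x, R ≤ |x| → w s x = c) (s₀ : ℝ) :
    HasDerivAt (fun s => P.pairing (w s) (fun x => θ (w s x)) (fun x => κ (w s x)))
      (∫ x, (P.jet (w s₀ x)).closedForm (θ (w s₀ x)) (fderiv ℝ θ (w s₀ x)) (κ (w s₀ x))
        (fderiv ℝ κ (w s₀ x)) (deriv (fun s => w s x) s₀) (deriv (w s₀) x)) s₀ := by
  have hwf : IsHydroField V (w s₀) := ⟨contDiff_section_right hw s₀, hwV s₀, c, R, hwR s₀⟩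
  have hwabs : ∀ s x, max R 0 ≤ |x| → w s x = c := fun s x hx => hwR s x ((le_max_left _ _).trans hx)
  have hc : ∀ s, w s (max R 0) = c := fun s => hwabs s _ (le_abs_self _)
  have fam : ∀ {θ : (Fin N → ℝ) → Fin N → ℝ}, IsClosedForm V θ →
      ContDiff ℝ ∞ fun q : ℝ × ℝ => θ (w q.1 q.2) := fun hθ =>
    hθ.smooth.comp_contDiff hw fun q => hwV q.1 q.2
  have famR : ∀ (θ : (Fin N → ℝ) → Fin N → ℝ) s x, max R 0 ≤ |x| →
      θ (w s x) = θ (w s (max R 0)) := fun θ s x hx => by rw [hwabs s x hx, hc s]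
  have hd := hasDerivAt_pairing hV hP hPm hw hwV hwabs (ξ := fun s x => θ (w s x))
    (η := fun s x => κ (w s x)) (fam hθ) (famR θ) (fam hκ) (famR κ) s₀
  have dθ := isHydroField_deriv_family (ξ := fun s x => θ (w s x)) (fam hθ) (famR θ) s₀
  have dκ := isHydroField_deriv_family (ξ := fun s x => κ (w s x)) (fam hκ) (famR κ) s₀
  refine hd.congr_deriv ?_
  have fθ := hθ.isHydroField_comp hwf
  have fκ := hκ.isHydroField_comp hwf
  have ch : Continuous fun x => deriv (fun s => w s x) s₀ := (contDiff_section_right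
    (w := fun s x => deriv (fun s => w s x) s) (contDiff_deriv_family_left hw) s₀).continuous
  have hh : ∀ x, max R 0 ≤ |x| → deriv (fun s => w s x) s₀ = 0 := fun x hx => by
    rw [show (fun s => w s x) = fun _ => c from funext fun s => hwabs s x hx, deriv_const]
  have i1 := integrable_pairing hP hwf dθ.smooth.continuous fκ
  have i2 := integrable_pairing hP hwf dκ.smooth.continuous fθ
  have i3 := integrable_variation hV hP hwf fθ fκ ch hh
  rw [pairing_skew hV hP hG hPm hwf fθ dκ, ← sub_eq_add_neg, pairing_eq_integral_op,
    pairing_eq_integral_op, fieldVariation, ← MeasureTheory.integral_sub' i1 i2,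
    ← MeasureTheory.integral_add (i1.sub i2) i3]
  refine MeasureTheory.integral_congr_ae (Filter.Eventually.of_forall fun x => ?_)
  have hx := hwV s₀ x
  have e1 : ∀ {θ : (Fin N → ℝ) → Fin N → ℝ}, IsClosedForm V θ → deriv (fun s => θ (w s x)) s₀
      = fderiv ℝ θ (w s₀ x) (deriv (fun s => w s x) s₀) := fun hθ =>
    hθ.deriv_comp hV (contDiff_section_left hw x) hx
  simp only [Pi.sub_apply]
  rw [op_eq hwf fθ.smooth, op_eq hwf fκ.smooth, e1 hθ, e1 hκ,
    hθ.deriv_comp hV hwf.smooth hx, hκ.deriv_comp hV hwf.smooth hx]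
  simp only [HydroJet.opVal, HydroJet.variation, HydroJet.closedForm, map_add, map_smul, smul_eq_mul]
  -- Closedness of `θ` and `κ` cancels the nonlocal terms, and symmetry of `g` pairs the terms with
  -- two derivatives; the remaining integrand is exactly `closedForm`.
  have s1 := hθ.symm _ hx (deriv (fun s => w s x) s₀) (deriv (w s₀) x)
  have s2 := hκ.symm _ hx (deriv (fun s => w s x) s₀) (deriv (w s₀) x)
  have s3 := hG _ hx (fderiv ℝ κ (w s₀ x) (deriv (fun s => w s x) s₀))
    (fderiv ℝ θ (w s₀ x) (deriv (w s₀) x))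
  rw [s1, s2]
  simp only [jet]
  rw [s3]
  ring

/-- Convexity lets the field be contracted linearly to its constant at infinity. Along the
contraction the bracket has zero derivative, and at a constant field it is zero. -/
theorem pairing_comp_eq_zero (hV : IsOpen V) (hVc : Convex ℝ V) (hP : P.SmoothOn V)
    (hG : ∀ p ∈ V, ∀ ξ η, ⟪ξ, P.gL p η⟫ = ⟪η, P.gL p ξ⟫) (hPm : P.IsMetric V)
    (hθ : IsClosedForm V θ) (hκ : IsClosedForm V κ)
    (h : ∀ p ∈ V, ∀ w v, (P.jet p).closedForm (θ p) (fderiv ℝ θ p) (κ p) (fderiv ℝ κ p) w v = 0)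
    {u : ℝ → Fin N → ℝ} (hu : IsHydroField V u) :
    P.pairing u (fun x => θ (u x)) (fun x => κ (u x)) = 0 := by
  obtain ⟨c, R, hR0, hR⟩ := hu.exists_radius
  have hcV : c ∈ V := by
    rw [← (hR R (le_abs_self R)).1]
    exact hu.mem R
  -- The parameter `sin² s` runs through `[0, 1]` as `s` goes from `0` to `π / 2`, while the family
  -- stays in `V` for every real `s`.
  have hmem : ∀ s x, c + (Real.sin s ^ 2) • (u x - c) ∈ V := fun s x =>
    hVc.add_smul_sub_mem hcV (hu.mem x) ⟨sq_nonneg _, Real.sin_sq_le_one s⟩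
  have hd := hasDerivAt_pairing_comp hV hP hG hPm hθ hκ (c := c) (R := R)
    (w := fun s x => c + (Real.sin s ^ 2) • (u x - c))
    (contDiff_const.add (((Real.contDiff_sin.comp contDiff_fst).pow 2).smul
      ((hu.smooth.comp contDiff_snd).sub contDiff_const))) hmem
    fun s x hx => by simp [(hR x hx).1]
  simp only [h _ (hmem _ _), MeasureTheory.integral_zero] at hd
  have hconst := is_const_of_deriv_eq_zero (fun s => (hd s).differentiableAt)
    (fun s => (hd s).deriv) (Real.pi / 2) 0
  simp only [Real.sin_pi_div_two, Real.sin_zero, one_pow, one_smul, add_sub_cancel,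
    ne_eq, OfNat.ofNat_ne_zero, not_false_eq_true, zero_pow, zero_smul, add_zero] at hconst
  rw [hconst, pairing_eq (IsHydroField.const hcV) contDiff_const]
  simp [HydroJet.opVal]

/-- The field `p + e φ v` is varied in the direction `φ' w`: bilinearity of the 2-form in the
variation and in `u_x` yields the weight `e φ'²`. -/
theorem closedForm_eq_zero (hV : IsOpen V) (hP : P.SmoothOn V)
    (hG : ∀ p ∈ V, ∀ ξ η, ⟪ξ, P.gL p η⟫ = ⟪η, P.gL p ξ⟫) (hPm : P.IsMetric V)
    (hθ : IsClosedForm V θ) (hκ : IsClosedForm V κ)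
    (h : ∀ u, IsHydroField V u → P.pairing u (fun x => θ (u x)) (fun x => κ (u x)) = 0)
    {p : Fin N → ℝ} (hp : p ∈ V) (w v : Fin N → ℝ) :
    (P.jet p).closedForm (θ p) (fderiv ℝ θ p) (κ p) (fderiv ℝ κ p) w v = 0 := by
  obtain ⟨φ, hφ⟩ := exists_isBump
  have c1 := hP.contDiffOn_gL.continuousOn
  have c2 := hP.contDiffOn_bL.continuousOn
  have c3 := (hP.contDiffOn_fderiv_bL hV).continuousOn
  have c4 := hθ.smooth.continuousOn
  have c5 := hκ.smooth.continuousOn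
  have c6 := hθ.continuousOn_fderiv hV
  have c7 := hκ.continuousOn_fderiv hV
  refine hφ.eq_zero_of_testField' hV hp v (Q := fun p =>
    (P.jet p).closedForm (θ p) (fderiv ℝ θ p) (κ p) (fderiv ℝ κ p) w v) ?_ fun e he => ?_
  · simp only [HydroJet.closedForm, HydroJet.curv, jet]
    fun_prop
  have hv := hφ.isHydroField_deriv_smul w
  obtain ⟨δ, hδ, hmem⟩ := exists_pos_forall_add_smul_mem hV he
    hv.smooth.continuous hv.smooth.continuous (R := 4)
    (fun x hx => by rw [hφ.vanish_deriv x hx, zero_smul])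
    (fun x hx => by rw [hφ.vanish_deriv x hx, zero_smul])
  have hmem' : ∀ s x, (p + (e * φ x) • v) + sinScale δ s • deriv φ x • w ∈ V := fun s x => by
    simpa using hmem (sinScale δ s) 0 (abs_sinScale_le hδ s) (by simpa using hδ.le) x
  have hws : ContDiff ℝ ∞ fun q : ℝ × ℝ =>
      (p + (e * φ q.2) • v) + sinScale δ q.1 • deriv φ q.2 • w :=
    (he.smooth.comp contDiff_snd).add
      (((contDiff_sinScale δ).comp contDiff_fst).smul (hv.smooth.comp contDiff_snd))
  have hwR : ∀ s x, 4 ≤ |x| → (p + (e * φ x) • v) + sinScale δ s • deriv φ x • w = p :=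
    fun s x hx => by simp [hφ.vanish x hx, hφ.vanish_deriv x hx]
  have hd := hasDerivAt_pairing_comp hV hP hG hPm hθ hκ
    (w := fun s x => (p + (e * φ x) • v) + sinScale δ s • deriv φ x • w) hws hmem' hwR 0
  have hz : ∀ s, P.pairing (fun x => (p + (e * φ x) • v) + sinScale δ s • deriv φ x • w)
      (fun x => θ ((p + (e * φ x) • v) + sinScale δ s • deriv φ x • w))
      (fun x => κ ((p + (e * φ x) • v) + sinScale δ s • deriv φ x • w)) = 0 := fun s =>
    h _ ⟨contDiff_section_right
      (w := fun s x => (p + (e * φ x) • v) + sinScale δ s • deriv φ x • w) hws s, hmem' s, p, 4,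
      hwR s⟩
  simp only [hz] at hd
  have h0 := hd.unique (hasDerivAt_const (0 : ℝ) (0 : ℝ))
  have hds : ∀ x, deriv (fun s => (p + (e * φ x) • v) + sinScale δ s • deriv φ x • w) 0
      = deriv φ x • w := fun x => by
    simpa using (((hasDerivAt_sinScale hδ).smul_const (deriv φ x • w)).const_add
      (p + (e * φ x) • v)).deriv
  simp only [hds, sinScale_zero, zero_smul, add_zero, hφ.deriv_testField] at h0
  rw [integral_eq_intervalIntegral_of_vanish (R := 4) fun x hx => by
    simp [hφ.vanish_deriv x hx, HydroJet.closedForm, HydroJet.curv]] at h0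
  rw [← intervalIntegral.integral_const_mul, ← h0]
  congr 1
  funext x
  simp only [HydroJet.closedForm, HydroJet.curv, map_smul, smul_apply, smul_eq_mul]
  ring

theorem op_comp (hV : IsOpen V) (hK : P.K = 0) (hθ : IsClosedForm V θ) {u : ℝ → Fin N → ℝ}
    (hu : IsHydroField V u) (x : ℝ) :
    P.op u (fun x => θ (u x)) x
      = P.gL (u x) (fderiv ℝ θ (u x) (deriv u x)) + P.bL (u x) (deriv u x) (θ (u x)) := by
  rw [op_eq hu (hθ.isHydroField_comp hu).smooth, hθ.deriv_comp hV hu.smooth (hu.mem x)]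
  simp [HydroJet.opVal, jet, hK]

/-- For a local bracket the operator applied to a 1-form along the field is linear in `u_x`, so test
covectors `φ' a` suffice. The constant `k` covers annihilators (`k = 0`) and momenta (`k = 1`)
together. -/
theorem eq_smul_of_integral_op (hV : IsOpen V) (hP : P.SmoothOn V) (hK : P.K = 0)
    (hθ : IsClosedForm V θ) (k : ℝ)
    (h : ∀ u, IsHydroField V u → ∀ ξ, IsHydroField Set.univ ξ →
      ∫ x, ⟪ξ x, P.op u (fun x => θ (u x)) x - k • deriv u x⟫ = 0)
    {p : Fin N → ℝ} (hp : p ∈ V) (v : Fin N → ℝ) :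
    P.gL p (fderiv ℝ θ p v) + P.bL p v (θ p) = k • v := by
  obtain ⟨φ, hφ⟩ := exists_isBump
  have c1 := hP.contDiffOn_gL.continuousOn
  have c2 := hP.contDiffOn_bL.continuousOn
  have c4 := hθ.smooth.continuousOn
  have c6 := hθ.continuousOn_fderiv hV
  rw [← sub_eq_zero]
  refine eq_of_forall_pairL fun a => ?_
  rw [map_zero]
  refine hφ.eq_zero_of_testField' hV hp v (Q := fun p =>
    ⟪a, P.gL p (fderiv ℝ θ p v) + P.bL p v (θ p) - k • v⟫) (by fun_prop) fun e he => ?_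
  have h1 := h _ he _ (hφ.isHydroField_deriv_smul a)
  simp only [op_comp hV hK hθ he, hφ.deriv_testField] at h1
  rw [integral_eq_intervalIntegral_of_vanish (R := 4) fun x hx => by
    simp [hφ.vanish_deriv x hx]] at h1
  rw [← intervalIntegral.integral_const_mul, ← h1]
  congr 1
  funext x
  simp only [map_add, map_sub, map_smul, smul_apply, smul_eq_mul]
  ring

end HydroBracket

end Densities

/-! ### Annihilators and momentum of a local bracket -/

namespace HydroJet

variable {N : ℕ} {X Y : HydroJet N} {H : (Fin N → ℝ) →L[ℝ] (Fin N → ℝ)}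

theorem closedForm_add_left (X : HydroJet N) (ξ₁ ξ₂ η : Fin N → ℝ)
    (S₁ S₂ T : (Fin N → ℝ) →L[ℝ] (Fin N → ℝ)) (w v : Fin N → ℝ) :
    X.closedForm (ξ₁ + ξ₂) (S₁ + S₂) η T w v
      = X.closedForm ξ₁ S₁ η T w v + X.closedForm ξ₂ S₂ η T w v := by
  simp only [closedForm, curv, map_add, add_apply]
  ring

theorem closedForm_smul_left (X : HydroJet N) (c : ℝ) (ξ η : Fin N → ℝ)
    (S T : (Fin N → ℝ) →L[ℝ] (Fin N → ℝ)) (w v : Fin N → ℝ) :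
    X.closedForm (c • ξ) (c • S) η T w v = c * X.closedForm ξ S η T w v := by
  simp only [closedForm, curv, map_smul, smul_apply, smul_eq_mul]
  ring

theorem closedForm_add_right (X : HydroJet N) (ξ η₁ η₂ : Fin N → ℝ)
    (S T₁ T₂ : (Fin N → ℝ) →L[ℝ] (Fin N → ℝ)) (w v : Fin N → ℝ) :
    X.closedForm ξ S (η₁ + η₂) (T₁ + T₂) w v
      = X.closedForm ξ S η₁ T₁ w v + X.closedForm ξ S η₂ T₂ w v := by
  simp only [closedForm, curv, map_add, add_apply]
  ring

theorem closedForm_smul_right (X : HydroJet N) (c : ℝ) (ξ η : Fin N → ℝ)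
    (S T : (Fin N → ℝ) →L[ℝ] (Fin N → ℝ)) (w v : Fin N → ℝ) :
    X.closedForm ξ S (c • η) (c • T) w v = c * X.closedForm ξ S η T w v := by
  simp only [closedForm, curv, map_smul, smul_apply, smul_eq_mul]
  ring

/-- The parallel derivative is linear in the covector, so `closedForm` on parallel 1-jets is linear
in that slot and a spanning set decides its vanishing. -/
theorem closedForm_parallel_left_eq_zero (X : HydroJet N) {ι : Type*} {θ : ι → Fin N → ℝ}
    (hθ : Submodule.span ℝ (Set.range θ) = ⊤) {η : Fin N → ℝ}
    {T : (Fin N → ℝ) →L[ℝ] (Fin N → ℝ)} {w v : Fin N → ℝ}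
    (h : ∀ a, X.closedForm (θ a) (Y.parallel H (θ a)) η T w v = 0) (ξ : Fin N → ℝ) :
    X.closedForm ξ (Y.parallel H ξ) η T w v = 0 := by
  have hξ : ξ ∈ Submodule.span ℝ (Set.range θ) := hθ ▸ Submodule.mem_top
  induction hξ using Submodule.span_induction with
  | mem x hx => obtain ⟨a, rfl⟩ := hx; exact h a
  | zero => simpa using X.closedForm_smul_left 0 0 η 0 T w v
  | add x y _ _ hx hy => rw [map_add, closedForm_add_left, hx, hy, add_zero]
  | smul c x _ hx => rw [map_smul, closedForm_smul_left, hx, mul_zero]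

theorem closedForm_parallel_right_eq_zero (X : HydroJet N) {ι : Type*} {θ : ι → Fin N → ℝ}
    (hθ : Submodule.span ℝ (Set.range θ) = ⊤) {ξ : Fin N → ℝ}
    {S : (Fin N → ℝ) →L[ℝ] (Fin N → ℝ)} {w v : Fin N → ℝ}
    (h : ∀ a, X.closedForm ξ S (θ a) (Y.parallel H (θ a)) w v = 0) (η : Fin N → ℝ) :
    X.closedForm ξ S η (Y.parallel H η) w v = 0 := by
  have hη : η ∈ Submodule.span ℝ (Set.range θ) := hθ ▸ Submodule.mem_top
  induction hη using Submodule.span_induction with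
  | mem x hx => obtain ⟨a, rfl⟩ := hx; exact h a
  | zero => simpa using X.closedForm_smul_right 0 ξ 0 S 0 w v
  | add x y _ _ hx hy => rw [map_add, closedForm_add_right, hx, hy, add_zero]
  | smul c x _ hx => rw [map_smul, closedForm_smul_right, hx, mul_zero]

theorem mixed_iff (hGH : ∀ v, Y.G (H v) = v) (hHG : ∀ v, H (Y.G v) = v) (hY : Y.IsPoisson)
    (hX : ∀ ξ η, ⟪ξ, X.G η⟫ = ⟪η, X.G ξ⟫) :
    Mixed X Y ↔ (∀ ξ η w v, X.closedForm ξ (Y.parallel H ξ) η (Y.parallel H η) w v = 0) ∧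
      ∀ ξ w v, X.closedForm ξ (Y.parallel H ξ) 0 H w v = 0 := by
  constructor
  · intro h
    refine ⟨fun ξ η w v => ?_, fun ξ w v => ?_⟩
    · have := h.obsB v ξ η (H w)
      rwa [obsB_mixed_eq hGH hY hX h.obsA, hGH] at this
    · have := h.obsA ξ (H w) (H v)
      rwa [obsA_mixed_eq hGH hHG hY, hGH, hGH, neg_eq_zero] at this
  · rintro ⟨h1, h2⟩
    have hA : ∀ ξ η ζ, X.obsA Y ξ η ζ + Y.obsA X ξ η ζ = 0 := fun ξ η ζ => by
      rw [obsA_mixed_eq hGH hHG hY, h2, neg_zero]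
    exact ⟨hA, fun v ξ η ζ => by rw [obsB_mixed_eq hGH hY hX hA, h1]⟩

/-- The differentials `θ a` and `μ` of annihilators and a momentum at a point, with their
derivatives `S a` and `M`. -/
structure IsFrame (Y : HydroJet N) {ι : Type*} (θ : ι → Fin N → ℝ)
    (S : ι → (Fin N → ℝ) →L[ℝ] (Fin N → ℝ)) (μ : Fin N → ℝ)
    (M : (Fin N → ℝ) →L[ℝ] (Fin N → ℝ)) : Prop where
  span : Submodule.span ℝ (Set.range θ) = ⊤
  annihilator : ∀ a v, Y.G (S a v) + Y.B v (θ a) = 0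
  momentum : ∀ v, Y.G (M v) + Y.B v μ = v

namespace IsFrame

variable {ι : Type*} {θ : ι → Fin N → ℝ} {S : ι → (Fin N → ℝ) →L[ℝ] (Fin N → ℝ)}
  {μ : Fin N → ℝ} {M : (Fin N → ℝ) →L[ℝ] (Fin N → ℝ)}

/-- A frame forces `G` to be invertible. The annihilators span, so `μ` has some parallel derivative
`T`; subtracting its equation from that of the momentum gives `G (M - T) = 1`. Hence a system of
annihilators and a momentum lives only where the bracket is nondegenerate. -/
theorem exists_inverse (h : Y.IsFrame θ S μ M) :
    ∃ H : (Fin N → ℝ) →L[ℝ] (Fin N → ℝ), (∀ v, Y.G (H v) = v) ∧ ∀ v, H (Y.G v) = v := by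
  have key : ∀ ξ ∈ Submodule.span ℝ (Set.range θ), ∃ T : (Fin N → ℝ) →L[ℝ] (Fin N → ℝ),
      ∀ v, Y.G (T v) + Y.B v ξ = 0 := fun ξ hξ => by
    induction hξ using Submodule.span_induction with
    | mem x hx => obtain ⟨a, rfl⟩ := hx; exact ⟨S a, h.annihilator a⟩
    | zero => exact ⟨0, fun v => by simp⟩
    | add x y _ _ hx hy =>
      obtain ⟨T₁, h₁⟩ := hx
      obtain ⟨T₂, h₂⟩ := hy
      refine ⟨T₁ + T₂, fun v => ?_⟩
      rw [add_apply, map_add, map_add, add_add_add_comm, h₁, h₂, add_zero]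
    | smul c x _ hx =>
      obtain ⟨T, h₁⟩ := hx
      exact ⟨c • T, fun v => by rw [smul_apply, map_smul, map_smul, ← smul_add, h₁, smul_zero]⟩
  obtain ⟨T, hT⟩ := key μ (h.span ▸ Submodule.mem_top)
  have h1 : ∀ v, Y.G ((M - T) v) = v := fun v => by
    have e1 := h.momentum v
    have e2 := hT v
    rw [sub_apply, map_sub, eq_neg_of_add_eq_zero_left e2, sub_neg_eq_add, e1]
  have h2 : (Y.G : (Fin N → ℝ) →ₗ[ℝ] (Fin N → ℝ)) * ((M - T : (Fin N → ℝ) →L[ℝ] (Fin N → ℝ)) :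
      (Fin N → ℝ) →ₗ[ℝ] (Fin N → ℝ)) = 1 := LinearMap.ext h1
  exact ⟨M - T, h1, fun v => LinearMap.congr_fun (mul_eq_one_comm.1 h2) v⟩

theorem eq_parallel (h : Y.IsFrame θ S μ M) (hHG : ∀ v, H (Y.G v) = v) (a : ι) :
    S a = Y.parallel H (θ a) := by
  ext1 v
  rw [parallel_apply, ← hHG (S a v), eq_neg_of_add_eq_zero_left (h.annihilator a v), map_neg]

theorem eq_parallel_add (h : Y.IsFrame θ S μ M) (hHG : ∀ v, H (Y.G v) = v) :
    M = Y.parallel H μ + H := by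
  ext1 v
  rw [add_apply, parallel_apply, ← hHG (M v), eq_sub_of_add_eq (h.momentum v), map_sub]
  abel

/-- Annihilators test parallel pairs. The 1-jet of the momentum splits as a parallel one plus `(0,
H)`, so once parallel pairs are known to vanish, the pairs with the momentum test exactly the `(0,
H)` part. -/
theorem mixed_iff (h : Y.IsFrame θ S μ M) (hY : Y.IsPoisson)
    (hX : ∀ ξ η, ⟪ξ, X.G η⟫ = ⟪η, X.G ξ⟫) :
    Mixed X Y ↔ (∀ a b w v, X.closedForm (θ a) (S a) (θ b) (S b) w v = 0) ∧
      ∀ a w v, X.closedForm (θ a) (S a) μ M w v = 0 := by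
  obtain ⟨H, hGH, hHG⟩ := h.exists_inverse
  rw [HydroJet.mixed_iff hGH hHG hY hX]
  have e : ∀ ξ S w v, X.closedForm ξ S μ M w v
      = X.closedForm ξ S μ (Y.parallel H μ) w v + X.closedForm ξ S 0 H w v := fun ξ S w v => by
    rw [← closedForm_add_right, add_zero, h.eq_parallel_add hHG]
  simp only [h.eq_parallel hHG, e]
  constructor
  · rintro ⟨h1, h2⟩
    exact ⟨fun a b => h1 _ _, fun a w v => by rw [h1, h2, add_zero]⟩
  · rintro ⟨h1, h2⟩
    have h3 : ∀ ξ η w v, X.closedForm ξ (Y.parallel H ξ) η (Y.parallel H η) w v = 0 :=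
      fun ξ η w v => closedForm_parallel_left_eq_zero X h.span
        (fun a => closedForm_parallel_right_eq_zero X h.span (fun b => h1 a b w v) η) ξ
    refine ⟨h3, fun ξ w v => closedForm_parallel_left_eq_zero X h.span (fun a => ?_) ξ⟩
    have := h2 a w v
    rwa [h3, zero_add] at this

end IsFrame

end HydroJet

namespace HydroBracket

variable {N : ℕ} {V U : Set (Fin N → ℝ)} {P Q : HydroBracket N} {f : (Fin N → ℝ) → ℝ}

/-- Linear functionals realize every admissible covector field, so annihilation means that the
operator kills the differential, which is the parallel equation. -/
theorem isAnnihilator_iff (hV : IsOpen V) (hQ : Q.SmoothOn V)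
    (hG : ∀ p ∈ V, ∀ ξ η, ⟪ξ, Q.gL p η⟫ = ⟪η, Q.gL p ξ⟫) (hQm : Q.IsMetric V) (hK : Q.K = 0)
    (hf : ContDiffOn ℝ ∞ f V) :
    Q.IsAnnihilator V f ↔ ∀ p ∈ V, ∀ v,
      Q.gL p (fderiv ℝ (gradCovector f) p v) + Q.bL p v (gradCovector f p) = 0 := by
  have hθ := isClosedForm_gradCovector hV hf
  constructor
  · intro h p hp v
    rw [eq_smul_of_integral_op hV hQ hK hθ 0 (fun u hu ξ hξ => ?_) hp v, zero_smul]
    simp only [zero_smul, sub_zero]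
    rw [← pairing_eq_integral_op, pairing_skew hV hQ hG hQm hu hξ (hθ.isHydroField_comp hu),
      neg_eq_zero]
    exact h (linFunctional V ξ hξ) u hu
  · intro h J u hu
    rw [densityDeriv_eq, pairing_skew hV hQ hG hQm hu (hθ.isHydroField_comp hu)
      (J.isHydroField_varDeriv hu), pairing_eq_integral_op]
    simp [op_comp hV hK hθ hu, h _ (hu.mem _)]

theorem isMomentum_iff (hV : IsOpen V) (hQ : Q.SmoothOn V) (hK : Q.K = 0)
    (hf : ContDiffOn ℝ ∞ f V) :
    Q.IsMomentum V f ↔ ∀ p ∈ V, ∀ v,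
      Q.gL p (fderiv ℝ (gradCovector f) p v) + Q.bL p v (gradCovector f p) = v := by
  have hθ := isClosedForm_gradCovector hV hf
  constructor
  · intro h p hp v
    rw [eq_smul_of_integral_op hV hQ hK hθ 1 (fun u hu ξ hξ => ?_) hp v, one_smul]
    have := h u hu
    rw [densityDeriv_eq] at this
    simp [this]
  · intro h u hu
    funext x
    rw [densityDeriv_eq, op_comp hV hK hθ hu, h _ (hu.mem x)]

theorem IsMetric.mono (hP : P.IsMetric U) (h : V ⊆ U) : P.IsMetric V := fun p hp => hP p (h hp)

theorem IsAnnihilatorsAndMomentum.isFrame (hV : IsOpen V) (hQ : Q.SmoothOn V)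
    (hG : ∀ p ∈ V, ∀ ξ η, ⟪ξ, Q.gL p η⟫ = ⟪η, Q.gL p ξ⟫) (hQm : Q.IsMetric V) (hK : Q.K = 0)
    {n : Fin N → (Fin N → ℝ) → ℝ} {m : (Fin N → ℝ) → ℝ} (h : Q.IsAnnihilatorsAndMomentum V n m)
    {p : Fin N → ℝ} (hp : p ∈ V) :
    (Q.jet p).IsFrame (fun i => gradCovector (n i) p) (fun i => fderiv ℝ (gradCovector (n i)) p)
      (gradCovector m p) (fderiv ℝ (gradCovector m) p) where
  span := by
    have hi : LinearIndependent ℝ fun i => gradCovector (n i) p :=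
      (h.independent p hp).map' (covectorL : ((Fin N → ℝ) →L[ℝ] ℝ) →L[ℝ] (Fin N → ℝ)).toLinearMap
        (LinearMap.ker_eq_bot_of_injective fun L L' hL => by
          ext1 v
          rw [← pairL_covectorL, ← pairL_covectorL L']
          exact congrArg (fun ξ => ⟪ξ, v⟫) hL)
    exact hi.span_eq_top_of_card_eq_finrank' (by simp)
  annihilator i := (isAnnihilator_iff hV hQ hG hQm hK (h.smooth_annihilator i)).1
    (h.annihilator i) p hp
  momentum := (isMomentum_iff hV hQ hK h.smooth_momentum).1 h.momentum p hp

/-- Involution of the annihilators and the momentum of `Q` with respect to `P` is the vanishing of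
the mixed obstructions. -/
theorem IsAnnihilatorsAndMomentum.inInvolution_iff (hV : IsOpen V) (hVc : Convex ℝ V)
    (hP : P.SmoothOn V) (hPG : ∀ p ∈ V, ∀ ξ η, ⟪ξ, P.gL p η⟫ = ⟪η, P.gL p ξ⟫) (hPm : P.IsMetric V)
    (hQ : Q.SmoothOn V) (hQm : Q.IsMetric V) (hQj : ∀ p ∈ V, (Q.jet p).IsPoisson) (hK : Q.K = 0)
    {n : Fin N → (Fin N → ℝ) → ℝ} {m : (Fin N → ℝ) → ℝ} (h : Q.IsAnnihilatorsAndMomentum V n m) :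
    P.AnnihilatorsAndMomentumInInvolution V n m ↔
      ∀ p ∈ V, HydroJet.Mixed (P.jet p) (Q.jet p) := by
  have hn := fun i => isClosedForm_gradCovector hV (h.smooth_annihilator i)
  have hm := isClosedForm_gradCovector hV h.smooth_momentum
  have hF : ∀ p (hp : p ∈ V), _ := fun p hp =>
    (h.isFrame hV hQ (fun p hp => (hQj p hp).symm) hQm hK hp).mixed_iff (X := P.jet p)
      (hQj p hp) (hPG p hp)
  constructor
  · intro hi p hp
    exact (hF p hp).2
      ⟨fun a b => closedForm_eq_zero hV hP hPG hPm (hn a) (hn b) (hi (some a) (some b)) hp,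
        fun a => closedForm_eq_zero hV hP hPG hPm (hn a) hm (hi (some a) none) hp⟩
  · intro hM
    have hnm : ∀ i u, IsHydroField V u →
        P.pairing u (densityDeriv (n i) u) (densityDeriv m u) = 0 := fun i u hu =>
      pairing_comp_eq_zero hV hVc hP hPG hPm (hn i) hm
        (fun p hp => ((hF p hp).1 (hM p hp)).2 i) hu
    intro α β u hu
    have skew := fun {ξ η} => HydroBracket.pairing_skew hV hP hPG hPm hu (ξ := ξ) (η := η)
    rcases α with _ | i <;> rcases β with _ | j
    -- The momentum is in involution with itself by skew-symmetry alone.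
    · have := skew (hm.isHydroField_comp hu) (hm.isHydroField_comp hu)
      change P.pairing u (fun x => gradCovector m (u x)) (fun x => gradCovector m (u x)) = 0
      linarith
    · have := skew (hm.isHydroField_comp hu) ((hn j).isHydroField_comp hu)
      rw [← densityDeriv_eq, ← densityDeriv_eq, hnm j u hu, neg_zero] at this
      exact this
    · exact hnm i u hu
    · exact pairing_comp_eq_zero hV hVc hP hPG hPm (hn i) (hn j)
        (fun p hp => ((hF p hp).1 (hM p hp)).1 i j) hu

/-! ### Linear combinations of brackets -/

theorem gL_linComb (α β : ℝ) : (linComb α P β Q).gL = fun p => α • P.gL p + β • Q.gL p := by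
  funext p
  refine ContinuousLinearMap.ext fun ξ => funext fun i => ?_
  simp only [gL_apply, linComb, add_apply, smul_apply, Pi.add_apply, Pi.smul_apply, smul_eq_mul,
    Finset.mul_sum, ← Finset.sum_add_distrib]
  exact Finset.sum_congr rfl fun j _ => by ring

theorem bL_linComb (α β : ℝ) : (linComb α P β Q).bL = fun p => α • P.bL p + β • Q.bL p := by
  funext p
  refine ContinuousLinearMap.ext fun v => ContinuousLinearMap.ext fun ξ => funext fun i => ?_
  simp only [bL_apply, linComb, add_apply, smul_apply, Pi.add_apply, Pi.smul_apply, smul_eq_mul,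
    Finset.mul_sum, ← Finset.sum_add_distrib]
  exact Finset.sum_congr rfl fun j _ => Finset.sum_congr rfl fun k _ => by ring

theorem SmoothOn.linComb (hP : P.SmoothOn U) (hQ : Q.SmoothOn U) (α β : ℝ) :
    (linComb α P β Q).SmoothOn U :=
  ⟨fun i j => (contDiffOn_const.mul (hP.1 i j)).add (contDiffOn_const.mul (hQ.1 i j)),
    fun i j k => (contDiffOn_const.mul (hP.2 i j k)).add (contDiffOn_const.mul (hQ.2 i j k))⟩

theorem jet_linComb (hU : IsOpen U) (hP : P.SmoothOn U) (hQ : Q.SmoothOn U) (α β : ℝ)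
    {p : Fin N → ℝ} (hp : p ∈ U) :
    (linComb α P β Q).jet p = HydroJet.comb α (P.jet p) β (Q.jet p) := by
  have h := ((hP.hasFDerivAt_bL hU hp).const_smul α).add ((hQ.hasFDerivAt_bL hU hp).const_smul β)
  rw [jet, HydroJet.comb, HydroJet.mk.injEq]
  refine ⟨congrFun (gL_linComb α β) p, congrFun (bL_linComb α β) p, ?_, rfl⟩
  rw [bL_linComb]
  exact h.fderiv

theorem IsMetric.linComb (hU : IsOpen U) (hP : P.SmoothOn U) (hQ : Q.SmoothOn U)
    (hPm : P.IsMetric U) (hQm : Q.IsMetric U) (α β : ℝ) : (linComb α P β Q).IsMetric U := by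
  intro p hp h ξ η
  have hd := ((hP.hasFDerivAt_gL hU hp).const_smul α).add ((hQ.hasFDerivAt_gL hU hp).const_smul β)
  have e : fderiv ℝ (HydroBracket.linComb α P β Q).gL p
      = α • fderiv ℝ P.gL p + β • fderiv ℝ Q.gL p := by
    rw [gL_linComb]
    exact hd.fderiv
  rw [e, bL_linComb]
  simp only [add_apply, smul_apply, map_add, map_smul, smul_eq_mul, hPm p hp, hQm p hp]
  ring

/-- The sum of the two brackets already isolates the cross term, since both diagonal terms of the
quadratic form vanish. -/
theorem Compatible.mixed (h : P.Compatible Q U) (hU : IsOpen U) (hP : P.SmoothOn U)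
    (hQ : Q.SmoothOn U) (hPp : P.IsPoisson U) (hQp : Q.IsPoisson U) {p : Fin N → ℝ} (hp : p ∈ U) :
    HydroJet.Mixed (P.jet p) (Q.jet p) := by
  refine (hPp.jet_isPoisson hU hP hp).mixed (hQp.jet_isPoisson hU hQ hp) ?_
  rw [← jet_linComb hU hP hQ 1 1 hp]
  exact (h 1 1).jet_isPoisson hU (hP.linComb hQ 1 1) hp

theorem exists_inverse_gL {p : Fin N → ℝ} (hp : Matrix.det (Matrix.of (Q.g p)) ≠ 0) :
    ∃ H : (Fin N → ℝ) →L[ℝ] (Fin N → ℝ), (∀ v, Q.gL p (H v) = v) ∧ ∀ v, H (Q.gL p v) = v := by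
  have hu : IsUnit (Matrix.det (Matrix.of (Q.g p))) := isUnit_iff_ne_zero.2 hp
  refine ⟨LinearMap.toContinuousLinearMap (Matrix.toLin' (Matrix.of (Q.g p))⁻¹), fun v => ?_,
    fun v => ?_⟩
  · simp [gL_eq_mulVec, Matrix.mul_nonsing_inv _ hu]
  · simp [gL_eq_mulVec, Matrix.nonsing_inv_mul _ hu]

/-- At nondegenerate points obstruction C comes for free. These points are dense and the
obstructions of every combination are continuous, so they vanish on `U`. -/
theorem compatible_of_mixed (hU : IsOpen U) (hP : P.SmoothOn U) (hQ : Q.SmoothOn U)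
    (hPp : P.IsPoisson U) (hQp : Q.IsPoisson U) (hnd : Q.Nondegenerate U)
    (h : ∀ p ∈ U, Matrix.det (Matrix.of (Q.g p)) ≠ 0 → HydroJet.Mixed (P.jet p) (Q.jet p)) :
    P.Compatible Q U := by
  intro α β
  have hs := hP.linComb hQ α β
  refine isPoisson_of_jet hU hs
    ((hPp.isMetric hU hP).linComb hU hP hQ (hQp.isMetric hU hQ) α β) ?_
  have hj : ∀ p ∈ {a | a ∈ U ∧ Matrix.det (Matrix.of (Q.g a)) ≠ 0},
      ((linComb α P β Q).jet p).IsPoisson := fun p ⟨hp, hd⟩ => by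
    obtain ⟨H, hGH, -⟩ := exists_inverse_gL hd
    have h1 := hPp.jet_isPoisson hU hP hp
    have h2 := hQp.jet_isPoisson hU hQ hp
    rw [jet_linComb hU hP hQ α β hp]
    exact h1.comb h2 (h p hp hd)
      (fun v ξ η ζ => HydroJet.obsC_mixed_eq_zero hGH h2 h1.symm (h p hp hd) v ξ η ζ) α β
  have ext : ∀ {k : (Fin N → ℝ) → ℝ}, ContinuousOn k U →
      (∀ p ∈ {a | a ∈ U ∧ Matrix.det (Matrix.of (Q.g a)) ≠ 0}, k p = 0) → ∀ p ∈ U, k p = 0 :=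
    fun hk h0 => Set.EqOn.of_subset_closure (g := fun _ => 0) h0 hk continuousOn_const
      (fun _ hp => hp.1) hnd
  refine fun p hp => ⟨fun ξ η => ?_, fun ξ η ζ => ?_, fun v ξ η ζ => ?_, fun v ξ η ζ => ?_⟩
  · rw [jet_linComb hU hP hQ α β hp]
    have h1 := (hPp.jet_isPoisson hU hP hp).symm ξ η
    have h2 := (hQp.jet_isPoisson hU hQ hp).symm ξ η
    simp only [HydroJet.comb, add_apply, smul_apply, map_add, map_smul, h1, h2]
  · exact ext (hs.continuousOn_obsA ξ η ζ) (fun p hp => (hj p hp).obsA ξ η ζ) p hp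
  · exact ext (hs.continuousOn_obsB hU v ξ η ζ) (fun p hp => (hj p hp).obsB v ξ η ζ) p hp
  · exact ext (hs.continuousOn_obsC hU v ξ η ζ) (fun p hp => (hj p hp).obsC v ξ η ζ) p hp

end HydroBracket

/-! ### Flat linear systems -/

section FlatSystem

variable {E F : Type*} [NormedAddCommGroup E] [NormedSpace ℝ E] [NormedAddCommGroup F]
  [NormedSpace ℝ F]

theorem exists_linear_ODE_solution [CompleteSpace F] {L : ℝ → F →L[ℝ] F}
    (hL : ContinuousOn L (Set.Icc 0 1)) (hL1 : ∀ t ∈ Set.Icc (0 : ℝ) 1, ‖L t‖ ≤ 1 / 2) (f₀ : F) :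
    ∃ φ : ℝ → F, φ 0 = f₀ ∧
      ∀ t ∈ Set.Icc (0 : ℝ) 1, HasDerivWithinAt φ (L t (φ t)) (Set.Icc 0 1) t := by
  -- On the ball of radius `‖f₀‖ + 1` about `f₀` the speed is at most `(2 ‖f₀‖ + 1) / 2`, so
  -- solutions stay in it over the whole interval `[0, 1]`.
  have h : IsPicardLindelof (fun t φ => L t φ) (⟨0, by simp⟩ : Set.Icc (0 : ℝ) 1) f₀ (‖f₀‖₊ + 1) 0
      (‖f₀‖₊ + 1) 1 := by
    refine ⟨fun t ht => ?_, fun x _ => hL.clm_apply continuousOn_const, fun t ht x hx => ?_, ?_⟩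
    · refine ((L t).lipschitz.weaken ?_).lipschitzOnWith
      exact_mod_cast (hL1 t ht).trans (by norm_num)
    · have h1 : ‖x‖ ≤ ‖f₀‖ + (‖f₀‖ + 1) := by
        have := norm_le_norm_add_norm_sub f₀ x
        rw [mem_closedBall_iff_norm', NNReal.coe_add, coe_nnnorm, NNReal.coe_one] at hx
        linarith
      have h2 := (L t).le_of_opNorm_le (hL1 t ht) x
      push_cast
      linarith
    · simp
  exact h.exists_eq_forall_mem_Icc_hasDerivWithinAt₀

/-- Solutions of a linear equation with small coefficients depend on the coefficients in a Lipschitz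
way. -/
theorem norm_sub_le_of_approx_linear_ODE {L : ℝ → F →L[ℝ] F}
    (hL1 : ∀ t ∈ Set.Icc (0 : ℝ) 1, ‖L t‖ ≤ 1 / 2) {φ ψ ψ' : ℝ → F} {ε : ℝ} (hε : 0 ≤ ε)
    (hφ : ∀ t ∈ Set.Icc (0 : ℝ) 1, HasDerivWithinAt φ (L t (φ t)) (Set.Icc 0 1) t)
    (hψ : ∀ t ∈ Set.Icc (0 : ℝ) 1, HasDerivWithinAt ψ (ψ' t) (Set.Icc 0 1) t)
    (hb : ∀ t ∈ Set.Icc (0 : ℝ) 1, ‖ψ' t - L t (ψ t)‖ ≤ ε) (h0 : φ 0 = ψ 0) :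
    ‖φ 1 - ψ 1‖ ≤ 2 * ε := by
  have h := dist_le_of_approx_trajectories_ODE_of_mem (K := 1) (v := fun t x => L t x)
    (s := fun _ => Set.univ) (a := 0) (b := 1) (f := φ) (g := ψ) (f' := fun t => L t (φ t))
    (g' := ψ') (εf := 0) (εg := ε) (δ := 0)
    (fun t ht => ((L t).lipschitz.weaken (by
      exact_mod_cast (hL1 t (Set.Ico_subset_Icc_self ht)).trans (by norm_num))).lipschitzOnWith)
    (fun t ht => (hφ t ht).continuousWithinAt)
    (fun t ht => (hφ t (Set.Ico_subset_Icc_self ht)).mono_of_mem_nhdsWithin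
      (Icc_mem_nhdsGE_of_mem ht)) (fun t _ => by simp) (fun _ _ => Set.mem_univ _)
    (fun t ht => (hψ t ht).continuousWithinAt)
    (fun t ht => (hψ t (Set.Ico_subset_Icc_self ht)).mono_of_mem_nhdsWithin
      (Icc_mem_nhdsGE_of_mem ht))
    (fun t ht => by rw [dist_eq_norm]; exact hb t (Set.Ico_subset_Icc_self ht))
    (fun _ _ => Set.mem_univ _) (by simp [h0]) 1 (by simp)
  rw [dist_eq_norm, NNReal.coe_one, gronwallBound_of_K_ne_0 one_ne_zero] at h
  -- The Grönwall bound with Lipschitz constant `1` at time `1` is `ε (e - 1)`.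
  have he : Real.exp 1 - 1 ≤ 2 := by linarith [Real.exp_one_lt_d9]
  simp only [zero_mul, zero_add, div_one, sub_zero, mul_one] at h
  linarith [mul_le_mul_of_nonneg_left he hε]

variable {A : E → E →L[ℝ] F →L[ℝ] F} {a : E} {U : Set E}

/-- Near every point a flat linear system `df(v) = A(v) f` has a solution with given value at the
point. -/
theorem exists_forall_hasFDerivAt_of_flat [CompleteSpace F] (hU : IsOpen U) (ha : a ∈ U)
    (hA : ContDiffOn ℝ ∞ A U)
    (hflat : ∀ x ∈ U, ∀ v w f, fderiv ℝ A x v w f + A x w (A x v f)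
      = fderiv ℝ A x w v f + A x v (A x w f)) :
    ∃ r > 0, Metric.ball a r ⊆ U ∧ ∀ f₀ : F, ∃ f : E → F, f a = f₀ ∧
      ∀ x ∈ Metric.ball a r, HasFDerivAt f ((A x).flip (f x)) x := by
  have hD : ContDiffOn ℝ ∞ (fderiv ℝ A) U := hA.fderiv_of_isOpen hU (by simp)
  have hDa : ContDiffAt ℝ 1 (fderiv ℝ A) a := (hD.contDiffAt (hU.mem_nhds ha)).of_le (by simp)
  obtain ⟨K, T, hT, hK⟩ := hDa.exists_lipschitzOnWith
  have e1 : ∀ᶠ x in 𝓝 a, ‖A x‖ < ‖A a‖ + 1 :=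
    (hA.contDiffAt (hU.mem_nhds ha)).continuousAt.norm.eventually_lt_const (by linarith)
  have e2 : ∀ᶠ x in 𝓝 a, ‖fderiv ℝ A x‖ < ‖fderiv ℝ A a‖ + 1 :=
    hDa.continuousAt.norm.eventually_lt_const (by linarith)
  obtain ⟨r₀, hr₀, hball⟩ := Metric.eventually_nhds_iff.1
    (e1.and (e2.and ((hU.eventually_mem ha).and hT)))
  set C := max (‖A a‖ + 1) (‖fderiv ℝ A a‖ + 1) with hC
  have hC1 : 1 ≤ C := le_trans (by linarith [norm_nonneg (A a)]) (le_max_left _ _)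
  -- With `C r ≤ 1 / 2`, the radial equations have coefficients of norm at most `1 / 2` and are
  -- solvable up to time `1`.
  set r := min r₀ (1 / (2 * C)) with hr
  have hr0 : 0 < r := lt_min hr₀ (by positivity)
  have hrC : C * r ≤ 1 / 2 := by
    have := mul_le_mul_of_nonneg_left (min_le_right r₀ (1 / (2 * C))) (zero_le_one.trans hC1)
    rwa [show C * (1 / (2 * C)) = 1 / 2 by field_simp] at this
  have hr1 : r ≤ 1 := by nlinarith
  set B := Metric.ball a r with hB
  have hBU : ∀ x ∈ B, x ∈ U := fun x hx =>
    (hball (lt_of_lt_of_le hx (min_le_left _ _))).2.2.1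
  have hBT : ∀ x ∈ B, x ∈ T := fun x hx =>
    (hball (lt_of_lt_of_le hx (min_le_left _ _))).2.2.2
  have bA : ∀ x ∈ B, ‖A x‖ ≤ C := fun x hx =>
    (hball (lt_of_lt_of_le hx (min_le_left _ _))).1.le.trans (le_max_left _ _)
  have bD : ∀ x ∈ B, ‖fderiv ℝ A x‖ ≤ C := fun x hx =>
    (hball (lt_of_lt_of_le hx (min_le_left _ _))).2.1.le.trans (le_max_right _ _)
  have hBc : Convex ℝ B := convex_ball a r
  have hdA : ∀ x ∈ B, HasFDerivAt A (fderiv ℝ A x) x := fun x hx =>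
    ((hA.contDiffAt (hU.mem_nhds (hBU x hx))).differentiableAt (by simp)).hasFDerivAt
  have lipA : ∀ x ∈ B, ∀ y ∈ B, ‖A y - A x‖ ≤ C * ‖y - x‖ := fun x hx y hy =>
    hBc.norm_image_sub_le_of_norm_hasFDerivWithin_le (fun x hx => (hdA x hx).hasFDerivWithinAt)
      bD hx hy
  have taylor : ∀ x ∈ B, ∀ y ∈ B, ‖A y - A x - fderiv ℝ A x (y - x)‖ ≤ K * ‖y - x‖ ^ 2 :=
    fun x hx y hy => by
    have hseg : segment ℝ x y ⊆ B := hBc.segment_subset hx hy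
    have := (convex_segment (𝕜 := ℝ) x y).norm_image_sub_le_of_norm_hasFDerivWithin_le'
      (f := A) (f' := fderiv ℝ A) (φ := fderiv ℝ A x) (C := K * ‖y - x‖)
      (fun z hz => (hdA z (hseg hz)).hasFDerivWithinAt) (fun z hz => by
        refine (hK.norm_sub_le (hBT z (hseg hz)) (hBT x hx)).trans ?_
        gcongr
        exact norm_sub_le_of_mem_segment hz) (left_mem_segment ℝ x y) (right_mem_segment ℝ x y)
    rwa [mul_assoc, ← sq] at this
  have hγ : ∀ x ∈ B, ∀ t ∈ Set.Icc (0 : ℝ) 1, a + t • (x - a) ∈ B := fun x hx t ht =>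
    hBc.add_smul_sub_mem (Metric.mem_ball_self hr0) hx ht
  have bz : ∀ x ∈ B, ‖x - a‖ ≤ r := fun x hx => (mem_ball_iff_norm.1 hx).le
  have bL : ∀ x ∈ B, ∀ t ∈ Set.Icc (0 : ℝ) 1, ‖A (a + t • (x - a)) (x - a)‖ ≤ 1 / 2 :=
    fun x hx t ht => ((A _).le_opNorm _).trans ((mul_le_mul (bA _ (hγ x hx t ht)) (bz x hx)
      (norm_nonneg _) (zero_le_one.trans hC1)).trans hrC)
  refine ⟨r, hr0, hBU, fun f₀ => ?_⟩
  -- The candidate solution at `x` is the value at time `1` of the equation restricted to the ray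
  -- from `a` to `x`.
  have hsol : ∀ x : E, ∃ φ : ℝ → F, x ∈ B → φ 0 = f₀ ∧ ∀ t ∈ Set.Icc (0 : ℝ) 1,
      HasDerivWithinAt φ (A (a + t • (x - a)) (x - a) (φ t)) (Set.Icc 0 1) t := fun x => by
    by_cases hx : x ∈ B
    · obtain ⟨φ, hφ⟩ := exists_linear_ODE_solution (L := fun t => A (a + t • (x - a)) (x - a))
        (fun t ht => by
          have := (hdA _ (hγ x hx t ht)).continuousAt
          exact ((ContinuousAt.comp (f := fun t : ℝ => a + t • (x - a)) this
            (by fun_prop)).clm_apply continuousAt_const).continuousWithinAt) (bL x hx) f₀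
      exact ⟨φ, fun _ => hφ⟩
    · exact ⟨fun _ => 0, fun h => absurd h hx⟩
  choose φ hφ using hsol
  refine ⟨fun x => φ x 1, ?_, fun x hx => ?_⟩
  · have haB : a ∈ B := Metric.mem_ball_self hr0
    have := norm_sub_le_of_approx_linear_ODE (bL a haB) le_rfl (hφ a haB).2
      (ψ := fun _ => f₀) (ψ' := fun _ => 0) (fun t _ => hasDerivWithinAt_const _ _ _)
      (fun t _ => by simp) (hφ a haB).1
    rw [mul_zero, norm_le_zero_iff, sub_eq_zero] at this
    exact this
  obtain ⟨h0, hd⟩ := hφ x hx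
  have hcont : ContinuousOn (φ x) (Set.Icc 0 1) := fun t ht => (hd t ht).continuousWithinAt
  obtain ⟨Φ, hΦ⟩ := isCompact_Icc.exists_bound_of_continuousOn hcont
  have hΦ0 : 0 ≤ Φ := (norm_nonneg _).trans (hΦ 0 (by simp))
  -- The ray to `x + v` is compared with `φ x t + t A(v) φ x t`. Flatness makes this curve solve the
  -- equation of the new ray up to an error of order `‖v‖²`, so the difference of the values at time
  -- `1` is quadratic in `v`.
  have key : ∀ y ∈ B, ‖φ y 1 - (φ x 1 + A x (y - x) (φ x 1))‖
      ≤ 2 * ((K + C + 2 * C ^ 2) * Φ * ‖y - x‖ ^ 2) := fun y hy => by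
    obtain ⟨v, rfl⟩ : ∃ v, y = x + v := ⟨y - x, by abel⟩
    rw [add_sub_cancel_left]
    have h1 : ∀ t ∈ Set.Icc (0 : ℝ) 1, HasDerivWithinAt
        (fun t => φ x t + t • A (a + t • (x - a)) v (φ x t))
        (A (a + t • (x - a)) (x - a) (φ x t) + (t • (fderiv ℝ A (a + t • (x - a)) (x - a) v (φ x t)
          + A (a + t • (x - a)) v (A (a + t • (x - a)) (x - a) (φ x t)))
          + (1 : ℝ) • A (a + t • (x - a)) v (φ x t))) (Set.Icc 0 1) t := fun t ht => by
      have g1 : HasDerivAt (fun t : ℝ => a + t • (x - a)) (x - a) t := by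
        simpa using ((hasDerivAt_id t).smul_const (x - a)).const_add a
      have g2 := (hdA _ (hγ x hx t ht)).comp_hasDerivAt t g1
      have g3 : HasDerivAt (fun t : ℝ => A (a + t • (x - a)) v)
          (fderiv ℝ A (a + t • (x - a)) (x - a) v) t := by
        simpa using g2.clm_apply (hasDerivAt_const t v)
      exact (hd t ht).add ((hasDerivAt_id t).hasDerivWithinAt.smul
        (g3.hasDerivWithinAt.clm_apply (hd t ht)))
    have h2 := norm_sub_le_of_approx_linear_ODE (bL (x + v) hy)
      (ε := (K + C + 2 * C ^ 2) * Φ * ‖v‖ ^ 2) (by positivity) (hφ (x + v) hy).2 h1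
      (fun t ht => ?_) (by simp [h0, (hφ (x + v) hy).1])
    · simpa using h2
    have hp := hγ x hx t ht
    have hq := hγ (x + v) hy t ht
    have hqp : (a + t • (x + v - a)) - (a + t • (x - a)) = t • v := by
      rw [add_sub_add_left_eq_sub, ← smul_sub]; congr 1; abel
    have hf := hflat _ (hBU _ hp) (x - a) v (φ x t)
    have t1 := taylor _ hp _ hq
    have t2 := lipA _ hp _ hq
    have t3 := bA _ hp
    have t4 := bA _ hq
    have t5 := hΦ t ht
    have t6 := (bz x hx).trans hr1
    rw [hqp] at t1 t2
    rw [hf]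
    set A₀ := A (a + t • (x - a))
    set A₁ := A (a + t • (x + v - a))
    set D := fderiv ℝ A (a + t • (x - a))
    set z := x - a
    set f := φ x t
    have ez : x + v - a = z + v := by simp only [z]; abel
    have tv : ‖t • v‖ ≤ ‖v‖ := by
      rw [norm_smul, Real.norm_of_nonneg ht.1]
      exact mul_le_of_le_one_left (norm_nonneg _) ht.2
    -- Four error terms: the Taylor remainder (bounded with `K`), one first-order difference of `A`
    -- (`C`), and two terms with iterated coefficients (`C²` each).
    have edec : A₀ z f + (t • (D v z f + A₀ z (A₀ v f)) + (1 : ℝ) • A₀ v f)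
        - A₁ (x + v - a) (f + t • A₀ v f)
        = -((A₁ - A₀ - D (t • v)) z f + (A₁ - A₀) v f + t • (A₁ - A₀) z (A₀ v f)
          + t • A₁ v (A₀ v f)) := by
      rw [ez]
      simp only [map_add, map_smul, add_apply, sub_apply, smul_apply, smul_add, smul_sub, one_smul]
      abel
    rw [edec, norm_neg]
    have b1 : ‖A₁ - A₀ - D (t • v)‖ ≤ K * ‖v‖ ^ 2 := t1.trans (by gcongr)
    have b2 : ‖A₁ - A₀‖ ≤ C * ‖v‖ := t2.trans (by gcongr)
    have op : ∀ (M : E →L[ℝ] F →L[ℝ] F) (p : E) (q : F) {m n k : ℝ}, ‖M‖ ≤ m → ‖p‖ ≤ n → ‖q‖ ≤ k →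
        ‖M p q‖ ≤ m * n * k := fun M p q {m n k} hm hn hk => by
      have m0 : 0 ≤ m := (norm_nonneg M).trans hm
      have n0 : 0 ≤ n := (norm_nonneg p).trans hn
      calc ‖M p q‖ ≤ ‖M‖ * ‖p‖ * ‖q‖ := M.le_opNorm₂ p q
        _ ≤ m * n * k := by gcongr
    have sm : ∀ q : F, ‖t • q‖ ≤ ‖q‖ := fun q => by
      rw [norm_smul, Real.norm_of_nonneg ht.1]
      exact mul_le_of_le_one_left (norm_nonneg _) ht.2
    have b3 := op A₀ v f t3 le_rfl t5
    have c1 := op _ z f b1 t6 t5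
    have c2 := op _ v f b2 le_rfl t5
    have c3 := (sm _).trans (op _ z (A₀ v f) b2 t6 b3)
    have c4 := (sm _).trans (op _ v (A₀ v f) t4 le_rfl b3)
    refine (norm_add_le _ _).trans ?_
    have := norm_add₃_le (a := (A₁ - A₀ - D (t • v)) z f) (b := (A₁ - A₀) v f)
      (c := t • (A₁ - A₀) z (A₀ v f))
    linarith
  have hO : (fun y => φ y 1 - (φ x 1 + A x (y - x) (φ x 1))) =O[𝓝 x] fun y => ‖y - x‖ ^ 2 := by
    refine Asymptotics.IsBigO.of_bound (2 * ((K + C + 2 * C ^ 2) * Φ)) ?_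
    filter_upwards [Metric.isOpen_ball.mem_nhds hx] with y hy
    rw [norm_pow, norm_norm]
    exact (key y hy).trans (le_of_eq (by ring))
  have h3 := hO.hasFDerivAt (𝕜 := ℝ) one_lt_two
  have h4 : HasFDerivAt (fun y => φ x 1 + A x (y - x) (φ x 1)) ((A x).flip (φ x 1)) x := by
    have := ((A x).flip (φ x 1)).hasFDerivAt.comp x ((hasFDerivAt_id x).sub_const x)
    exact (this.const_add (φ x 1)).congr_fderiv (by ext; simp)
  exact ((h3.add h4).congr_fderiv (zero_add _)).congr_of_eventuallyEq
    (Filter.Eventually.of_forall fun y => by simp)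

/-- Bootstrapping: the equation expresses the derivative of `f` through `f`, so each order of
smoothness gives the next one. -/
theorem contDiffOn_of_hasFDerivAt_linear (hU : IsOpen U) (hA : ContDiffOn ℝ ∞ A U) {f : E → F}
    (hf : ∀ x ∈ U, HasFDerivAt f ((A x).flip (f x)) x) : ContDiffOn ℝ ∞ f U := by
  rw [contDiffOn_infty]
  intro n
  induction n with
  | zero => exact contDiffOn_zero.2 fun x hx => (hf x hx).continuousAt.continuousWithinAt
  | succ n ih =>
    rw [Nat.cast_succ, contDiffOn_succ_iff_fderiv_of_isOpen hU]
    refine ⟨fun x hx => (hf x hx).differentiableAt.differentiableWithinAt, by simp, ?_⟩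
    refine ContDiffOn.congr ?_ fun x hx => (hf x hx).fderiv
    have h1 : ContDiffOn ℝ n A U := hA.of_le (by exact_mod_cast le_top)
    have h2 := (ContinuousLinearMap.flipₗᵢ ℝ E F F).toContinuousLinearEquiv.contDiff.comp_contDiffOn
      (n := (n : WithTop ℕ∞)) h1
    exact h2.clm_apply ih

end FlatSystem

/-! ### Existence of annihilators and of a momentum -/

namespace HydroBracket

variable {N : ℕ} {U : Set (Fin N → ℝ)} {Q : HydroBracket N}

/-- The linear system for a function `f`, its differential `θ` and a constant `τ`, with `τ = 0` for
densities of annihilators and `τ = 1` for densities of momenta of a local bracket. -/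
noncomputable def densitySystem (Q : HydroBracket N) (p : Fin N → ℝ) :
    (Fin N → ℝ) →L[ℝ] (ℝ × (Fin N → ℝ) × ℝ) →L[ℝ] (ℝ × (Fin N → ℝ) × ℝ) :=
  (LinearMap.mk₂ ℝ (fun (v : Fin N → ℝ) (f : ℝ × (Fin N → ℝ) × ℝ) =>
    ((⟪f.2.1, v⟫, (Q.gL p).inverse (f.2.2 • v - Q.bL p v f.2.1), 0) : ℝ × (Fin N → ℝ) × ℝ))
    (fun v w f => by ext <;> simp; ring) (fun c v f => by ext <;> simp; ring)
    (fun v f k => by ext <;> simp [add_smul]; ring)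
    (fun c v f => by ext <;> simp [mul_assoc]; ring)).toContinuousBilinearMap

theorem densitySystem_apply (p v : Fin N → ℝ) (f : ℝ × (Fin N → ℝ) × ℝ) :
    Q.densitySystem p v f
      = (⟪f.2.1, v⟫, (Q.gL p).inverse (f.2.2 • v - Q.bL p v f.2.1), 0) := rfl

/-- The points of `U` at which the bracket is nondegenerate. -/
def regularSet (Q : HydroBracket N) (U : Set (Fin N → ℝ)) : Set (Fin N → ℝ) :=
  {a | a ∈ U ∧ Matrix.det (Matrix.of (Q.g a)) ≠ 0}

theorem SmoothOn.isOpen_regularSet (hU : IsOpen U) (hQ : Q.SmoothOn U) :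
    IsOpen (Q.regularSet U) := by
  have hc : ContinuousOn (fun a => Matrix.det (Matrix.of (Q.g a))) U := by
    simp only [Matrix.det_apply]
    refine continuousOn_finsetSum _ fun σ _ => ContinuousOn.const_smul
      (continuousOn_finsetProd _ fun i _ => (hQ.1 _ _).continuousOn) _
  exact hc.isOpen_inter_preimage hU isOpen_compl_singleton

theorem exists_equiv_of_mem_regularSet {p : Fin N → ℝ} (hp : p ∈ Q.regularSet U) :
    ∃ e : (Fin N → ℝ) ≃L[ℝ] (Fin N → ℝ), (e : (Fin N → ℝ) →L[ℝ] (Fin N → ℝ)) = Q.gL p := by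
  obtain ⟨H, h1, h2⟩ := exists_inverse_gL hp.2
  exact ⟨ContinuousLinearEquiv.equivOfInverse (Q.gL p) H h2 h1, by ext; rfl⟩

theorem gL_inverse {p : Fin N → ℝ} (hp : p ∈ Q.regularSet U) (v : Fin N → ℝ) :
    Q.gL p ((Q.gL p).inverse v) = v := by
  obtain ⟨e, he⟩ := exists_equiv_of_mem_regularSet hp
  rw [← he, ContinuousLinearMap.inverse_equiv]
  simp

theorem SmoothOn.contDiffOn_inverse (hU : IsOpen U) (hQ : Q.SmoothOn U) :
    ContDiffOn ℝ ∞ (fun p => (Q.gL p).inverse) (Q.regularSet U) := fun p hp => by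
  obtain ⟨e, he⟩ := exists_equiv_of_mem_regularSet hp
  have h1 : ContDiffAt ℝ ∞ ContinuousLinearMap.inverse (Q.gL p) := he ▸ contDiffAt_map_inverse e
  exact (h1.comp p (hQ.contDiffOn_gL.contDiffAt (hU.mem_nhds hp.1))).contDiffWithinAt

theorem SmoothOn.contDiffOn_densitySystem (hU : IsOpen U) (hQ : Q.SmoothOn U) :
    ContDiffOn ℝ ∞ Q.densitySystem (Q.regularSet U) := by
  refine contDiffOn_clm_apply.2 fun v => contDiffOn_clm_apply.2 fun f => ?_
  simp only [densitySystem_apply]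
  refine contDiffOn_const.prodMk (ContDiffOn.prodMk ?_ contDiffOn_const)
  exact (hQ.contDiffOn_inverse hU).clm_apply (contDiffOn_const.sub
    (((hQ.contDiffOn_bL.mono fun _ h => h.1).clm_apply contDiffOn_const).clm_apply
      contDiffOn_const))

/-- Carrying the constant `τ` as an unknown makes the inhomogeneous momentum equation linear and
homogeneous. Integrability of the scalar component is symmetry of `g⁻¹` and absence of torsion; that
of the covector component is zero curvature, where locality enters. -/
theorem IsPoisson.densitySystem_flat (hU : IsOpen U) (hQ : Q.SmoothOn U) (hQp : Q.IsPoisson U)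
    (hK : Q.K = 0) {p : Fin N → ℝ} (hp : p ∈ Q.regularSet U) (v w : Fin N → ℝ)
    (f : ℝ × (Fin N → ℝ) × ℝ) :
    fderiv ℝ Q.densitySystem p v w f + Q.densitySystem p w (Q.densitySystem p v f)
      = fderiv ℝ Q.densitySystem p w v f + Q.densitySystem p v (Q.densitySystem p w f) := by
  have hR := hQ.isOpen_regularSet hU
  obtain ⟨c, θ, τ⟩ := f
  have hY := hQp.jet_isPoisson hU hQ hp.1
  have hm := hQp.isMetric hU hQ p hp.1
  have hGH : ∀ v, (Q.jet p).G ((Q.gL p).inverse v) = v := gL_inverse hp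
  set H := (Q.gL p).inverse with hH
  have hs := ((hQ.contDiffOn_densitySystem hU).contDiffAt (hR.mem_nhds hp)).differentiableAt
    (by simp)
  have hi := ((hQ.contDiffOn_inverse hU).contDiffAt (hR.mem_nhds hp)).differentiableAt (by simp)
  have hb := (hQ.hasFDerivAt_bL hU hp.1)
  have hg := (hQ.hasFDerivAt_gL hU hp.1)
  let s : (Fin N → ℝ) → (Fin N → ℝ) → Fin N → ℝ := fun w x =>
    (Q.gL x).inverse (τ • w - Q.bL x w θ)
  have hs' : ∀ w, DifferentiableAt ℝ (s w) p := fun w =>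
    hi.clm_apply ((differentiableAt_const _).sub
      ((hb.differentiableAt.clm_apply (differentiableAt_const _)).clm_apply
        (differentiableAt_const _)))
  have hD : ∀ v w, fderiv ℝ Q.densitySystem p v w (c, θ, τ) = (0, fderiv ℝ (s w) p v, 0) := by
    intro v w
    have h1 : HasFDerivAt (fun x => Q.densitySystem x w (c, θ, τ))
        ((fderiv ℝ Q.densitySystem p).flip w |>.flip (c, θ, τ)) p := by
      simpa using (hs.hasFDerivAt.clm_apply (hasFDerivAt_const w p)).clm_apply
        (hasFDerivAt_const (c, θ, τ) p)
    have h2 : HasFDerivAt (fun x => Q.densitySystem x w (c, θ, τ)) ((0 : (Fin N → ℝ) →L[ℝ] ℝ).prod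
        ((fderiv ℝ (s w) p).prod 0)) p :=
      (hasFDerivAt_const _ _).prodMk ((hs' w).hasFDerivAt.prodMk (hasFDerivAt_const _ _))
    exact DFunLike.congr_fun (h1.unique h2) v
  -- The derivative of `g⁻¹` is avoided by differentiating the identity `g s = τ w - b(w) θ`.
  have hGs : ∀ v w, Q.gL p (fderiv ℝ (s w) p v)
      = -fderiv ℝ Q.bL p v w θ - fderiv ℝ Q.gL p v (s w p) := by
    intro v w
    have h1 := hg.clm_apply (hs' w).hasFDerivAt
    have h2 : HasFDerivAt (fun x => τ • w - Q.bL x w θ)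
        (-((fderiv ℝ Q.bL p).flip w |>.flip θ)) p := by
      have h3 := (hasFDerivAt_const (τ • w) p).sub
        ((hb.clm_apply (hasFDerivAt_const w p)).clm_apply (hasFDerivAt_const θ p))
      exact h3.congr_fderiv (by ext; simp)
    have h4 : (fun x => Q.gL x (s w x)) =ᶠ[𝓝 p] fun x => τ • w - Q.bL x w θ :=
      Filter.eventually_of_mem (hR.mem_nhds hp) fun x hx => gL_inverse hx _
    have h5 := DFunLike.congr_fun (h1.unique (h2.congr_of_eventuallyEq h4)) v
    simp only [add_apply, ContinuousLinearMap.comp_apply, ContinuousLinearMap.flip_apply,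
      neg_apply] at h5
    exact eq_sub_of_add_eq h5
  have hsp : ∀ w, s w p = τ • H w + (Q.jet p).parallel H θ w := fun w => by
    simp only [s, HydroJet.parallel_apply, ← hH, map_sub, map_smul]
    rw [sub_eq_add_neg]
    rfl
  rw [hD, hD]
  simp only [densitySystem_apply, ← hH, zero_smul, zero_sub]
  have e1 : ∀ v, H (τ • v - Q.bL p v θ) = s v p := fun v => rfl
  simp only [e1, Prod.mk_add_mk, zero_add, add_zero, Prod.mk.injEq, and_true]
  constructor
  · simp only [hsp, map_add, map_smul, add_apply, smul_apply]
    rw [HydroJet.pairL_inv_comm hGH hY v w, HydroJet.pairL_parallel_comm hGH hY θ v w]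
  have hinj : Function.Injective (Q.gL p) := by
    obtain ⟨e, he⟩ := exists_equiv_of_mem_regularSet hp
    rw [← he]
    exact e.injective
  refine hinj (eq_of_forall_pairL fun ξ => ?_)
  have hGH' : ∀ v, Q.gL p (H v) = v := hGH
  simp only [map_add, map_neg, hGs, hGH', map_sub, hm]
  have hc := HydroJet.curv_nondegenerate hGH hY v w ξ θ
  have hB : ∀ a v, ⟪a, Q.bL p v ξ⟫ = -⟪(Q.jet p).parallel H ξ v, Q.gL p a⟫ := fun a v => by
    have := HydroJet.B_eq_parallel hGH ξ v
    change Q.bL p v ξ = _ at this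
    rw [this, map_neg, hY.symm]
    rfl
  have hcomm := HydroJet.pairL_parallel_comm hGH hY ξ v w
  have hsymm := hY.symm ((Q.jet p).parallel H θ v) ((Q.jet p).parallel H ξ w)
  rw [HydroJet.curv, show (Q.jet p).K = 0 from hK] at hc
  change ⟪ξ, fderiv ℝ Q.bL p v w θ⟫ - ⟪ξ, fderiv ℝ Q.bL p w v θ⟫ - _ = _ at hc
  change ⟪_, Q.gL p _⟫ = ⟪_, Q.gL p _⟫ at hsymm
  simp only [show (Q.jet p).G = Q.gL p from rfl] at hc
  simp only [hB]
  simp only [hsp, map_add, map_smul, hGH', smul_eq_mul]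
  rw [hcomm]
  linarith

/-- Local solvability of the equations for densities of annihilators and momenta. -/
theorem IsPoisson.exists_density (hU : IsOpen U) (hQ : Q.SmoothOn U) (hQp : Q.IsPoisson U)
    (hK : Q.K = 0) {a : Fin N → ℝ} (ha : a ∈ Q.regularSet U) :
    ∃ r > 0, Metric.ball a r ⊆ Q.regularSet U ∧ ∀ (ξ : Fin N → ℝ) (τ : ℝ), ∃ f : (Fin N → ℝ) → ℝ,
      ContDiffOn ℝ ∞ f (Metric.ball a r) ∧ fderiv ℝ f a = pairL ξ ∧
      ∀ p ∈ Metric.ball a r, ∀ v, Q.gL p (fderiv ℝ (gradCovector f) p v)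
        + Q.bL p v (gradCovector f p) = τ • v := by
  have hR := hQ.isOpen_regularSet hU
  obtain ⟨r, hr, hball, hsol⟩ := exists_forall_hasFDerivAt_of_flat hR ha
    (hQ.contDiffOn_densitySystem hU) fun p hp v w f => hQp.densitySystem_flat hU hQ hK hp v w f
  refine ⟨r, hr, hball, fun ξ τ => ?_⟩
  obtain ⟨F, hF0, hF⟩ := hsol (0, ξ, τ)
  have haB : a ∈ Metric.ball a r := Metric.mem_ball_self hr
  have hFs := contDiffOn_of_hasFDerivAt_linear Metric.isOpen_ball
    ((hQ.contDiffOn_densitySystem hU).mono hball) hF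
  have h1 : ∀ p ∈ Metric.ball a r, HasFDerivAt (fun p => (F p).1) (pairL (F p).2.1) p :=
    fun p hp => (hF p hp).fst.congr_fderiv (by ext; rfl)
  have h2 : ∀ p ∈ Metric.ball a r, HasFDerivAt (fun p => (F p).2.1)
      ((ContinuousLinearMap.fst ℝ _ _).comp ((ContinuousLinearMap.snd ℝ _ _).comp
        ((Q.densitySystem p).flip (F p)))) p :=
    fun p hp => (hF p hp).snd.fst
  have h3 : ∀ p ∈ Metric.ball a r, HasFDerivAt (fun p => (F p).2.2) (0 : (Fin N → ℝ) →L[ℝ] ℝ) p :=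
    fun p hp => (hF p hp).snd.snd.congr_fderiv (by ext; rfl)
  -- The third component of the system is zero, so `τ` keeps its initial value on the connected
  -- ball.
  have hτ : ∀ p ∈ Metric.ball a r, (F p).2.2 = τ := fun p hp => by
    rw [Metric.isOpen_ball.is_const_of_fderiv_eq_zero (f := fun p => (F p).2.2)
      (convex_ball a r).isPreconnected
      (fun p hp => (h3 p hp).differentiableAt.differentiableWithinAt)
      (fun p hp => (h3 p hp).fderiv) hp haB, hF0]
  have hgrad : ∀ p ∈ Metric.ball a r, gradCovector (fun p => (F p).1) p = (F p).2.1 :=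
    fun p hp => by rw [gradCovector, (h1 p hp).fderiv, covectorL_pairL]
  refine ⟨fun p => (F p).1, hFs.fst, by rw [(h1 a haB).fderiv, hF0], fun p hp v => ?_⟩
  have h4 : gradCovector (fun p => (F p).1) =ᶠ[𝓝 p] fun p => (F p).2.1 :=
    Filter.eventually_of_mem (Metric.isOpen_ball.mem_nhds hp) hgrad
  rw [h4.fderiv_eq, (h2 p hp).fderiv, hgrad p hp]
  change Q.gL p ((Q.gL p).inverse ((F p).2.2 • v - Q.bL p v (F p).2.1)) + _ = _
  rw [gL_inverse (hball hp), hτ p hp, sub_add_cancel]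

theorem IsPoisson.exists_annihilatorsAndMomentum (hU : IsOpen U) (hQ : Q.SmoothOn U)
    (hQp : Q.IsPoisson U) (hK : Q.K = 0) {a : Fin N → ℝ} (ha : a ∈ U)
    (hdet : Matrix.det (Matrix.of (Q.g a)) ≠ 0) :
    ∃ V ⊆ U, IsOpen V ∧ Convex ℝ V ∧ a ∈ V ∧ ∃ n m, Q.IsAnnihilatorsAndMomentum V n m := by
  obtain ⟨r, hr, hball, hsol⟩ := hQp.exists_density hU hQ hK ⟨ha, hdet⟩
  have haB : a ∈ Metric.ball a r := Metric.mem_ball_self hr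
  -- Initial covectors `e_i` make the differentials independent at `a`, hence on a smaller ball
  -- because independence is an open condition. For the momentum any initial covector would do.
  choose n hn hna hneq using fun i : Fin N => hsol (Pi.single i 1) 0
  obtain ⟨m, hm, -, hmeq⟩ := hsol 0 1
  have hc : ContinuousAt (fun p => fun i => fderiv ℝ (n i) p) a := continuousAt_pi.2 fun i =>
    ((hn i).fderiv_of_isOpen Metric.isOpen_ball (m := ∞) (by simp)).continuousOn.continuousAt
      (Metric.isOpen_ball.mem_nhds haB)
  have hind : LinearIndependent ℝ fun i => fderiv ℝ (n i) a := by
    rw [Fintype.linearIndependent_iff]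
    intro g hg i
    have := DFunLike.congr_fun hg (Pi.single i 1)
    simpa [hna, pairL_single_left, Pi.single_apply] using this
  obtain ⟨r', hr', hball'⟩ := Metric.eventually_nhds_iff.1
    (hc.eventually (isOpen_setOfPred_linearIndependent.eventually_mem hind))
  have hsub : Metric.ball a (min r r') ⊆ Metric.ball a r := Metric.ball_subset_ball (min_le_left _ _)
  have hVU : Metric.ball a (min r r') ⊆ U := fun p hp => (hball (hsub hp)).1
  have hQV := hQ.mono hVU
  refine ⟨Metric.ball a (min r r'), hVU, Metric.isOpen_ball, convex_ball _ _,
    Metric.mem_ball_self (lt_min hr hr'), n, m, fun i => (hn i).mono hsub, hm.mono hsub,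
    fun p hp => hball' (lt_of_lt_of_le hp (min_le_right _ _)), fun i => ?_, ?_⟩
  · refine (isAnnihilator_iff Metric.isOpen_ball hQV
      (fun p hp => hQp.gL_symm (hVU hp)) ((hQp.isMetric hU hQ).mono hVU) hK
      ((hn i).mono hsub)).2 fun p hp v => ?_
    rw [hneq i p (hsub hp), zero_smul]
  · refine (isMomentum_iff Metric.isOpen_ball hQV hK (hm.mono hsub)).2 fun p hp v => ?_
    rw [hmeq p (hsub hp), one_smul]

end HydroBracket

/-! ### Assembly of the equivalences -/

theorem mainTheorem4 {N : ℕ} (U : Set (Fin N → ℝ)) (hU : IsOpen U)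
    (P₁ P₂ : HydroBracket N) (hs₁ : P₁.SmoothOn U) (hs₂ : P₂.SmoothOn U)
    (hP₁ : P₁.IsPoisson U) (hP₂ : P₂.IsPoisson U)
    (hloc : P₂.K = 0) (hnd : P₂.Nondegenerate U) :
    -- near every point of nondegeneracy there are `N` annihilators and a momentum
    (∀ a ∈ U, Matrix.det (Matrix.of (P₂.g a)) ≠ 0 →
      ∃ V ⊆ U, IsOpen V ∧ Convex ℝ V ∧ a ∈ V ∧ ∃ n m, P₂.IsAnnihilatorsAndMomentum V n m) ∧
    -- compatibility is equivalent to involution of all such annihilators and momenta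
    (P₁.Compatible P₂ U ↔
      ∀ V ⊆ U, IsOpen V → Convex ℝ V → ∀ n m, P₂.IsAnnihilatorsAndMomentum V n m →
        P₁.AnnihilatorsAndMomentumInInvolution V n m) ∧
    -- and to involution of some of them near every point of nondegeneracy
    (P₁.Compatible P₂ U ↔
      ∀ a ∈ U, Matrix.det (Matrix.of (P₂.g a)) ≠ 0 →
        ∃ V ⊆ U, IsOpen V ∧ Convex ℝ V ∧ a ∈ V ∧ ∃ n m, P₂.IsAnnihilatorsAndMomentum V n m ∧
          P₁.AnnihilatorsAndMomentumInInvolution V n m) := by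
  have hex := fun a (ha : a ∈ U) (hd : Matrix.det (Matrix.of (P₂.g a)) ≠ 0) =>
    hP₂.exists_annihilatorsAndMomentum hU hs₂ hloc ha hd
  -- For any given system, involution is the same pointwise condition on the two brackets. It does
  -- not depend on the chosen densities, which is why "every system" and "some system" agree.
  have hinv : ∀ V (hVU : V ⊆ U) (hV : IsOpen V) (hVc : Convex ℝ V) n m
      (h : P₂.IsAnnihilatorsAndMomentum V n m), P₁.AnnihilatorsAndMomentumInInvolution V n m ↔
        ∀ p ∈ V, HydroJet.Mixed (P₁.jet p) (P₂.jet p) := fun V hVU hV hVc n m h =>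
    h.inInvolution_iff hV hVc (hs₁.mono hVU) (fun p hp => hP₁.gL_symm (hVU hp))
      ((hP₁.isMetric hU hs₁).mono hVU) (hs₂.mono hVU) ((hP₂.isMetric hU hs₂).mono hVU)
      (fun p hp => hP₂.jet_isPoisson hU hs₂ (hVU hp)) hloc
  have hab : P₁.Compatible P₂ U → ∀ V ⊆ U, IsOpen V → Convex ℝ V → ∀ n m,
      P₂.IsAnnihilatorsAndMomentum V n m → P₁.AnnihilatorsAndMomentumInInvolution V n m :=
    fun hc V hVU hV hVc n m h => (hinv V hVU hV hVc n m h).2 fun p hp =>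
      hc.mixed hU hs₁ hs₂ hP₁ hP₂ (hVU hp)
  have hbc : (∀ V ⊆ U, IsOpen V → Convex ℝ V → ∀ n m, P₂.IsAnnihilatorsAndMomentum V n m →
      P₁.AnnihilatorsAndMomentumInInvolution V n m) →
      ∀ a ∈ U, Matrix.det (Matrix.of (P₂.g a)) ≠ 0 →
        ∃ V ⊆ U, IsOpen V ∧ Convex ℝ V ∧ a ∈ V ∧ ∃ n m, P₂.IsAnnihilatorsAndMomentum V n m ∧
          P₁.AnnihilatorsAndMomentumInInvolution V n m := fun hb a ha hd => by
    obtain ⟨V, hVU, hV, hVc, haV, n, m, h⟩ := hex a ha hd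
    exact ⟨V, hVU, hV, hVc, haV, n, m, h, hb V hVU hV hVc n m h⟩
  have hca : (∀ a ∈ U, Matrix.det (Matrix.of (P₂.g a)) ≠ 0 →
      ∃ V ⊆ U, IsOpen V ∧ Convex ℝ V ∧ a ∈ V ∧ ∃ n m, P₂.IsAnnihilatorsAndMomentum V n m ∧
        P₁.AnnihilatorsAndMomentumInInvolution V n m) → P₁.Compatible P₂ U := fun hc =>
    HydroBracket.compatible_of_mixed hU hs₁ hs₂ hP₁ hP₂ hnd fun a ha hd => by
      obtain ⟨V, hVU, hV, hVc, haV, n, m, h, hi⟩ := hc a ha hd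
      exact (hinv V hVU hV hVc n m h).1 hi a haV
  exact ⟨hex, ⟨hab, fun hb => hca (hbc hb)⟩, ⟨fun ha => hbc (hab ha), hca⟩⟩
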